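/- A prudent walk is a self-avoiding walk on the square lattice $\mathbb{Z}^2$, started at $(0,0)$, that never takes a step towards an already visited node (no node visited so far lies on the ray from the current node in the direction of the step). A 4-sided (i.e. unrestricted) prudent polygon is a prudent walk with more than one step that ends at a node adjacent to $(0,0)$; it is closed by the edge from its last node to $(0,0)$, its area is the number of enclosed unit cells, and its width and height are those of its bounding box. There are finitely many prudent polygons of each area; let $PA^{(4)}(q)=\sum_{n\ge1}PA^{(4)}_nq^n$, where $PA^{(4)}_n$ is the number of 4-sided prudent polygons of area $n$ (counted as walks). Divide the prudent polygons that end at $(-1,0)$ and are traversed counterclockwise into three classes. Class $\mathcal{X}$ consists of those for which removing the top row of cells neither changes the width nor leaves two or more disconnected pieces. Class $\mathcal{Y}$ consists of the unit square and of those not in $\mathcal{X}$ for which removing the rightmost column of cells neither changes the height nor leaves two or more disconnected pieces. Class $\mathcal{Z}$ consists of those in neither $\mathcal{X}$ nor $\mathcal{Y}$. Let $X(q,u,v)$, $Y(q,u,v)$, $Z(q,u,v)$ be the generating functions (formal power series) of these classes, where $q$ marks area in all three, and $(u,v)$ mark (width, height) in $X$, (height, width) in $Y$, and (width minus $1$,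 height) in $Z$. Then \begin{align*} X(q,u,v)&=\frac{qv}{1-q}[X(q,u,v)-X(q,qu,v)]+\frac{qv}{1-q}[Y(q,v,u)-Y(q,v,qu)]+\frac{quv}{1-q}[Z(q,u,v)-qZ(q,qu,v)],\\ Y(q,u,v)&=quv+\frac{qv}{1-q}[Y(q,u,v)-Y(q,qu,v)]+\frac{qv^2}{1-q}[Z(q,v,u)-Z(q,v,qu)]+quv[X(q,qv,u)+Y(q,u,qv)+qvZ(q,qv,u)],\\ Z(q,u,v)&=\frac{qv}{1-q}[Z(q,u,v)-Z(q,qu,v)]+qvY(q,qv,u)+quvZ(q,u,qv), \end{align*} and \begin{align*} PA^{(4)}(q)&=8[X(q,1,1)+Y(q,1,1)+Z(q,1,1)]\\ &=8q+16q^2+40q^3+96q^4+232q^5+560q^6+1336q^7+3176q^8+7480q^9+17528q^{10}+\cdots. \end{align*} -/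

import Mathlib

namespace PrudentPolygon

/-- A self-avoiding walk on the square lattice starting at the origin, given by the list of the
nodes it visits: consecutive nodes are at distance one, and no node is visited twice. -/
def IsSAW (w : List (ℤ × ℤ)) : Prop :=
  w.head? = some (0, 0) ∧
  w.IsChain (fun p r => |r.1 - p.1| + |r.2 - p.2| = 1) ∧
  w.Nodup

/-- A walk is prudent if it never steps towards an already occupied node: when it steps from
`w[i]` to `w[i + 1]`, the open lattice ray from `w[i]` in the direction of that step contains none
of the nodes `w[0], …, w[i]`. -/
def IsPrudent (w : List (ℤ × ℤ)) : Prop :=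
  ∀ (i : ℕ) (hi : i + 1 < w.length), ∀ p ∈ w.take (i + 1), ∀ k : ℕ, 1 ≤ k →
    p ≠ w[i] + k • (w[i + 1] - w[i])

/-- A prudent polygon is a prudent self-avoiding walk of more than one step that ends at a node
adjacent to its starting point. "4-sided" means that there is no restriction on the sides of the
bounding box on which the walk may end, so these are exactly the 4-sided prudent polygons. -/
def IsPrudentPolygon (w : List (ℤ × ℤ)) : Prop :=
  IsSAW w ∧ IsPrudent w ∧ 2 < w.length ∧ ∃ p, w.getLast? = some p ∧ |p.1| + |p.2| = 1

/-- The directed edges of the closed polygon: the steps of the walk, and the closing edge from its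
last node to its first. -/
def edges (w : List (ℤ × ℤ)) : List ((ℤ × ℤ) × (ℤ × ℤ)) :=
  w.zip (w.rotate 1)

/-- The unit cells enclosed by the polygon. The cell `[a, a + 1] × [b, b + 1]` is named by its
south-west corner `(a, b)`; it is enclosed when the horizontal ray from its centre to the east
crosses the polygon an odd number of times (even-odd rule). -/
def cells (w : List (ℤ × ℤ)) : Set (ℤ × ℤ) :=
  {c | Odd ((edges w).countP
    (fun e => decide (e.1.1 = e.2.1 ∧ c.1 < e.1.1 ∧ min e.1.2 e.2.2 = c.2)))}

/-- The unit cell on the left-hand side of the directed edge from `p` to `r`. -/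
def leftCell (p r : ℤ × ℤ) : ℤ × ℤ :=
  if r = p + (1, 0) then p
  else if r = p + (0, 1) then p + (-1, 0)
  else if r = p + (-1, 0) then p + (-1, -1)
  else p + (0, -1)

/-- The polygon is traversed counterclockwise: its interior lies on the left of each edge. -/
def IsCounterclockwise (w : List (ℤ × ℤ)) : Prop :=
  ∀ e ∈ edges w, leftCell e.1 e.2 ∈ cells w

/-- Area of a set of cells. -/
noncomputable def area (S : Set (ℤ × ℤ)) : ℕ := S.ncard

/-- Width of (the bounding box of) a set of cells: the number of columns from its leftmost to its
rightmost one. -/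
noncomputable def width (S : Set (ℤ × ℤ)) : ℕ :=
  {a : ℤ | ∃ c ∈ S, ∃ d ∈ S, c.1 ≤ a ∧ a ≤ d.1}.ncard

/-- Height of (the bounding box of) a set of cells: the number of rows from its lowest to its
highest one. -/
noncomputable def height (S : Set (ℤ × ℤ)) : ℕ :=
  {b : ℤ | ∃ c ∈ S, ∃ d ∈ S, c.2 ≤ b ∧ b ≤ d.2}.ncard

/-- `S` does not consist of two or more disconnected pieces: any two of its cells are joined by a
chain of cells of `S`, consecutive ones sharing a side. -/
def IsOnePiece (S : Set (ℤ × ℤ)) : Prop :=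
  ∀ c ∈ S, ∀ d ∈ S, Relation.ReflTransGen
    (fun c d => d ∈ S ∧ |d.1 - c.1| + |d.2 - c.2| = 1) c d

/-- What is left of a set of cells when its top row is removed. -/
def removeTopRow (S : Set (ℤ × ℤ)) : Set (ℤ × ℤ) := {c ∈ S | ∃ d ∈ S, c.2 < d.2}

/-- What is left of a set of cells when its rightmost column is removed. -/
def removeRightColumn (S : Set (ℤ × ℤ)) : Set (ℤ × ℤ) := {c ∈ S | ∃ d ∈ S, c.1 < d.1}

/-- The prudent polygons that end at `(-1, 0)` in a counterclockwise direction. -/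
def classW : Set (List (ℤ × ℤ)) :=
  {w | IsPrudentPolygon w ∧ w.getLast? = some (-1, 0) ∧ IsCounterclockwise w}

/-- Class `𝒳`: removing the top row neither changes the width nor disconnects the polygon. -/
def classX : Set (List (ℤ × ℤ)) :=
  {w ∈ classW | width (removeTopRow (cells w)) = width (cells w) ∧
    IsOnePiece (removeTopRow (cells w))}

/-- Class `𝒴`: the unit square, and the polygons not in `𝒳` for which removing the rightmost
column neither changes the height nor disconnects the polygon. -/
def classY : Set (List (ℤ × ℤ)) :=
  {w ∈ classW | area (cells w) = 1 ∨
    (w ∉ classX ∧ height (removeRightColumn (cells w)) = height (cells w) ∧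
      IsOnePiece (removeRightColumn (cells w)))}

/-- Class `𝒵`: the polygons neither in `𝒳` nor in `𝒴`. -/
def classZ : Set (List (ℤ × ℤ)) :=
  {w ∈ classW | w ∉ classX ∧ w ∉ classY}

/-- `X(q, u, v)`: `q` marks area, `u` marks width and `v` marks height.
The variables `q, u, v` have the indices `0, 1, 2`. -/
noncomputable def genX : MvPowerSeries (Fin 3) ℚ := fun m =>
  ({w ∈ classX | area (cells w) = m 0 ∧ width (cells w) = m 1 ∧
    height (cells w) = m 2}.ncard : ℚ)

/-- `Y(q, u, v)`: `q` marks area, `u` marks height and `v` marks width. -/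
noncomputable def genY : MvPowerSeries (Fin 3) ℚ := fun m =>
  ({w ∈ classY | area (cells w) = m 0 ∧ height (cells w) = m 1 ∧
    width (cells w) = m 2}.ncard : ℚ)

/-- `Z(q, u, v)`: `q` marks area, `u` marks width minus one and `v` marks height. -/
noncomputable def genZ : MvPowerSeries (Fin 3) ℚ := fun m =>
  ({w ∈ classZ | area (cells w) = m 0 ∧ width (cells w) = m 1 + 1 ∧
    height (cells w) = m 2}.ncard : ℚ)

/-- The area generating function of all (4-sided) prudent polygons. -/
noncomputable def genPA : PowerSeries ℚ := PowerSeries.mk fun n =>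
  ({w | IsPrudentPolygon w ∧ area (cells w) = n}.ncard : ℚ)

/-- `F(q, a, b)`: substitution of power series `a, b` without constant term for `u, v`. -/
noncomputable def substUV (F a b : MvPowerSeries (Fin 3) ℚ) : MvPowerSeries (Fin 3) ℚ :=
  MvPowerSeries.subst ![MvPowerSeries.X 0, a, b] F

/-- `F(q, 1, 1)`, for a series `F` in which each power of `q` has a coefficient that is a
polynomial in `u, v`. -/
noncomputable def evalOne (F : MvPowerSeries (Fin 3) ℚ) : PowerSeries ℚ :=
  PowerSeries.mk fun n => ∑ᶠ p : ℕ × ℕ,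
    MvPowerSeries.coeff (Finsupp.equivFunOnFinite.symm ![n, p.1, p.2]) F

end PrudentPolygon

open PrudentPolygon

/-!
A prudent walk ends on the border of its bounding box. Hence a counterclockwise prudent polygon that
ends at `(-1, 0)` arises in exactly one way from the unit square by adding rows of cells on top,
columns of cells on the right and rows of cells at the bottom: it runs through the right half-plane
to the top of its bounding box, and then returns along the top and the left side. A row or column of
length `k` can be added for all `k` up to a bound that is read off from the width or height, and the
kind of the last addition decides the class. Summing over `k` gives a geometric sum, which accounts
for the differences such as `X(q, u, v) - X(q, q u, v)` in the functional equations. The factor `8`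
is the number of symmetries of the square, and the first coefficients are obtained by listing the
constructions.
-/

namespace PrudentPolygon

/-! ### Prudent walks and their symmetries -/

/-- `FreeStep p r l`: the step from `p` to `r` is a unit step, and no node of `l` lies on the open
ray from `p` in its direction. -/
inductive FreeStep (p r : ℤ × ℤ) (l : List (ℤ × ℤ)) : Prop
  | right (hr : r = (p.1 + 1, p.2)) (free : ∀ q ∈ l, q.2 = p.2 → q.1 ≤ p.1)
  | left (hr : r = (p.1 - 1, p.2)) (free : ∀ q ∈ l, q.2 = p.2 → p.1 ≤ q.1)
  | up (hr : r = (p.1, p.2 + 1)) (free : ∀ q ∈ l, q.1 = p.1 → q.2 ≤ p.2)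
  | down (hr : r = (p.1, p.2 - 1)) (free : ∀ q ∈ l, q.1 = p.1 → p.2 ≤ q.2)

/-- Prudent walks from the origin, as lists of nodes in reversed order, so that a step of the walk
is a `List.cons` and the head of the list is the current node. -/
inductive PrudentPath : List (ℤ × ℤ) → Prop
  | start : PrudentPath [(0, 0)]
  | step {p r : ℤ × ℤ} {l : List (ℤ × ℤ)} (path : PrudentPath (p :: l))
      (free : FreeStep p r (p :: l)) : PrudentPath (r :: p :: l)

theorem PrudentPath.cons {p r : ℤ × ℤ} {l : List (ℤ × ℤ)} (hl : PrudentPath l)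
    (hp : l.head? = some p) (hf : FreeStep p r l) : PrudentPath (r :: l) := by
  obtain ⟨t, rfl⟩ := List.head?_eq_some_iff.mp hp
  exact hl.step hf

theorem PrudentPath.origin_mem {l : List (ℤ × ℤ)} (h : PrudentPath l) : ((0, 0) : ℤ × ℤ) ∈ l := by
  induction h with
  | start => exact List.mem_singleton_self _
  | step _ _ ih => exact List.mem_cons_of_mem _ ih

theorem PrudentPath.getLast? {l : List (ℤ × ℤ)} (h : PrudentPath l) :
    l.getLast? = some (0, 0) := by
  induction h with
  | start => rfl
  | step _ _ ih => rwa [List.getLast?_cons_cons]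

theorem FreeStep.not_mem {p r : ℤ × ℤ} {l : List (ℤ × ℤ)} (h : FreeStep p r l) : r ∉ l := by
  intro hr
  rcases h with ⟨rfl, h⟩ | ⟨rfl, h⟩ | ⟨rfl, h⟩ | ⟨rfl, h⟩ <;>
  · have := h _ hr rfl
    dsimp only at this
    omega

theorem PrudentPath.nodup {l : List (ℤ × ℤ)} (h : PrudentPath l) : l.Nodup := by
  induction h with
  | start => exact List.nodup_singleton _
  | step _ hf ih => exact List.nodup_cons.2 ⟨hf.not_mem, ih⟩

theorem PrudentPath.head_ne_origin {p : ℤ × ℤ} {l : List (ℤ × ℤ)} (h : PrudentPath (p :: l))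
    (hl : l ≠ []) : p ≠ (0, 0) := by
  rintro rfl
  cases h with
  | start => exact hl rfl
  | step h hf => exact hf.not_mem h.origin_mem

/-- Reflection of the plane in the horizontal axis. -/
def reflect (p : ℤ × ℤ) : ℤ × ℤ := (p.1, -p.2)

theorem reflect_involutive : Function.Involutive reflect := fun p => by simp only [reflect, neg_neg]

theorem map_reflect_map_reflect (l : List (ℤ × ℤ)) : (l.map reflect).map reflect = l := by
  rw [List.map_map, reflect_involutive.comp_self, List.map_id]

theorem map_swap_map_swap {α : Type*} (l : List (α × α)) :
    (l.map Prod.swap).map Prod.swap = l := by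
  rw [List.map_map, Prod.swap_swap_eq, List.map_id]

theorem mem_map_swap {α : Type*} {l : List (α × α)} {q : α × α} :
    q ∈ l.map Prod.swap ↔ q.swap ∈ l :=
  List.mem_map_of_involutive Prod.swap_swap

theorem FreeStep.map_swap {p r : ℤ × ℤ} {l : List (ℤ × ℤ)} (h : FreeStep p r l) :
    FreeStep p.swap r.swap (l.map Prod.swap) := by
  rcases h with ⟨rfl, h⟩ | ⟨rfl, h⟩ | ⟨rfl, h⟩ | ⟨rfl, h⟩
  · exact .up rfl (List.forall_mem_map.2 h)
  · exact .down rfl (List.forall_mem_map.2 h)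
  · exact .right rfl (List.forall_mem_map.2 h)
  · exact .left rfl (List.forall_mem_map.2 h)

theorem PrudentPath.map_swap {l : List (ℤ × ℤ)} (h : PrudentPath l) :
    PrudentPath (l.map Prod.swap) := by
  induction h with
  | start => exact .start
  | step _ hf ih => exact ih.step hf.map_swap

theorem FreeStep.map_reflect {p r : ℤ × ℤ} {l : List (ℤ × ℤ)} (h : FreeStep p r l) :
    FreeStep (reflect p) (reflect r) (l.map reflect) := by
  rcases h with ⟨rfl, h⟩ | ⟨rfl, h⟩ | ⟨rfl, h⟩ | ⟨rfl, h⟩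
  · exact .right rfl (List.forall_mem_map.2 fun q hq hq2 => h q hq (neg_inj.1 hq2))
  · exact .left rfl (List.forall_mem_map.2 fun q hq hq2 => h q hq (neg_inj.1 hq2))
  · exact .down (Prod.ext rfl (neg_add' _ _))
      (List.forall_mem_map.2 fun q hq hq1 => neg_le_neg (h q hq hq1))
  · exact .up (Prod.ext rfl (neg_sub' _ _))
      (List.forall_mem_map.2 fun q hq hq1 => neg_le_neg (h q hq hq1))

theorem PrudentPath.map_reflect {l : List (ℤ × ℤ)} (h : PrudentPath l) :
    PrudentPath (l.map reflect) := by
  induction h with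
  | start => exact .start
  | step _ hf ih => exact ih.step hf.map_reflect

theorem PrudentPath.exists_mem_column {l : List (ℤ × ℤ)} (h : PrudentPath l) {x : ℤ}
    (hle : ∃ q ∈ l, q.1 ≤ x) (hge : ∃ q ∈ l, x ≤ q.1) : ∃ y, (x, y) ∈ l := by
  induction h with
  | start =>
    obtain ⟨_, hq, hqx⟩ := hle
    obtain ⟨_, hr, hxr⟩ := hge
    cases List.mem_singleton.1 hq
    cases List.mem_singleton.1 hr
    exact ⟨0, List.mem_singleton.2 (Prod.ext (le_antisymm hxr hqx) rfl)⟩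
  | @step p r l _ hf ih =>
    by_cases hx : x = r.1
    · exact ⟨r.2, hx ▸ List.mem_cons_self⟩
    have hpr : r.1 ≤ p.1 + 1 ∧ p.1 ≤ r.1 + 1 := by
      rcases hf with ⟨rfl, -⟩ | ⟨rfl, -⟩ | ⟨rfl, -⟩ | ⟨rfl, -⟩ <;> dsimp only <;> omega
    have hle' : ∃ q ∈ p :: l, q.1 ≤ x := by
      obtain ⟨q, hq, hqx⟩ := hle
      rcases List.mem_cons.1 hq with rfl | hq
      · exact ⟨p, List.mem_cons_self, by omega⟩
      · exact ⟨q, hq, hqx⟩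
    have hge' : ∃ q ∈ p :: l, x ≤ q.1 := by
      obtain ⟨q, hq, hqx⟩ := hge
      rcases List.mem_cons.1 hq with rfl | hq
      · exact ⟨p, List.mem_cons_self, by omega⟩
      · exact ⟨q, hq, hqx⟩
    obtain ⟨y, hy⟩ := ih hle' hge'
    exact ⟨y, List.mem_cons_of_mem _ hy⟩

/-- A walk that has been on both sides of the column of its current node has crossed it before. -/
theorem PrudentPath.exists_ne_head_column {p : ℤ × ℤ} {l : List (ℤ × ℤ)}
    (h : PrudentPath (p :: l)) (hlt : ∃ q ∈ p :: l, q.1 < p.1) (hgt : ∃ q ∈ p :: l, p.1 < q.1) :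
    ∃ q ∈ p :: l, q.1 = p.1 ∧ q.2 ≠ p.2 := by
  obtain ⟨a, ha, hap⟩ := hlt
  obtain ⟨b, hb, hbp⟩ := hgt
  have ha' : a ∈ l := (List.mem_cons.1 ha).resolve_left (by rintro rfl; omega)
  have hb' : b ∈ l := (List.mem_cons.1 hb).resolve_left (by rintro rfl; omega)
  have hpl : p ∉ l := (List.nodup_cons.1 h.nodup).1
  cases h with
  | start => cases ha'
  | step h _ =>
    obtain ⟨y, hy⟩ := h.exists_mem_column ⟨a, ha', hap.le⟩ ⟨b, hb', hbp.le⟩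
    exact ⟨_, List.mem_cons_of_mem _ hy, rfl, fun e => hpl (by rwa [show y = p.2 from e] at hy)⟩

theorem PrudentPath.exists_ne_head_row {p : ℤ × ℤ} {l : List (ℤ × ℤ)}
    (h : PrudentPath (p :: l)) (hlt : ∃ q ∈ p :: l, q.2 < p.2) (hgt : ∃ q ∈ p :: l, p.2 < q.2) :
    ∃ q ∈ p :: l, q.2 = p.2 ∧ q.1 ≠ p.1 := by
  obtain ⟨q, hq, hqp, hne⟩ := h.map_swap.exists_ne_head_column
    (hlt.imp' Prod.swap fun q => .imp_left (List.mem_map_of_mem (f := Prod.swap)))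
    (hgt.imp' Prod.swap fun q => .imp_left (List.mem_map_of_mem (f := Prod.swap)))
  exact ⟨q.swap, mem_map_swap.1 hq, hqp, hne⟩

/-- The node `p` lies on the border of the bounding box of a walk through `p` with nodes `l`. -/
def OnBorder (p : ℤ × ℤ) (l : List (ℤ × ℤ)) : Prop :=
  (∀ q ∈ l, q.1 ≤ p.1) ∨ (∀ q ∈ l, p.1 ≤ q.1) ∨ (∀ q ∈ l, q.2 ≤ p.2) ∨ (∀ q ∈ l, p.2 ≤ q.2)

theorem OnBorder.cons {p : ℤ × ℤ} {l : List (ℤ × ℤ)} (h : OnBorder p l) : OnBorder p (p :: l) := by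
  simpa only [OnBorder, List.forall_mem_cons, le_refl, true_and] using h

/-- If the node left by a step to the right is not on the border in a direction that the step
keeps, then it is on the left border and the walk has been both above and below it. It has then
crossed its row elsewhere, which the border forbids on the left and prudence on the right. -/
theorem PrudentPath.onBorder_right {p : ℤ × ℤ} {l : List (ℤ × ℤ)} (h : PrudentPath (p :: l))
    (free : ∀ q ∈ p :: l, q.2 = p.2 → q.1 ≤ p.1) (hp : OnBorder p (p :: l)) :
    OnBorder (p.1 + 1, p.2) (p :: l) := by
  rcases hp with hp | hp | hp | hp
  · exact .inl fun q hq => (hp q hq).trans (Int.le_add_one le_rfl)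
  · by_contra hcon
    simp only [OnBorder, not_or, not_forall, not_le, exists_prop] at hcon
    obtain ⟨-, -, hgt, hlt⟩ := hcon
    obtain ⟨q, hq, hqp, hne⟩ := h.exists_ne_head_row hlt hgt
    exact hne (le_antisymm (free q hq hqp) (hp q hq))
  · exact .inr (.inr (.inl hp))
  · exact .inr (.inr (.inr hp))

theorem OnBorder.map_swap {p : ℤ × ℤ} {l : List (ℤ × ℤ)} (h : OnBorder p l) :
    OnBorder p.swap (l.map Prod.swap) := by
  simp only [OnBorder, List.forall_mem_map] at h ⊢
  tauto

theorem OnBorder.map_reflect {p : ℤ × ℤ} {l : List (ℤ × ℤ)} (h : OnBorder p l) :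
    OnBorder (reflect p) (l.map reflect) := by
  simp only [OnBorder, List.forall_mem_map, reflect, neg_le_neg_iff] at h ⊢
  tauto

theorem PrudentPath.onBorder_up {p : ℤ × ℤ} {l : List (ℤ × ℤ)} (h : PrudentPath (p :: l))
    (free : ∀ q ∈ p :: l, q.1 = p.1 → q.2 ≤ p.2) (hp : OnBorder p (p :: l)) :
    OnBorder (p.1, p.2 + 1) (p :: l) := by
  have free' : ∀ q ∈ (p :: l).map Prod.swap, q.2 = p.1 → q.1 ≤ p.2 := List.forall_mem_map.2 free
  rw [← map_swap_map_swap (p :: l)]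
  exact (h.map_swap.onBorder_right free' hp.map_swap).map_swap

theorem PrudentPath.onBorder_down {p : ℤ × ℤ} {l : List (ℤ × ℤ)} (h : PrudentPath (p :: l))
    (free : ∀ q ∈ p :: l, q.1 = p.1 → p.2 ≤ q.2) (hp : OnBorder p (p :: l)) :
    OnBorder (p.1, p.2 - 1) (p :: l) := by
  have hr : reflect (p.1, -p.2 + 1) = (p.1, p.2 - 1) :=
    Prod.ext rfl (by simp only [reflect]; ring)
  have free' : ∀ q ∈ (p :: l).map reflect, q.1 = p.1 → q.2 ≤ -p.2 :=
    List.forall_mem_map.2 fun q hq hqp => neg_le_neg (free q hq hqp)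
  rw [← hr, ← map_reflect_map_reflect (p :: l)]
  exact (h.map_reflect.onBorder_up free' hp.map_reflect).map_reflect

theorem PrudentPath.onBorder_left {p : ℤ × ℤ} {l : List (ℤ × ℤ)} (h : PrudentPath (p :: l))
    (free : ∀ q ∈ p :: l, q.2 = p.2 → p.1 ≤ q.1) (hp : OnBorder p (p :: l)) :
    OnBorder (p.1 - 1, p.2) (p :: l) := by
  have free' : ∀ q ∈ (p :: l).map Prod.swap, q.1 = p.2 → p.1 ≤ q.2 := List.forall_mem_map.2 free
  rw [← map_swap_map_swap (p :: l)]
  exact (h.map_swap.onBorder_down free' hp.map_swap).map_swap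

theorem PrudentPath.onBorder_head {p : ℤ × ℤ} {l : List (ℤ × ℤ)} (h : PrudentPath (p :: l)) :
    OnBorder p (p :: l) := by
  generalize hl : p :: l = m at h
  induction h generalizing p l with
  | start =>
    cases hl
    exact .inl (List.forall_mem_singleton.2 le_rfl)
  | step h hf ih =>
    cases hl
    rcases hf with ⟨rfl, free⟩ | ⟨rfl, free⟩ | ⟨rfl, free⟩ | ⟨rfl, free⟩
    · exact (h.onBorder_right free (ih rfl)).cons
    · exact (h.onBorder_left free (ih rfl)).cons
    · exact (h.onBorder_up free (ih rfl)).cons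
    · exact (h.onBorder_down free (ih rfl)).cons

/-! ### Straight moves and ray crossings -/

/-- `extend d p l n` prolongs the walk `l` with current node `p` by `n` steps in direction `d`. -/
def extend (d p : ℤ × ℤ) (l : List (ℤ × ℤ)) : ℕ → List (ℤ × ℤ)
  | 0 => l
  | n + 1 => (p + (n + 1) • d) :: extend d p l n

/-- The walk `l` prolonged horizontally up to the abscissa `x`. -/
def moveX (x : ℤ) : List (ℤ × ℤ) → List (ℤ × ℤ)
  | [] => []
  | p :: l => if p.1 ≤ x then extend (1, 0) p (p :: l) (x - p.1).toNat
    else extend (-1, 0) p (p :: l) (p.1 - x).toNat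

/-- The walk `l` prolonged vertically up to the ordinate `y`. -/
def moveY (y : ℤ) (l : List (ℤ × ℤ)) : List (ℤ × ℤ) :=
  (moveX y (l.map Prod.swap)).map Prod.swap

/-- The directed edges of a walk given in reversed order. -/
def pathEdges : List (ℤ × ℤ) → List ((ℤ × ℤ) × (ℤ × ℤ))
  | r :: p :: l => (p, r) :: pathEdges (p :: l)
  | _ => []

/-- The number of edges of a walk that are crossed by the ray from the cell `c` to the east. -/
def crossings (l : List (ℤ × ℤ)) (c : ℤ × ℤ) : ℕ :=
  (pathEdges l).countP (fun e => decide (e.1.1 = e.2.1 ∧ c.1 < e.1.1 ∧ min e.1.2 e.2.2 = c.2))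

section Moves

variable {p : ℤ × ℤ} {l : List (ℤ × ℤ)}

theorem head?_map_swap (h : l.head? = some p) : (l.map Prod.swap).head? = some p.swap := by
  rw [List.head?_map, h, Option.map_some]

theorem moveX_self (h : l.head? = some p) : moveX p.1 l = l := by
  obtain ⟨t, rfl⟩ := List.head?_eq_some_iff.mp h
  rw [moveX, if_pos le_rfl, sub_self, Int.toNat_zero, extend]

theorem moveX_add_one (h : l.head? = some p) {x : ℤ} (hx : p.1 ≤ x) :
    moveX (x + 1) l = (x + 1, p.2) :: moveX x l := by
  obtain ⟨t, rfl⟩ := List.head?_eq_some_iff.mp h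
  rw [moveX, moveX, if_pos hx, if_pos (by omega),
    show (x + 1 - p.1).toNat = (x - p.1).toNat + 1 by omega, extend]
  congr 1
  ext <;> simp; omega

theorem moveX_sub_one (h : l.head? = some p) {x : ℤ} (hx : x ≤ p.1) :
    moveX (x - 1) l = (x - 1, p.2) :: moveX x l := by
  have hd : (p.1 - (x - 1)).toNat = (p.1 - x).toNat + 1 := by omega
  have hm : moveX x l = extend (-1, 0) p l (p.1 - x).toNat := by
    rcases hx.eq_or_lt with rfl | hx
    · rw [moveX_self h, sub_self, Int.toNat_zero, extend]
    · obtain ⟨t, rfl⟩ := List.head?_eq_some_iff.mp h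
      rw [moveX, if_neg hx.not_ge]
  obtain ⟨t, rfl⟩ := List.head?_eq_some_iff.mp h
  rw [hm, moveX, if_neg (by omega), hd, extend]
  congr 1
  ext <;> simp; omega

theorem moveX_induction (h : l.head? = some p) {motive : ℤ → List (ℤ × ℤ) → Prop}
    (self : motive p.1 l)
    (right : ∀ x, p.1 ≤ x → motive x (moveX x l) → motive (x + 1) ((x + 1, p.2) :: moveX x l))
    (left : ∀ x, x ≤ p.1 → motive x (moveX x l) → motive (x - 1) ((x - 1, p.2) :: moveX x l))
    (x : ℤ) : motive x (moveX x l) := by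
  induction x using Int.inductionOn' (b := p.1) with
  | zero => rwa [moveX_self h]
  | succ k hk ih => rw [moveX_add_one h hk]; exact right k hk ih
  | pred k hk ih => rw [moveX_sub_one h hk]; exact left k hk ih

theorem moveY_self (h : l.head? = some p) : moveY p.2 l = l := by
  rw [moveY, ← Prod.fst_swap, moveX_self (head?_map_swap h), map_swap_map_swap]

theorem moveY_add_one (h : l.head? = some p) {y : ℤ} (hy : p.2 ≤ y) :
    moveY (y + 1) l = (p.1, y + 1) :: moveY y l :=
  congrArg (List.map Prod.swap) (moveX_add_one (head?_map_swap h) hy)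

theorem moveY_sub_one (h : l.head? = some p) {y : ℤ} (hy : y ≤ p.2) :
    moveY (y - 1) l = (p.1, y - 1) :: moveY y l :=
  congrArg (List.map Prod.swap) (moveX_sub_one (head?_map_swap h) hy)

theorem moveY_induction (h : l.head? = some p) {motive : ℤ → List (ℤ × ℤ) → Prop}
    (self : motive p.2 l)
    (up : ∀ y, p.2 ≤ y → motive y (moveY y l) → motive (y + 1) ((p.1, y + 1) :: moveY y l))
    (down : ∀ y, y ≤ p.2 → motive y (moveY y l) → motive (y - 1) ((p.1, y - 1) :: moveY y l))
    (y : ℤ) : motive y (moveY y l) :=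
  moveX_induction (motive := fun y m => motive y (m.map Prod.swap)) (head?_map_swap h)
    (by rwa [map_swap_map_swap]) up down y

theorem head?_moveX (h : l.head? = some p) (x : ℤ) : (moveX x l).head? = some (x, p.2) :=
  moveX_induction (motive := fun x m => m.head? = some (x, p.2)) h h (fun _ _ _ => rfl)
    (fun _ _ _ => rfl) x

theorem head?_moveY (h : l.head? = some p) (y : ℤ) : (moveY y l).head? = some (p.1, y) :=
  head?_map_swap (head?_moveX (head?_map_swap h) y)

theorem mem_moveX (h : l.head? = some p) (x : ℤ) (q : ℤ × ℤ) : q ∈ moveX x l ↔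
    q ∈ l ∨ q.2 = p.2 ∧ (p.1 ≤ q.1 ∧ q.1 ≤ x ∨ x ≤ q.1 ∧ q.1 ≤ p.1) := by
  obtain ⟨a, b⟩ := q
  refine moveX_induction (motive := fun x m => (a, b) ∈ m ↔
    (a, b) ∈ l ∨ b = p.2 ∧ (p.1 ≤ a ∧ a ≤ x ∨ x ≤ a ∧ a ≤ p.1)) h ?_ ?_ ?_ x
  · have hp : (p.1, p.2) ∈ l := List.mem_of_mem_head? h
    refine ⟨.inl, ?_⟩
    rintro (hq | ⟨rfl, hq⟩)
    · exact hq
    · rwa [show a = p.1 by omega]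
  all_goals
    intro x hx ih
    rw [List.mem_cons, ih, Prod.mk.injEq]
    by_cases hq : (a, b) ∈ l <;> simp only [hq, true_or, or_true, false_or]
    omega

theorem mem_moveY (h : l.head? = some p) (y : ℤ) (q : ℤ × ℤ) : q ∈ moveY y l ↔
    q ∈ l ∨ q.1 = p.1 ∧ (p.2 ≤ q.2 ∧ q.2 ≤ y ∨ y ≤ q.2 ∧ q.2 ≤ p.2) := by
  rw [moveY, mem_map_swap, mem_moveX (head?_map_swap h), mem_map_swap]
  rfl

protected theorem PrudentPath.moveX (hl : PrudentPath l) (h : l.head? = some p) (x : ℤ)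
    (right : p.1 < x → ∀ q ∈ l, q.2 = p.2 → q.1 ≤ p.1)
    (left : x < p.1 → ∀ q ∈ l, q.2 = p.2 → p.1 ≤ q.1) : PrudentPath (moveX x l) := by
  revert right left
  refine moveX_induction (motive := fun x m => (p.1 < x → ∀ q ∈ l, q.2 = p.2 → q.1 ≤ p.1) →
    (x < p.1 → ∀ q ∈ l, q.2 = p.2 → p.1 ≤ q.1) → PrudentPath m) h (fun _ _ => hl) ?_ ?_ x
  · intro x hx ih right _
    have hm : PrudentPath (PrudentPolygon.moveX x l) := ih (fun _ => right (by omega)) (by omega)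
    refine hm.cons (head?_moveX h x) (.right rfl fun q hq hq2 => ?_)
    rcases (mem_moveX h x q).1 hq with hq | ⟨-, hq⟩
    · exact (right (by omega) q hq hq2).trans hx
    · dsimp only; omega
  · intro x hx ih _ left
    have hm : PrudentPath (PrudentPolygon.moveX x l) := ih (by omega) (fun _ => left (by omega))
    refine hm.cons (head?_moveX h x) (.left rfl fun q hq hq2 => ?_)
    rcases (mem_moveX h x q).1 hq with hq | ⟨-, hq⟩
    · exact hx.trans (left (by omega) q hq hq2)
    · dsimp only; omega

protected theorem PrudentPath.moveY (hl : PrudentPath l) (h : l.head? = some p) (y : ℤ)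
    (up : p.2 < y → ∀ q ∈ l, q.1 = p.1 → q.2 ≤ p.2)
    (down : y < p.2 → ∀ q ∈ l, q.1 = p.1 → p.2 ≤ q.2) : PrudentPath (moveY y l) :=
  (hl.map_swap.moveX (head?_map_swap h) y (fun hy => List.forall_mem_map.2 (up hy))
    fun hy => List.forall_mem_map.2 (down hy)).map_swap

theorem pathEdges_cons (h : l.head? = some p) (r : ℤ × ℤ) :
    pathEdges (r :: l) = (p, r) :: pathEdges l := by
  obtain ⟨t, rfl⟩ := List.head?_eq_some_iff.mp h
  rfl

theorem pathEdges_map (f : ℤ × ℤ → ℤ × ℤ) :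
    ∀ l : List (ℤ × ℤ), pathEdges (l.map f) = (pathEdges l).map (Prod.map f f)
  | [] => rfl
  | [_] => rfl
  | r :: p :: l => congrArg ((f p, f r) :: ·) (pathEdges_map f (p :: l))

theorem mem_pathEdges_moveX (h : l.head? = some p) (x : ℤ) : ∀ e ∈ pathEdges (moveX x l),
    e ∈ pathEdges l ∨ (∃ t, p.1 ≤ t ∧ t < x ∧ e = ((t, p.2), (t + 1, p.2))) ∨
      ∃ t, x ≤ t ∧ t < p.1 ∧ e = ((t + 1, p.2), (t, p.2)) := by
  refine moveX_induction (motive := fun x m => ∀ e ∈ pathEdges m, e ∈ pathEdges l ∨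
    (∃ t, p.1 ≤ t ∧ t < x ∧ e = ((t, p.2), (t + 1, p.2))) ∨
      ∃ t, x ≤ t ∧ t < p.1 ∧ e = ((t + 1, p.2), (t, p.2))) h (fun e he => .inl he) ?_ ?_ x
  · intro x hx ih e he
    rw [pathEdges_cons (head?_moveX h x)] at he
    rcases List.mem_cons.1 he with rfl | he
    · exact .inr (.inl ⟨x, hx, by omega, rfl⟩)
    · rcases ih e he with he | ⟨t, h1, h2, rfl⟩ | ⟨t, h1, h2, rfl⟩
      · exact .inl he
      · exact .inr (.inl ⟨t, h1, by omega, rfl⟩)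
      · omega
  · intro x hx ih e he
    rw [pathEdges_cons (head?_moveX h x)] at he
    rcases List.mem_cons.1 he with rfl | he
    · exact .inr (.inr ⟨x - 1, le_rfl, by omega, by rw [sub_add_cancel]⟩)
    · rcases ih e he with he | ⟨t, h1, h2, rfl⟩ | ⟨t, h1, h2, rfl⟩
      · exact .inl he
      · omega
      · exact .inr (.inr ⟨t, by omega, h2, rfl⟩)

theorem mem_pathEdges_moveY (h : l.head? = some p) (y : ℤ) : ∀ e ∈ pathEdges (moveY y l),
    e ∈ pathEdges l ∨ (∃ t, p.2 ≤ t ∧ t < y ∧ e = ((p.1, t), (p.1, t + 1))) ∨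
      ∃ t, y ≤ t ∧ t < p.2 ∧ e = ((p.1, t + 1), (p.1, t)) := by
  intro e he
  rw [moveY, pathEdges_map] at he
  obtain ⟨e, hm, rfl⟩ := List.mem_map.1 he
  rcases mem_pathEdges_moveX (head?_map_swap h) y e hm with he |
     ⟨t, h1, h2, rfl⟩ | ⟨t, h1, h2, rfl⟩
  · rw [pathEdges_map] at he
    obtain ⟨e, hl, rfl⟩ := List.mem_map.1 he
    exact .inl hl
  · exact .inr (.inl ⟨t, h1, h2, rfl⟩)
  · exact .inr (.inr ⟨t, h1, h2, rfl⟩)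

theorem crossings_cons (h : l.head? = some p) (r c : ℤ × ℤ) : crossings (r :: l) c =
    crossings l c + if p.1 = r.1 ∧ c.1 < p.1 ∧ min p.2 r.2 = c.2 then 1 else 0 := by
  simp only [crossings, pathEdges_cons h, List.countP_cons, decide_eq_true_eq]

theorem crossings_moveX (h : l.head? = some p) (x : ℤ) (c : ℤ × ℤ) :
    crossings (moveX x l) c = crossings l c := by
  refine moveX_induction (motive := fun _ m => crossings m c = crossings l c) h rfl ?_ ?_ x
  all_goals
    intro x _ ih
    rw [crossings_cons (head?_moveX h x), ih, if_neg (by dsimp only; omega), add_zero]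

theorem crossings_moveY (h : l.head? = some p) (y : ℤ) (c : ℤ × ℤ) :
    crossings (moveY y l) c = crossings l c +
      if c.1 < p.1 ∧ (p.2 ≤ c.2 ∧ c.2 < y ∨ y ≤ c.2 ∧ c.2 < p.2) then 1 else 0 := by
  refine moveY_induction (motive := fun y m => crossings m c = crossings l c +
    if c.1 < p.1 ∧ (p.2 ≤ c.2 ∧ c.2 < y ∨ y ≤ c.2 ∧ c.2 < p.2) then 1 else 0) h ?_ ?_ ?_ y
  · rw [if_neg (by omega), add_zero]
  all_goals
    intro y hy ih
    rw [crossings_cons (head?_moveY h y), ih]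
    dsimp only
    split_ifs <;> omega

end Moves

/-! ### Constructions and their walks -/

/-- The ways to build up a polygon from the unit square: `addTop c k` adds a row of `k` cells on
top, `addRight c k` a column of `k` cells on the right, and `addBottom c k` a row of `k` cells at
the bottom. Rows on top start at the left side, columns on the right start at the top side, and rows
at the bottom start at the right side. -/
inductive Construction
  | square : Construction
  | addTop : Construction → ℕ → Construction
  | addRight : Construction → ℕ → Construction
  | addBottom : Construction → ℕ → Construction

namespace Construction

/-- The width of the polygon. -/
protected def width : Construction → ℕ
  | square => 1
  | addTop c k => max c.width k
  | addRight c _ => c.width + 1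
  | addBottom c _ => c.width

/-- The height of the polygon. -/
protected def height : Construction → ℕ
  | square => 1
  | addTop c _ => c.height + 1
  | addRight c k => max c.height k
  | addBottom c _ => c.height + 1

/-- The area of the polygon. -/
protected def area : Construction → ℕ
  | square => 1
  | addTop c k => c.area + k
  | addRight c k => c.area + k
  | addBottom c k => c.area + k

/-- The ordinate of the top side of the polygon. -/
def topY : Construction → ℤ
  | square => 1
  | addTop c _ => c.topY + 1
  | addRight c _ => c.topY
  | addBottom c _ => c.topY

/-- The ordinate of the bottom side of the polygon. -/
def bottomY (c : Construction) : ℤ := c.topY - c.height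

/-- The last addition was a top row within the width of the polygon. -/
def IsX : Construction → Prop
  | addTop c k => k ≤ c.width
  | _ => False

/-- The last addition was a bottom row, or a right column that is longer than the polygon. -/
def IsZ : Construction → Prop
  | addRight c k => c.height < k
  | addBottom _ _ => True
  | _ => False

/-- The constructions that give a prudent polygon. -/
def Valid : Construction → Prop
  | square => True
  | addTop c k => c.Valid ∧ 1 ≤ k ∧ k ≤ c.width + 1
  | addRight c k => c.Valid ∧ ¬ c.IsX ∧ 1 ≤ k ∧ k ≤ c.height + 1
  | addBottom c k => c.Valid ∧ c.IsZ ∧ 1 ≤ k ∧ k + 1 ≤ c.width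

/-- The pair of `path` and `footPath`. -/
def paths : Construction → List (ℤ × ℤ) × List (ℤ × ℤ)
  | square => ([(0, 0)], [])
  | addTop c k => (moveX (k - 1) (moveY c.topY c.paths.1), [])
  | addRight c k => (moveX c.width (moveY (c.topY - k) c.paths.1), moveY (c.topY - k) c.paths.1)
  | addBottom c k =>
    (moveX (c.width - 1) (moveY (c.bottomY - 1) (moveX (c.width - 1 - k) c.paths.2)),
      moveY (c.bottomY - 1) (moveX (c.width - 1 - k) c.paths.2))

/-- The part of the walk around the polygon, in reversed order, that ends when the last added row or
column has been traversed. -/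
def path (c : Construction) : List (ℤ × ℤ) := c.paths.1

/-- The part of `path` that ends at the foot, where the walk turns towards the right side for the
last time. It is only relevant when the last addition was a right column or a bottom row. -/
def footPath (c : Construction) : List (ℤ × ℤ) := c.paths.2

/-- The closed walk around the polygon, in reversed order. -/
def loop (c : Construction) : List (ℤ × ℤ) := moveY 0 (moveX (-1) (moveY c.topY c.path))

/-- The last node of `path`. -/
def tip : Construction → ℤ × ℤ
  | square => (0, 0)
  | addTop c k => (k - 1, c.topY)
  | addRight c k => (c.width, c.topY - k)
  | addBottom c _ => (c.width - 1, c.bottomY - 1)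

/-- The abscissa of the last node of `footPath`; its ordinate is that of `tip`. -/
def footX : Construction → ℤ
  | addRight c _ => c.width - 1
  | addBottom c k => c.width - 1 - k
  | _ => 0

variable {c : Construction} {k : ℕ}

theorem tip_addTop : (addTop c k).tip = ((k : ℤ) - 1, c.topY) := rfl

theorem tip_addRight : (addRight c k).tip = ((c.width : ℤ), c.topY - k) := rfl

theorem tip_addBottom : (addBottom c k).tip = ((c.width : ℤ) - 1, c.bottomY - 1) := rfl

theorem bottomY_addTop : (addTop c k).bottomY = c.bottomY := by
  simp only [bottomY, topY, Construction.height]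
  push_cast
  ring

theorem bottomY_addRight : (addRight c k).bottomY = c.topY - max (c.height : ℤ) k := by
  simp only [bottomY, topY, Construction.height, Nat.cast_max]

theorem bottomY_addBottom : (addBottom c k).bottomY = c.bottomY - 1 := by
  simp only [bottomY, topY, Construction.height]
  push_cast
  ring

theorem cast_width_addTop : ((addTop c k).width : ℤ) = max (c.width : ℤ) k := Nat.cast_max _ _

theorem cast_width_addRight : ((addRight c k).width : ℤ) = c.width + 1 := Nat.cast_succ _

theorem Valid.one_le_width : ∀ {c : Construction}, c.Valid → 1 ≤ c.width
  | square, _ => le_rfl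
  | addTop _ _, h => le_max_of_le_left h.1.one_le_width
  | addRight _ _, _ => Nat.le_add_left _ _
  | addBottom _ _, h => h.1.one_le_width

theorem Valid.one_le_height : ∀ {c : Construction}, c.Valid → 1 ≤ c.height
  | square, _ => le_rfl
  | addTop _ _, _ => Nat.le_add_left _ _
  | addRight _ _, h => le_max_of_le_left h.1.one_le_height
  | addBottom _ _, _ => Nat.le_add_left _ _

theorem Valid.one_le_area : ∀ {c : Construction}, c.Valid → 1 ≤ c.area
  | square, _ => le_rfl
  | addTop _ _, h => le_add_right h.1.one_le_area
  | addRight _ _, h => le_add_right h.1.one_le_area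
  | addBottom _ _, h => le_add_right h.1.one_le_area

theorem not_isX_of_isZ : ∀ {c : Construction}, c.IsZ → ¬ c.IsX
  | square, _ => id
  | addTop _ _, h => h.elim
  | addRight _ _, _ => id
  | addBottom _ _, _ => id

/-- The position of `path` in the bounding box of the polygon. -/
structure PathInvariant (c : Construction) : Prop where
  head : c.path.head? = some c.tip
  prudent : PrudentPath c.path
  box : ∀ q ∈ c.path, 0 ≤ q.1 ∧ q.1 ≤ c.width - 1 ∧ c.bottomY ≤ q.2 ∧ q.2 ≤ c.topY - 1
  hit_column : ∀ x : ℤ, 0 ≤ x → x ≤ c.width - 1 → ∃ y, (x, y) ∈ c.path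
  hit_row : ∀ y : ℤ, c.bottomY ≤ y → y ≤ c.topY - 1 → ∃ x, (x, y) ∈ c.path
  free_up : ∀ q ∈ c.path, q.1 = c.tip.1 → q.2 ≤ c.tip.2
  tip_top : c.IsX → c.tip.2 = c.topY - 1
  tip_right : ¬ c.IsX → c.tip.1 = c.width - 1
  right_side : ¬ c.IsX → ∀ q ∈ c.path, q.1 = c.width - 1 → q.2 = c.tip.2
  hit_row_left : ¬ c.IsX → 2 ≤ c.width → ∀ y : ℤ, c.bottomY ≤ y → y ≤ c.topY - 1 →
    ∃ x : ℤ, x < c.width - 1 ∧ (x, y) ∈ c.path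

/-- The position of `footPath` in the bounding box of a polygon whose last addition was a right
column or a bottom row. -/
structure FootInvariant (c : Construction) : Prop where
  path_eq : c.path = moveX (c.width - 1) c.footPath
  tip_fst : c.tip.1 = c.width - 1
  head : c.footPath.head? = some (c.footX, c.tip.2)
  prudent : PrudentPath c.footPath
  box : ∀ q ∈ c.footPath, 0 ≤ q.1 ∧ q.1 ≤ c.width - 2 ∧ c.bottomY ≤ q.2 ∧ q.2 ≤ c.topY - 1
  hit_column : ∀ x : ℤ, 0 ≤ x → x ≤ c.width - 2 → ∃ y, (x, y) ∈ c.footPath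
  hit_row : ∀ y : ℤ, c.bottomY ≤ y → y ≤ c.topY - 1 → ∃ x, (x, y) ∈ c.footPath
  free_right : ∀ q ∈ c.footPath, q.2 = c.tip.2 → q.1 ≤ c.footX

/-- The position of `footPath` in the bounding box of a polygon to which a bottom row can be
added. -/
structure BottomInvariant (c : Construction) : Prop extends c.FootInvariant where
  tip_snd : c.tip.2 = c.bottomY
  hit_column_above : ∀ x : ℤ, 0 ≤ x → x ≤ c.width - 2 → ∃ y, c.bottomY < y ∧ (x, y) ∈ c.footPath
  bottom_row : ∀ q ∈ c.footPath, q.2 = c.bottomY → q.1 = c.footX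

theorem PathInvariant.tip_mem (h : c.PathInvariant) : c.tip ∈ c.path := List.mem_of_mem_head? h.head

theorem PathInvariant.tip_box (h : c.PathInvariant) :
    0 ≤ c.tip.1 ∧ c.tip.1 ≤ c.width - 1 ∧ c.bottomY ≤ c.tip.2 ∧ c.tip.2 ≤ c.topY - 1 :=
  h.box _ h.tip_mem

theorem PathInvariant.bottomY_nonpos (h : c.PathInvariant) : c.bottomY ≤ 0 :=
  (h.box _ h.prudent.origin_mem).2.2.1

theorem PathInvariant.one_le_topY (h : c.PathInvariant) : 1 ≤ c.topY := by
  have := (h.box _ h.prudent.origin_mem).2.2.2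
  dsimp only at this
  omega

theorem FootInvariant.foot_mem (h : c.FootInvariant) : (c.footX, c.tip.2) ∈ c.footPath :=
  List.mem_of_mem_head? h.head

theorem FootInvariant.footX_le (h : c.FootInvariant) : c.footX ≤ c.width - 2 :=
  (h.box _ h.foot_mem).2.1

theorem FootInvariant.mem_path (h : c.FootInvariant) (q : ℤ × ℤ) : q ∈ c.path ↔
    q ∈ c.footPath ∨ q.2 = c.tip.2 ∧ c.footX ≤ q.1 ∧ q.1 ≤ c.width - 1 := by
  have := h.footX_le
  rw [h.path_eq, mem_moveX h.head]
  by_cases hq : q ∈ c.footPath <;> simp only [hq, true_or, false_or]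
  omega

theorem FootInvariant.head?_path (h : c.FootInvariant) : c.path.head? = some c.tip := by
  rw [h.path_eq, head?_moveX h.head, ← h.tip_fst]

theorem FootInvariant.prudent_path (h : c.FootInvariant) : PrudentPath c.path := by
  have := h.footX_le
  rw [h.path_eq]
  exact h.prudent.moveX h.head _ (fun _ => h.free_right) (fun hlt => by dsimp only at hlt; omega)

theorem FootInvariant.pathInvariant (h : c.FootInvariant) (hX : ¬ c.IsX) : c.PathInvariant where
  head := h.head?_path
  prudent := h.prudent_path
  box q hq := by
    rcases (h.mem_path q).1 hq with hq | hq
    · have := h.box q hq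
      omega
    · have := h.box _ h.foot_mem
      dsimp only at this
      omega
  hit_column x h0 h1 := by
    rcases h1.eq_or_lt with rfl | h1
    · exact ⟨c.tip.2, h.tip_fst ▸ List.mem_of_mem_head? h.head?_path⟩
    · obtain ⟨y, hy⟩ := h.hit_column x h0 (by omega)
      exact ⟨y, (h.mem_path _).2 (.inl hy)⟩
  hit_row y h0 h1 := by
    obtain ⟨x, hx⟩ := h.hit_row y h0 h1
    exact ⟨x, (h.mem_path _).2 (.inl hx)⟩
  free_up q hq hq1 := by
    rcases (h.mem_path q).1 hq with hq | hq
    · have := h.box q hq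
      have := h.tip_fst
      omega
    · exact hq.1.le
  tip_top h := absurd h hX
  tip_right _ := h.tip_fst
  right_side _ q hq hq1 := by
    rcases (h.mem_path q).1 hq with hq | hq
    · have := h.box q hq
      omega
    · exact hq.1
  hit_row_left _ _ y h0 h1 := by
    obtain ⟨x, hx⟩ := h.hit_row y h0 h1
    have := (h.box _ hx).2.1
    exact ⟨x, by dsimp only at this; omega, (h.mem_path _).2 (.inl hx)⟩

theorem pathInvariant_square : square.PathInvariant where
  head := rfl
  prudent := .start
  box := List.forall_mem_singleton.2 ⟨le_rfl, le_rfl, le_rfl, le_rfl⟩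
  hit_column _ h0 h1 := ⟨0, List.mem_singleton.2 (Prod.ext (le_antisymm h1 h0) rfl)⟩
  hit_row _ h0 h1 := ⟨0, List.mem_singleton.2 (Prod.ext rfl (le_antisymm h1 h0))⟩
  free_up := List.forall_mem_singleton.2 fun _ => le_rfl
  tip_top h := h.elim
  tip_right _ := rfl
  right_side _ := List.forall_mem_singleton.2 fun _ => rfl
  hit_row_left _ h := absurd h (by decide)

section Top

theorem PathInvariant.head?_up (h : c.PathInvariant) :
    (moveY c.topY c.path).head? = some (c.tip.1, c.topY) :=
  head?_moveY h.head _

theorem PathInvariant.prudent_up (h : c.PathInvariant) : PrudentPath (moveY c.topY c.path) :=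
  h.prudent.moveY h.head _ (fun _ => h.free_up) fun hlt => by have := h.tip_box; omega

theorem PathInvariant.mem_up (h : c.PathInvariant) (q : ℤ × ℤ) : q ∈ moveY c.topY c.path ↔
    q ∈ c.path ∨ q.1 = c.tip.1 ∧ c.tip.2 ≤ q.2 ∧ q.2 ≤ c.topY := by
  have := h.tip_box
  rw [mem_moveY h.head]
  by_cases hq : q ∈ c.path <;> simp only [hq, true_or, false_or]
  omega

theorem PathInvariant.eq_of_mem_up (h : c.PathInvariant) {q : ℤ × ℤ}
    (hq : q ∈ moveY c.topY c.path) (hq2 : q.2 = c.topY) : q.1 = c.tip.1 := by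
  rcases (h.mem_up q).1 hq with hq | hq
  · have := h.box q hq
    omega
  · exact hq.1

theorem PathInvariant.prudent_moveX_up (h : c.PathInvariant) (x : ℤ) :
    PrudentPath (moveX x (moveY c.topY c.path)) :=
  h.prudent_up.moveX h.head?_up x (fun _ _ hq hq2 => (h.eq_of_mem_up hq hq2).le)
    (fun _ _ hq hq2 => (h.eq_of_mem_up hq hq2).ge)

theorem PathInvariant.mem_path_addTop (h : c.PathInvariant) (q : ℤ × ℤ) :
    q ∈ (addTop c k).path ↔ q ∈ c.path ∨ (q.1 = c.tip.1 ∧ c.tip.2 ≤ q.2 ∧ q.2 ≤ c.topY) ∨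
      (q.2 = c.topY ∧ (c.tip.1 ≤ q.1 ∧ q.1 ≤ k - 1 ∨ k - 1 ≤ q.1 ∧ q.1 ≤ c.tip.1)) := by
  rw [← or_assoc, ← h.mem_up]
  exact mem_moveX h.head?_up _ q

theorem PathInvariant.subset_path_addTop (h : c.PathInvariant) : c.path ⊆ (addTop c k).path :=
  fun q hq => (h.mem_path_addTop q).2 (.inl hq)

theorem PathInvariant.box_addTop (h : c.PathInvariant) (hk : 1 ≤ k) {q : ℤ × ℤ}
    (hq : q ∈ (addTop c k).path) : 0 ≤ q.1 ∧ q.1 ≤ (addTop c k).width - 1 ∧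
      (addTop c k).bottomY ≤ q.2 ∧ q.2 ≤ c.topY := by
  have htip := h.tip_box
  rw [bottomY_addTop, cast_width_addTop]
  rcases (h.mem_path_addTop q).1 hq with hq | hq
  · have := h.box q hq
    omega
  · omega

theorem PathInvariant.hit_row_addTop (h : c.PathInvariant) {y : ℤ} (h0 : c.bottomY ≤ y)
    (h1 : y ≤ c.topY) : ∃ x : ℤ, x < c.width ∧ (x, y) ∈ (addTop c k).path := by
  have htip := h.tip_box
  rcases h1.eq_or_lt with rfl | h1
  · exact ⟨c.tip.1, by omega, (h.mem_path_addTop _).2 (.inr (by dsimp only; omega))⟩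
  · obtain ⟨x, hx⟩ := h.hit_row y h0 (Int.le_sub_one_of_lt h1)
    exact ⟨x, Int.lt_of_le_sub_one (h.box _ hx).2.1, h.subset_path_addTop hx⟩

theorem PathInvariant.pathInvariant_addTop (h : c.PathInvariant) (hk : 1 ≤ k)
    (hk' : k ≤ c.width + 1) : (addTop c k).PathInvariant := by
  have hw := cast_width_addTop (c := c) (k := k)
  have ht : (addTop c k).topY - 1 = c.topY := add_sub_cancel_right _ _
  have hX : ¬ (addTop c k).IsX → k = c.width + 1 := fun hX => le_antisymm hk' (not_le.1 hX)
  constructor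
  case head => exact head?_moveX h.head?_up _
  case prudent => exact h.prudent_moveX_up _
  case box => exact fun q hq => ht ▸ h.box_addTop hk hq
  case hit_column =>
    intro x h0 h1
    by_cases hx : x ≤ c.width - 1
    · exact (h.hit_column x h0 hx).imp fun _ hy => h.subset_path_addTop hy
    · exact ⟨c.topY, (h.mem_path_addTop _).2 (.inr (by dsimp only; omega))⟩
  case hit_row =>
    intro y h0 h1
    rw [bottomY_addTop] at h0
    exact (h.hit_row_addTop h0 (h1.trans_eq ht)).imp fun _ => And.right
  case free_up => exact fun q hq _ => (h.box_addTop hk hq).2.2.2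
  case tip_top => exact fun _ => ht.symm
  case tip_right => exact fun hX' => by have := hX hX'; rw [tip_addTop]; dsimp only; omega
  case right_side =>
    intro hX' q hq hq1
    have := hX hX'
    have := h.tip_box
    rw [tip_addTop]; dsimp only
    rcases (h.mem_path_addTop q).1 hq with hq | hq
    · have := h.box q hq
      omega
    · omega
  case hit_row_left =>
    intro hX' _ y h0 h1
    have := hX hX'
    rw [bottomY_addTop] at h0
    obtain ⟨x, hx, hmem⟩ := h.hit_row_addTop h0 (h1.trans_eq ht) (k := k)
    exact ⟨x, by omega, hmem⟩

end Top

section Right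

theorem PathInvariant.prudent_moveY (h : c.PathInvariant) (hX : ¬ c.IsX) (y : ℤ) :
    PrudentPath (moveY y c.path) :=
  h.prudent.moveY h.head y (fun _ => h.free_up)
    fun _ q hq hq1 => (h.right_side hX q hq (hq1.trans (h.tip_right hX))).ge

theorem PathInvariant.mem_footPath_addRight (h : c.PathInvariant) (q : ℤ × ℤ) :
    q ∈ (addRight c k).footPath ↔ q ∈ c.path ∨
      q.1 = c.tip.1 ∧ (c.tip.2 ≤ q.2 ∧ q.2 ≤ c.topY - k ∨ c.topY - k ≤ q.2 ∧ q.2 ≤ c.tip.2) :=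
  mem_moveY h.head _ q

theorem PathInvariant.footInvariant_addRight (h : c.PathInvariant) (hX : ¬ c.IsX) (hk : 1 ≤ k)
    (hk' : k ≤ c.height + 1) : (addRight c k).FootInvariant := by
  have htip := h.tip_box
  have htip1 := h.tip_right hX
  have hb := bottomY_addRight (c := c) (k := k)
  have hw := cast_width_addRight (c := c) (k := k)
  have ht : (addRight c k).topY = c.topY := rfl
  have hl := tip_addRight (c := c) (k := k)
  have hf : (addRight c k).footX = c.width - 1 := rfl
  have hby : c.bottomY = c.topY - c.height := rfl
  have hbox : ∀ q ∈ (addRight c k).footPath, 0 ≤ q.1 ∧ q.1 ≤ (addRight c k).width - 2 ∧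
      (addRight c k).bottomY ≤ q.2 ∧ q.2 ≤ (addRight c k).topY - 1 := by
    intro q hq
    rcases (h.mem_footPath_addRight q).1 hq with hq | hq
    · have := h.box q hq
      omega
    · omega
  have hsub : c.path ⊆ (addRight c k).footPath :=
    fun q hq => (h.mem_footPath_addRight q).2 (.inl hq)
  constructor
  case path_eq => rw [hw, add_sub_cancel_right]; rfl
  case tip_fst => rw [hl, hw, add_sub_cancel_right]
  case head => rw [hf, ← htip1]; exact head?_moveY h.head _
  case prudent => exact h.prudent_moveY hX _
  case box => exact hbox
  case hit_column =>
    intro x h0 h1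
    exact (h.hit_column x h0 (by omega)).imp fun _ hy => hsub hy
  case hit_row =>
    intro y h0 h1
    by_cases hy : c.bottomY ≤ y
    · exact (h.hit_row y hy h1).imp fun _ hx => hsub hx
    · exact ⟨c.tip.1, (h.mem_footPath_addRight _).2 (.inr (by dsimp only; omega))⟩
  case free_right =>
    intro q hq _
    have := hbox q hq
    omega

theorem PathInvariant.bottomInvariant_addRight (h : c.PathInvariant) (hX : ¬ c.IsX)
    (hk : 1 ≤ k) (hk' : k ≤ c.height + 1) (hZ : (addRight c k).IsZ) :
    (addRight c k).BottomInvariant := by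
  have htip := h.tip_right hX
  have hb := bottomY_addRight (c := c) (k := k)
  have hw := cast_width_addRight (c := c) (k := k)
  have hf : (addRight c k).footX = c.width - 1 := rfl
  have hby : c.bottomY = c.topY - c.height := rfl
  have hlt : c.height < k := hZ
  refine ⟨h.footInvariant_addRight hX hk hk', ?_, fun x h0 h1 => ?_, fun q hq hq2 => ?_⟩
  · change c.topY - k = _
    omega
  · obtain ⟨y, hy⟩ := h.hit_column x h0 (by omega)
    have := h.box _ hy
    exact ⟨y, by dsimp only at this; omega, (h.mem_footPath_addRight _).2 (.inl hy)⟩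
  · rcases (h.mem_footPath_addRight q).1 hq with hq | hq
    · have := h.box q hq
      omega
    · omega

end Right

section Bottom

theorem BottomInvariant.head?_footPath (h : c.BottomInvariant) :
    c.footPath.head? = some (c.footX, c.bottomY) :=
  h.tip_snd ▸ h.head

theorem BottomInvariant.prudent_moveX (h : c.BottomInvariant) (x : ℤ) :
    PrudentPath (moveX x c.footPath) :=
  h.prudent.moveX h.head?_footPath x (fun _ q hq hq2 => (h.bottom_row q hq hq2).le)
    (fun _ q hq hq2 => (h.bottom_row q hq hq2).ge)

protected theorem BottomInvariant.head?_moveX (h : c.BottomInvariant) (x : ℤ) :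
    (moveX x c.footPath).head? = some (x, c.bottomY) :=
  head?_moveX h.head?_footPath x

theorem BottomInvariant.bottomY_le_of_mem_moveX (h : c.BottomInvariant) {x : ℤ} {q : ℤ × ℤ}
    (hq : q ∈ moveX x c.footPath) : c.bottomY ≤ q.2 := by
  rcases (mem_moveX h.head?_footPath x q).1 hq with hq | hq
  · exact (h.box q hq).2.2.1
  · exact hq.1.ge

theorem BottomInvariant.prudent_footPath_addBottom (h : c.BottomInvariant) :
    PrudentPath (addBottom c k).footPath :=
  (h.prudent_moveX _).moveY (h.head?_moveX _) _ (fun hlt => by dsimp only at hlt; omega)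
    fun _ _ hq _ => h.bottomY_le_of_mem_moveX hq

theorem BottomInvariant.subset_footPath_addBottom (h : c.BottomInvariant) :
    c.footPath ⊆ (addBottom c k).footPath :=
  fun q hq =>
    (mem_moveY (h.head?_moveX _) _ q).2 (.inl ((mem_moveX h.head?_footPath _ q).2 (.inl hq)))

theorem BottomInvariant.foot_mem_addBottom (h : c.BottomInvariant) :
    ((c.width : ℤ) - 1 - k, c.bottomY - 1) ∈ (addBottom c k).footPath :=
  List.mem_of_mem_head? (head?_moveY (h.head?_moveX _) _)

theorem BottomInvariant.mem_footPath_addBottom (h : c.BottomInvariant) (hk : 1 ≤ k)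
    (hk' : k + 1 ≤ c.width) {q : ℤ × ℤ} (hq : q ∈ (addBottom c k).footPath) :
    q ∈ c.footPath ∨ (q.2 = c.bottomY ∧ 0 ≤ q.1 ∧ q.1 ≤ c.width - 2) ∨
      (q.1 = c.width - 1 - k ∧ c.bottomY - 1 ≤ q.2 ∧ q.2 ≤ c.bottomY) := by
  have hfoot := h.box _ h.foot_mem
  dsimp only at hfoot
  rcases (mem_moveY (h.head?_moveX _) _ q).1 hq with hq | hq
  · rcases (mem_moveX h.head?_footPath _ q).1 hq with hq | hq
    · exact .inl hq
    · dsimp only at hq; omega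
  · dsimp only at hq; omega

theorem BottomInvariant.hit_column_addBottom (h : c.BottomInvariant) (x : ℤ) (h0 : 0 ≤ x)
    (h1 : x ≤ c.width - 2) : ∃ y, c.bottomY - 1 < y ∧ (x, y) ∈ (addBottom c k).footPath :=
  (h.hit_column_above x h0 h1).imp fun _ hy =>
    ⟨(sub_one_lt _).trans hy.1, h.subset_footPath_addBottom hy.2⟩

theorem BottomInvariant.bottom_row_addBottom (h : c.BottomInvariant) (hk : 1 ≤ k)
    (hk' : k + 1 ≤ c.width) (q : ℤ × ℤ) (hq : q ∈ (addBottom c k).footPath)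
    (hq2 : q.2 = c.bottomY - 1) : q.1 = c.width - 1 - k := by
  rcases h.mem_footPath_addBottom hk hk' hq with hq | hq
  · have := h.box q hq
    omega
  · omega

theorem BottomInvariant.footInvariant_addBottom (h : c.BottomInvariant) (hk : 1 ≤ k)
    (hk' : k + 1 ≤ c.width) : (addBottom c k).FootInvariant := by
  have hb := bottomY_addBottom (c := c) (k := k)
  have hw : (addBottom c k).width = c.width := rfl
  have ht : (addBottom c k).topY = c.topY := rfl
  have htop := (h.box _ h.foot_mem).2.2
  rw [h.tip_snd] at htop
  constructor
  case path_eq => rfl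
  case tip_fst => rfl
  case head => exact head?_moveY (h.head?_moveX _) _
  case prudent => exact h.prudent_footPath_addBottom
  case box =>
    intro q hq
    rcases h.mem_footPath_addBottom hk hk' hq with hq | hq
    · have := h.box q hq
      omega
    · omega
  case hit_column => exact fun x h0 h1 => (h.hit_column_addBottom x h0 h1).imp fun _ => And.right
  case hit_row =>
    intro y h0 h1
    by_cases hy : c.bottomY ≤ y
    · exact (h.hit_row y hy h1).imp fun _ hx => h.subset_footPath_addBottom hx
    · exact ⟨_, show y = c.bottomY - 1 by omega ▸ h.foot_mem_addBottom⟩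
  case free_right => exact fun q hq hq2 => (h.bottom_row_addBottom hk hk' q hq hq2).le

theorem BottomInvariant.bottomInvariant_addBottom (h : c.BottomInvariant) (hk : 1 ≤ k)
    (hk' : k + 1 ≤ c.width) : (addBottom c k).BottomInvariant where
  toFootInvariant := h.footInvariant_addBottom hk hk'
  tip_snd := bottomY_addBottom.symm
  hit_column_above := by
    rw [bottomY_addBottom]
    exact h.hit_column_addBottom
  bottom_row := by
    rw [bottomY_addBottom]
    exact h.bottom_row_addBottom hk hk'

end Bottom

theorem Valid.invariants : ∀ {c : Construction}, c.Valid →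
    c.PathInvariant ∧ (c.IsZ → c.BottomInvariant)
  | square, _ => ⟨pathInvariant_square, fun h => h.elim⟩
  | addTop _ _, ⟨hc, hk, hk'⟩ => ⟨hc.invariants.1.pathInvariant_addTop hk hk', fun h => h.elim⟩
  | addRight _ _, ⟨hc, hX, hk, hk'⟩ =>
    ⟨(hc.invariants.1.footInvariant_addRight hX hk hk').pathInvariant id,
      hc.invariants.1.bottomInvariant_addRight hX hk hk'⟩
  | addBottom _ _, ⟨hc, hZ, hk, hk'⟩ =>
    have h := (hc.invariants.2 hZ).bottomInvariant_addBottom hk hk'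
    ⟨h.pathInvariant id, fun _ => h⟩

theorem Valid.pathInvariant (h : c.Valid) : c.PathInvariant := h.invariants.1

theorem Valid.bottomInvariant (h : c.Valid) (hZ : c.IsZ) : c.BottomInvariant := h.invariants.2 hZ

theorem PathInvariant.head?_left (h : c.PathInvariant) :
    (moveX (-1) (moveY c.topY c.path)).head? = some (-1, c.topY) :=
  head?_moveX h.head?_up _

theorem PathInvariant.head?_loop (h : c.PathInvariant) : c.loop.head? = some (-1, 0) :=
  head?_moveY h.head?_left _

theorem PathInvariant.prudent_loop (h : c.PathInvariant) : PrudentPath c.loop := by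
  have htip := h.tip_box
  have htop := h.one_le_topY
  refine (h.prudent_moveX_up _).moveY h.head?_left _ (fun hlt => ?_) (fun _ q hq hq1 => ?_)
  · dsimp only at hlt
    omega
  · rcases (mem_moveX h.head?_up _ q).1 hq with hq | hq
    · rcases (h.mem_up q).1 hq with hq | hq
      · have := h.box q hq
        dsimp only at hq1
        omega
      · dsimp only at hq1
        omega
    · exact hq.1.ge

end Construction

/-! ### Every prudent walk in the right half-plane comes from a construction -/

section FreeMoves

variable {p : ℤ × ℤ} {l : List (ℤ × ℤ)}

theorem moveX_add_one_of_free (h : l.head? = some p) {x : ℤ}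
    (free : ∀ q ∈ moveX x l, q.2 = p.2 → q.1 ≤ x) : (x + 1, p.2) :: moveX x l = moveX (x + 1) l :=
  (moveX_add_one h
    (free p ((mem_moveX h x p).2 (.inl (List.mem_of_mem_head? h))) rfl)).symm

theorem moveX_sub_one_of_free (h : l.head? = some p) {x : ℤ}
    (free : ∀ q ∈ moveX x l, q.2 = p.2 → x ≤ q.1) : (x - 1, p.2) :: moveX x l = moveX (x - 1) l :=
  (moveX_sub_one h
    (free p ((mem_moveX h x p).2 (.inl (List.mem_of_mem_head? h))) rfl)).symm

theorem moveY_add_one_of_free (h : l.head? = some p) {y : ℤ}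
    (free : ∀ q ∈ moveY y l, q.1 = p.1 → q.2 ≤ y) : (p.1, y + 1) :: moveY y l = moveY (y + 1) l :=
  (moveY_add_one h
    (free p ((mem_moveY h y p).2 (.inl (List.mem_of_mem_head? h))) rfl)).symm

theorem moveY_sub_one_of_free (h : l.head? = some p) {y : ℤ}
    (free : ∀ q ∈ moveY y l, q.1 = p.1 → y ≤ q.2) : (p.1, y - 1) :: moveY y l = moveY (y - 1) l :=
  (moveY_sub_one h
    (free p ((mem_moveY h y p).2 (.inl (List.mem_of_mem_head? h))) rfl)).symm

end FreeMoves

open Construction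

/-- The walks met on the way when a polygon is built up. They turn out to be all prudent walks in
the right half-plane; each of them is on top of, to the right of, or below a polygon. -/
inductive IsPartialPath (l : List (ℤ × ℤ)) : Prop
  | onTop (c : Construction) (k : ℕ) (hc : c.Valid) (hk : 1 ≤ k) (hk' : k ≤ c.width)
      (eq : l = (addTop c k).path)
  | onRight (c : Construction) (y : ℤ) (hc : c.Valid) (hX : ¬ c.IsX) (hy : c.bottomY ≤ y)
      (hy' : y ≤ c.topY - 1) (eq : l = moveY y c.path)
  | onBottom (c : Construction) (x : ℤ) (hc : c.Valid) (hZ : c.IsZ) (hx : 0 ≤ x)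
      (hx' : x ≤ c.width - 2) (eq : l = moveX x c.footPath)

theorem isPartialPath_path {c : Construction} (hc : c.Valid) (hX : ¬ c.IsX) :
    IsPartialPath c.path :=
  have h := hc.pathInvariant.tip_box
  .onRight c c.tip.2 hc hX h.2.2.1 h.2.2.2 (moveY_self hc.pathInvariant.head).symm

theorem isPartialPath_step_top {c : Construction} {k : ℕ} (hc : c.Valid) (hk : 1 ≤ k)
    (hk' : k ≤ c.width) {r : ℤ × ℤ} (hr : 0 ≤ r.1)
    (hf : FreeStep ((k : ℤ) - 1, c.topY) r (addTop c k).path) :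
    IsPartialPath (r :: (addTop c k).path) := by
  have h := hc.pathInvariant
  have hup := h.head?_up
  have hv : (addTop c k).Valid := ⟨hc, hk, by omega⟩
  rcases hf with ⟨rfl, free⟩ | ⟨rfl, free⟩ | ⟨rfl, -⟩ | ⟨rfl, free⟩
  · have eq : ((k : ℤ) - 1 + 1, c.topY) :: (addTop c k).path = (addTop c (k + 1)).path :=
      (moveX_add_one_of_free hup free).trans
        (congrArg (moveX · (moveY c.topY c.path)) (by push_cast; ring))
    rw [eq]
    rcases hk'.eq_or_lt with hk' | hk'
    · exact isPartialPath_path ⟨hc, by omega, by omega⟩ (by simp only [IsX]; omega)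
    · exact .onTop c (k + 1) hc (by omega) hk' rfl
  · dsimp only at hr
    exact .onTop c (k - 1) hc (by omega) (by omega) ((moveX_sub_one_of_free hup free).trans
      (congrArg (moveX · (moveY c.topY c.path)) (by omega)))
  · have hhead : (addTop c k).path.head? = some ((k : ℤ) - 1, c.topY) := hv.pathInvariant.head
    refine .onTop (addTop c k) k hv hk (le_max_right _ _) ?_
    calc ((k : ℤ) - 1, c.topY + 1) :: (addTop c k).path
        = moveY (c.topY + 1) (addTop c k).path := by
          rw [moveY_add_one hhead le_rfl, moveY_self hhead]
      _ = moveX ((k : ℤ) - 1) (moveY (c.topY + 1) (addTop c k).path) :=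
          (moveX_self (head?_moveY hhead _)).symm
  · obtain ⟨y, hy⟩ := h.hit_column ((k : ℤ) - 1) (by omega) (by omega)
    have hbox := h.box _ hy
    have hle := free _ (h.subset_path_addTop hy) rfl
    dsimp only at hbox hle
    omega

theorem isPartialPath_step_right {c : Construction} {y : ℤ} (hc : c.Valid) (hX : ¬ c.IsX)
    (hy : c.bottomY ≤ y) (hy' : y ≤ c.topY - 1) {r : ℤ × ℤ} (hr : 0 ≤ r.1)
    (hf : FreeStep (c.tip.1, y) r (moveY y c.path)) : IsPartialPath (r :: moveY y c.path) := by
  have h := hc.pathInvariant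
  have htip := h.tip_right hX
  have hby : c.bottomY = c.topY - c.height := rfl
  have hw := hc.one_le_width
  rcases hf with ⟨rfl, -⟩ | ⟨rfl, free⟩ | ⟨rfl, free⟩ | ⟨rfl, free⟩
  · obtain ⟨k, hk⟩ : ∃ k : ℕ, c.topY - k = y := ⟨(c.topY - y).toNat, by omega⟩
    have hhead := head?_moveY h.head y
    have eq : (c.tip.1 + 1, y) :: moveY y c.path = (addRight c k).path :=
      calc (c.tip.1 + 1, y) :: moveY y c.path
          = moveX (c.tip.1 + 1) (moveY y c.path) := by
            rw [moveX_add_one hhead le_rfl, moveX_self hhead]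
        _ = moveX c.width (moveY (c.topY - k) c.path) := by rw [hk, htip, sub_add_cancel]
    rw [eq]
    exact isPartialPath_path ⟨hc, hX, by omega, by omega⟩ id
  · dsimp only at hr
    obtain ⟨x, hx, hmem⟩ := h.hit_row_left hX (by omega) y hy hy'
    have := free _ ((mem_moveY h.head y _).2 (.inl hmem)) rfl
    dsimp only at this
    omega
  · rw [moveY_add_one_of_free h.head free]
    rcases hy'.eq_or_lt with rfl | hlt
    · refine .onTop c c.width hc hw le_rfl ?_
      have hself := moveX_self h.head?_up
      rw [sub_add_cancel, ← hself, htip]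
      rfl
    · exact .onRight c (y + 1) hc hX (by omega) (by omega) rfl
  · rw [moveY_sub_one_of_free h.head free]
    rcases hy.eq_or_lt with rfl | hlt
    · have hv : (addRight c (c.height + 1)).Valid := ⟨hc, hX, by omega, le_rfl⟩
      have hZ : (addRight c (c.height + 1)).IsZ := Nat.lt_succ_self _
      have hself := moveX_self (hv.bottomInvariant hZ).head
      refine .onBottom _ (c.width - 1) hv hZ (by omega) (by rw [cast_width_addRight]; omega) ?_
      rw [show c.bottomY - 1 = c.topY - (c.height + 1 : ℕ) by omega]
      exact hself.symm
    · exact .onRight c (y - 1) hc hX (by omega) (by omega) rfl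

theorem isPartialPath_step_bottom {c : Construction} {x : ℤ} (hc : c.Valid) (hZ : c.IsZ)
    (hx : 0 ≤ x) (hx' : x ≤ c.width - 2) {r : ℤ × ℤ} (hr : 0 ≤ r.1)
    (hf : FreeStep (x, c.bottomY) r (moveX x c.footPath)) :
    IsPartialPath (r :: moveX x c.footPath) := by
  have h := hc.bottomInvariant hZ
  rcases hf with ⟨rfl, free⟩ | ⟨rfl, free⟩ | ⟨rfl, free⟩ | ⟨rfl, -⟩
  · rw [moveX_add_one_of_free h.head?_footPath free]
    rcases hx'.eq_or_lt with rfl | hlt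
    · rw [show (c.width : ℤ) - 2 + 1 = c.width - 1 by ring, ← h.path_eq]
      exact isPartialPath_path hc (not_isX_of_isZ hZ)
    · exact .onBottom c (x + 1) hc hZ (by omega) (by omega) rfl
  · rw [moveX_sub_one_of_free h.head?_footPath free]
    exact .onBottom c (x - 1) hc hZ hr (by omega) rfl
  · obtain ⟨y, hlt, hmem⟩ := h.hit_column_above x hx hx'
    have := free _ ((mem_moveX h.head?_footPath x _).2 (.inl hmem)) rfl
    dsimp only at this
    omega
  · obtain ⟨k, hk⟩ : ∃ k : ℕ, (c.width : ℤ) - 1 - k = x := ⟨(c.width - 1 - x).toNat, by omega⟩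
    have hhead := h.head?_moveX x
    have hv : (addBottom c k).Valid := ⟨hc, hZ, by omega, by omega⟩
    have hself := moveX_self (hv.bottomInvariant trivial).head
    refine .onBottom (addBottom c k) x hv trivial hx hx' ?_
    calc (x, c.bottomY - 1) :: moveX x c.footPath
        = moveY (c.bottomY - 1) (moveX x c.footPath) := by
          rw [moveY_sub_one hhead le_rfl, moveY_self hhead]
      _ = (addBottom c k).footPath := by rw [← hk]; rfl
      _ = moveX x (addBottom c k).footPath := by rw [← hk]; exact hself.symm

theorem PrudentPath.isPartialPath {l : List (ℤ × ℤ)} (h : PrudentPath l)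
    (hpos : ∀ q ∈ l, 0 ≤ q.1) : IsPartialPath l := by
  induction h with
  | start => exact isPartialPath_path (c := square) trivial id
  | @step p r l _ hf ih =>
    obtain ⟨hr, hpos⟩ := List.forall_mem_cons.1 hpos
    rcases ih hpos with
      ⟨c, k, hc, hk, hk', eq⟩ | ⟨c, y, hc, hX, hy, hy', eq⟩ | ⟨c, x, hc, hZ, hx, hx', eq⟩
    · have hp : some p = some ((k : ℤ) - 1, c.topY) :=
        (congrArg List.head? eq).trans (head?_moveX hc.pathInvariant.head?_up _)
      rw [eq] at hf ⊢
      rw [Option.some_inj.1 hp] at hf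
      exact isPartialPath_step_top hc hk hk' hr hf
    · have hp : some p = some (c.tip.1, y) :=
        (congrArg List.head? eq).trans (head?_moveY hc.pathInvariant.head _)
      rw [eq] at hf ⊢
      rw [Option.some_inj.1 hp] at hf
      exact isPartialPath_step_right hc hX hy hy' hr hf
    · have hp : some p = some (x, c.bottomY) :=
        (congrArg List.head? eq).trans ((hc.bottomInvariant hZ).head?_moveX _)
      rw [eq] at hf ⊢
      rw [Option.some_inj.1 hp] at hf
      exact isPartialPath_step_bottom hc hZ hx hx' hr hf

theorem PrudentPath.exists_exit {l : List (ℤ × ℤ)} (h : PrudentPath l) :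
    (∀ q ∈ l, 0 ≤ q.1) ∨ ∃ y t, (-1, y) :: (0, y) :: t <:+ l ∧
      PrudentPath ((0, y) :: t) ∧ ∀ q ∈ (0, y) :: t, 0 ≤ q.1 := by
  induction h with
  | start => exact .inl (List.forall_mem_singleton.2 le_rfl)
  | @step p r l hl hf ih =>
    rcases ih with ih | ⟨y, t, hs, ht⟩
    · by_cases hr : 0 ≤ r.1
      · exact .inl (List.forall_mem_cons.2 ⟨hr, ih⟩)
      · have hp := ih p List.mem_cons_self
        obtain ⟨y, rfl, rfl⟩ : ∃ y, p = (0, y) ∧ r = (-1, y) := by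
          refine ⟨p.2, Prod.ext ?_ rfl, ?_⟩ <;>
            rcases hf with ⟨rfl, -⟩ | ⟨rfl, -⟩ | ⟨rfl, -⟩ | ⟨rfl, -⟩ <;>
            simp only [Prod.mk.injEq, and_true] at hr ⊢ <;> omega
        exact .inr ⟨y, l, List.suffix_rfl, hl, ih⟩
    · exact .inr ⟨y, t, hs.trans (List.suffix_cons _ _), ht⟩

/-- The walk `m` has just left the right half-plane through the top of its bounding box. A step to
`(-1, y)` from the left would end off the border of the walk, and so would one from the right start,
unless `(0, y)` is already occupied by `m`. -/
theorem PrudentPath.eq_above_of_suffix {l m : List (ℤ × ℤ)} {p : ℤ × ℤ} {a y : ℤ}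
    (h : PrudentPath ((-1, y) :: p :: l)) (hm : m.head? = some (-1, a)) (ho : (0, 0) ∈ m)
    (hrow : (∀ q ∈ m, q.1 ≤ 0) → ∀ z, 0 < z → z < a → (0, z) ∈ m) (h0 : 0 ≤ y) (h1 : y ≤ a)
    (hs : m <:+ p :: l) : p = (-1, y + 1) := by
  have ha := hs.subset (List.mem_of_mem_head? hm)
  have ho' := hs.subset ho
  have hb := h.onBorder_head
  obtain @⟨⟩ | ⟨hl, hf⟩ := h
  have hlt : y < a := h1.lt_of_ne fun e => hf.not_mem (e ▸ ha)
  rcases hf with ⟨hp, free⟩ | ⟨hp, -⟩ | ⟨hp, free⟩ | ⟨hp, -⟩ <;>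
    obtain ⟨x, z⟩ := p <;> simp only [Prod.mk.injEq] at hp <;> obtain ⟨hx, rfl⟩ := hp
  · have hfree := free _ ho'
    rcases hb with hb | hb | hb | hb
    all_goals
      have hbp := hb _ (List.mem_cons_of_mem _ List.mem_cons_self)
      have hbo := hb _ (List.mem_cons_of_mem _ ho')
      have hba := hb _ (List.mem_cons_of_mem _ ha)
      dsimp only at hfree hbp hbo hba
      omega
  · obtain rfl : x = 0 := by omega
    have hml : m <:+ l := (List.suffix_cons_iff.1 hs).resolve_left fun e => by simp [e] at hm
    have hnot : (0, y) ∉ m := fun hy => (List.nodup_cons.1 hl.nodup).1 (hml.subset hy)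
    have hy : y ≠ 0 := fun e => hnot (e ▸ ho)
    rcases hl.onBorder_head with hb | hb | hb | hb
    · exact (hnot (hrow (fun q hq => hb q (hs.subset hq)) y (by omega) hlt)).elim
    all_goals
      have hbo := hb _ ho'
      have hba := hb _ ha
      dsimp only at hbo hba
      omega
  · have := free _ ha hx
    dsimp only at this
    omega
  · rw [Prod.mk.injEq]
    omega

theorem PrudentPath.eq_moveY_of_suffix {l m : List (ℤ × ℤ)} {a : ℤ} (h : PrudentPath l)
    (hm : m.head? = some (-1, a)) (ho : (0, 0) ∈ m)
    (hrow : (∀ q ∈ m, q.1 ≤ 0) → ∀ z, 0 < z → z < a → (0, z) ∈ m) :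
    ∀ y, l.head? = some (-1, y) → 0 ≤ y → y ≤ a → m <:+ l → l = moveY y m := by
  induction h with
  | start => intro y hy; simp at hy
  | @step p r l hl hf ih =>
    intro y hy h0 h1 hs
    obtain rfl : r = (-1, y) := Option.some_inj.1 hy
    rcases List.suffix_cons_iff.1 hs with rfl | hs
    · obtain rfl : y = a := congrArg Prod.snd (Option.some_inj.1 hm)
      exact (moveY_self hm).symm
    have hlt : y < a := h1.lt_of_ne fun e =>
      hf.not_mem (e ▸ hs.subset (List.mem_of_mem_head? hm))
    obtain rfl := (hl.step hf).eq_above_of_suffix hm ho hrow h0 h1 hs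
    calc (-1, y) :: (-1, y + 1) :: l
        = (-1, y + 1 - 1) :: moveY (y + 1) m := by
          rw [← ih (y + 1) rfl (by omega) hlt hs, add_sub_cancel_right]
      _ = moveY y m := by rw [← moveY_sub_one hm hlt, add_sub_cancel_right]

theorem eq_square_of_width_eq_one {c : Construction} (hc : c.Valid) (hX : ¬ c.IsX)
    (hw : c.width = 1) : c = square := by
  cases c with
  | square => rfl
  | addTop c k =>
    have := hc.1.one_le_width
    simp only [IsX] at hX
    simp only [Construction.width] at hw
    omega
  | addRight c k =>
    have := hc.1.one_le_width
    simp only [Construction.width] at hw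
    omega
  | addBottom c k =>
    have := hc.2.2
    simp only [Construction.width] at hw
    omega

theorem IsPartialPath.exists_eq_up {y : ℤ} {t : List (ℤ × ℤ)} (h : IsPartialPath ((0, y) :: t))
    (hy : 0 < y) : ∃ c : Construction, c.Valid ∧ y = c.topY ∧ (0, y) :: t = (addTop c 1).path := by
  rcases h with ⟨c, k, hc, hk, hk', eq⟩ | ⟨c, z, hc, hX, hz, hz', eq⟩ | ⟨c, x, hc, hZ, -, -, eq⟩
  · have head : some ((0 : ℤ), y) = some ((k : ℤ) - 1, c.topY) :=
      (congrArg List.head? eq).trans (head?_moveX hc.pathInvariant.head?_up _)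
    simp only [Option.some_inj, Prod.mk.injEq] at head
    obtain rfl : k = 1 := by omega
    exact ⟨c, hc, head.2, eq⟩
  · have head : some ((0 : ℤ), y) = some (c.tip.1, z) :=
      (congrArg List.head? eq).trans (head?_moveY hc.pathInvariant.head _)
    simp only [Option.some_inj, Prod.mk.injEq] at head
    have htip := hc.pathInvariant.tip_right hX
    obtain rfl := eq_square_of_width_eq_one hc hX (by omega)
    simp only [topY] at hz'
    omega
  · have head : some ((0 : ℤ), y) = some (x, c.bottomY) :=
      (congrArg List.head? eq).trans ((hc.bottomInvariant hZ).head?_moveX _)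
    simp only [Option.some_inj, Prod.mk.injEq] at head
    have := hc.pathInvariant.bottomY_nonpos
    omega

theorem PrudentPath.exists_loop_of_exit {l t : List (ℤ × ℤ)} {y : ℤ} (h : PrudentPath l)
    (hl : l.head? = some (-1, 0)) (hy : 0 < y) (hs : (-1, y) :: (0, y) :: t <:+ l)
    (ht : PrudentPath ((0, y) :: t)) (hpos : ∀ q ∈ (0, y) :: t, 0 ≤ q.1) :
    ∃ c : Construction, c.Valid ∧ l = c.loop := by
  obtain ⟨c, hc, rfl, eq⟩ := (ht.isPartialPath hpos).exists_eq_up hy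
  have hi := hc.pathInvariant
  have hm : (-1, c.topY) :: (0, c.topY) :: t = moveX (-1) (moveY c.topY c.path) := by
    rw [eq]
    exact (moveX_sub_one hi.head?_up hi.tip_box.1).symm
  have hsub : c.path ⊆ moveX (-1) (moveY c.topY c.path) := fun q hq =>
    (mem_moveX hi.head?_up _ _).2 (.inl ((hi.mem_up _).2 (.inl hq)))
  refine ⟨c, hc, h.eq_moveY_of_suffix hi.head?_left (hsub hi.prudent.origin_mem)
    (fun hneg z h0 h1 => ?_) 0 hl le_rfl hy.le (hm ▸ hs)⟩
  obtain ⟨x, hx⟩ := hi.hit_row z (hi.bottomY_nonpos.trans h0.le) (by omega)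
  obtain rfl : x = 0 := le_antisymm (hneg _ (hsub hx)) (hi.box _ hx).1
  exact hsub hx

theorem PrudentPath.exists_loop {l : List (ℤ × ℤ)} (h : PrudentPath l)
    (hl : l.head? = some (-1, 0)) (hlen : 2 < l.length) :
    ∃ c : Construction, c.Valid ∧ (l = c.loop ∨ l = c.loop.map reflect) := by
  rcases h.exists_exit with hpos | ⟨y, t, hs, ht, hpos⟩
  · exact absurd (hpos _ (List.mem_of_mem_head? hl)) (by decide)
  rcases lt_trichotomy y 0 with hy | rfl | hy
  · obtain ⟨c, hc, eq⟩ := h.map_reflect.exists_loop_of_exit (y := -y) (t := t.map reflect)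
      (by rw [List.head?_map, hl]; rfl) (by omega) (hs.map reflect) ht.map_reflect
      (List.forall_mem_cons.2 ⟨le_rfl, List.forall_mem_map.2 (List.forall_mem_cons.1 hpos).2⟩)
    exact ⟨c, hc, .inr (by rw [← eq, map_reflect_map_reflect])⟩
  · obtain rfl : t = [] := by_contra fun hne => ht.head_ne_origin hne rfl
    obtain ⟨_ | ⟨a, m⟩, rfl⟩ := hs
    · exact absurd hlen (by decide)
    · obtain rfl : a = (-1, 0) := Option.some_inj.1 hl
      exact absurd h.nodup (by simp)
  · obtain ⟨c, hc, eq⟩ := h.exists_loop_of_exit hl hy hs ht hpos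
    exact ⟨c, hc, .inl eq⟩

/-! ### Enclosed cells -/

theorem leftCell_right (t y : ℤ) : leftCell (t, y) (t + 1, y) = (t, y) := by
  simp [leftCell]

theorem leftCell_left (t y : ℤ) : leftCell (t + 1, y) (t, y) = (t, y - 1) := by
  have h1 : t ≠ t + 1 + 1 := by omega
  simp [leftCell, h1, sub_eq_add_neg]

theorem leftCell_up (x t : ℤ) : leftCell (x, t) (x, t + 1) = (x - 1, t) := by
  simp [leftCell, sub_eq_add_neg]

theorem leftCell_down (x t : ℤ) : leftCell (x, t + 1) (x, t) = (x, t) := by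
  have h1 : t ≠ t + 1 + 1 := by omega
  simp [leftCell, h1]

theorem odd_add_ite (n : ℕ) (P : Prop) [Decidable P] :
    Odd (n + if P then 1 else 0) ↔ (Odd n ↔ ¬ P) := by
  split_ifs with h <;> simp [h, Nat.odd_add_one]

/-- The cells to the left of the walk `l` belong to `S`. -/
def LeftCellsIn (S : Set (ℤ × ℤ)) (l : List (ℤ × ℤ)) : Prop :=
  ∀ e ∈ pathEdges l, leftCell e.1 e.2 ∈ S

theorem LeftCellsIn.mono {S T : Set (ℤ × ℤ)} {l : List (ℤ × ℤ)} (h : LeftCellsIn S l)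
    (hST : S ⊆ T) : LeftCellsIn T l :=
  fun e he => hST (h e he)

protected theorem LeftCellsIn.moveX {S : Set (ℤ × ℤ)} {l : List (ℤ × ℤ)} {p : ℤ × ℤ} {x : ℤ}
    (h : LeftCellsIn S l) (hp : l.head? = some p)
    (right : ∀ t, p.1 ≤ t → t < x → (t, p.2) ∈ S)
    (left : ∀ t, x ≤ t → t < p.1 → (t, p.2 - 1) ∈ S) : LeftCellsIn S (moveX x l) := by
  intro e he
  rcases mem_pathEdges_moveX hp x e he with he | ⟨t, h1, h2, rfl⟩ | ⟨t, h1, h2, rfl⟩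
  · exact h e he
  · rw [leftCell_right]
    exact right t h1 h2
  · rw [leftCell_left]
    exact left t h1 h2

protected theorem LeftCellsIn.moveY {S : Set (ℤ × ℤ)} {l : List (ℤ × ℤ)} {p : ℤ × ℤ} {y : ℤ}
    (h : LeftCellsIn S l) (hp : l.head? = some p)
    (up : ∀ t, p.2 ≤ t → t < y → (p.1 - 1, t) ∈ S)
    (down : ∀ t, y ≤ t → t < p.2 → (p.1, t) ∈ S) : LeftCellsIn S (moveY y l) := by
  intro e he
  rcases mem_pathEdges_moveY hp y e he with he | ⟨t, h1, h2, rfl⟩ | ⟨t, h1, h2, rfl⟩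
  · exact h e he
  · rw [leftCell_up]
    exact up t h1 h2
  · rw [leftCell_down]
    exact down t h1 h2

namespace Construction

/-- The cells of the polygon. -/
protected def cells : Construction → Set (ℤ × ℤ)
  | square => {(-1, 0)}
  | addTop c k => c.cells ∪ {q | q.2 = c.topY ∧ -1 ≤ q.1 ∧ q.1 < k - 1}
  | addRight c k => c.cells ∪ {q | q.1 = c.width - 1 ∧ c.topY - k ≤ q.2 ∧ q.2 < c.topY}
  | addBottom c k =>
    c.cells ∪ {q | q.2 = c.bottomY - 1 ∧ c.width - 1 - k ≤ q.1 ∧ q.1 < c.width - 1}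

variable {c : Construction} {k : ℕ} {q : ℤ × ℤ}

theorem mem_cells_square : q ∈ square.cells ↔ q.1 = -1 ∧ q.2 = 0 := Prod.ext_iff

theorem mem_cells_addTop : q ∈ (addTop c k).cells ↔
    q ∈ c.cells ∨ q.2 = c.topY ∧ -1 ≤ q.1 ∧ q.1 < k - 1 := Iff.rfl

theorem mem_cells_addRight : q ∈ (addRight c k).cells ↔
    q ∈ c.cells ∨ q.1 = c.width - 1 ∧ c.topY - k ≤ q.2 ∧ q.2 < c.topY := Iff.rfl

theorem mem_cells_addBottom : q ∈ (addBottom c k).cells ↔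
    q ∈ c.cells ∨ q.2 = c.bottomY - 1 ∧ c.width - 1 - k ≤ q.1 ∧ q.1 < c.width - 1 := Iff.rfl

theorem Valid.cells_box : ∀ {c : Construction}, c.Valid → ∀ {q : ℤ × ℤ}, q ∈ c.cells →
    -1 ≤ q.1 ∧ q.1 ≤ c.width - 2 ∧ c.bottomY ≤ q.2 ∧ q.2 ≤ c.topY - 1
  | square, _, q, hq => by
    rw [mem_cells_square] at hq
    simp only [bottomY, topY, Construction.width, Construction.height]
    omega
  | addTop c k, h, q, hq => by
    have hpos := h.1.one_le_height
    have hbottom : c.bottomY = c.topY - c.height := rfl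
    rw [bottomY_addTop, cast_width_addTop, topY]
    rcases hq with hq | ⟨h1, h2, h3⟩
    · have := h.1.cells_box hq
      omega
    · omega
  | addRight c k, h, q, hq => by
    have hbottom : c.bottomY = c.topY - c.height := rfl
    rw [bottomY_addRight, cast_width_addRight, topY]
    rcases hq with hq | ⟨h1, h2, h3⟩
    · have := h.1.cells_box hq
      omega
    · omega
  | addBottom c k, h, q, hq => by
    have hbottom : c.bottomY = c.topY - c.height := rfl
    rw [bottomY_addBottom, topY, Construction.width]
    rcases hq with hq | ⟨h1, h2, h3⟩
    · have := h.1.cells_box hq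
      omega
    · have := h.2.2
      omega

theorem Valid.mem_cells_left : ∀ {c : Construction}, c.Valid → ∀ {y : ℤ}, 0 ≤ y → y < c.topY →
    (-1, y) ∈ c.cells
  | square, _, y, h0, hy => mem_cells_square.2 ⟨rfl, by rw [topY] at hy; omega⟩
  | addTop c k, h, y, h0, hy => by
    rcases lt_or_ge y c.topY with hlt | hge
    · exact .inl (h.1.mem_cells_left h0 hlt)
    · have := h.2
      rw [topY] at hy
      exact .inr ⟨by dsimp only; omega, le_rfl, by dsimp only; omega⟩
  | addRight _ _, h, _, h0, hy => .inl (h.1.mem_cells_left h0 hy)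
  | addBottom _ _, h, _, h0, hy => .inl (h.1.mem_cells_left h0 hy)

theorem Valid.mem_cells_top : ∀ {c : Construction}, c.Valid → ∀ {x : ℤ}, -1 ≤ x → x < c.tip.1 →
    (x, c.topY - 1) ∈ c.cells
  | square, _, x, h1, hx => mem_cells_square.2 ⟨by simp only [tip] at hx; omega, rfl⟩
  | addTop c k, _, x, h1, hx => .inr ⟨add_sub_cancel_right _ _, h1, hx⟩
  | addRight c k, h, x, h1, hx => by
    have hright := h.1.pathInvariant.tip_right h.2.1
    have := h.2.2
    simp only [tip] at hx
    rcases lt_or_ge x (c.width - 1) with hlt | hge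
    · exact .inl (h.1.mem_cells_top h1 (by omega))
    · exact .inr ⟨by dsimp only; omega, by simp only [topY]; omega, by simp only [topY]; omega⟩
  | addBottom c k, h, x, h1, hx => by
    have hright := h.1.pathInvariant.tip_right (not_isX_of_isZ h.2.1)
    exact .inl (h.1.mem_cells_top h1 (by rwa [hright]))

theorem Valid.mem_cells_right : ∀ {c : Construction}, c.Valid → ¬ c.IsX → ∀ {y : ℤ}, c.tip.2 ≤ y →
    y < c.topY → ((c.width : ℤ) - 2, y) ∈ c.cells
  | square, _, _, y, h1, hy => mem_cells_square.2
    ⟨rfl, by simp only [tip, topY] at h1 hy; omega⟩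
  | addTop c k, _, hX, y, h1, hy => by
    simp only [tip, topY, IsX] at h1 hy hX
    rw [mem_cells_addTop, cast_width_addTop]
    dsimp only
    omega
  | addRight c k, _, _, y, h1, hy => by
    rw [mem_cells_addRight, cast_width_addRight]
    exact .inr ⟨by dsimp only; omega, h1, hy⟩
  | addBottom c k, h, _, y, h1, hy => by
    have htip := (h.1.bottomInvariant h.2.1).tip_snd
    have := h.2.2
    simp only [tip] at h1
    rcases lt_or_ge y c.bottomY with hlt | hge
    · exact .inr ⟨by dsimp only; omega, by simp only [Construction.width]; omega,
        by simp only [Construction.width]; omega⟩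
    · exact .inl (h.1.mem_cells_right (not_isX_of_isZ h.2.1) (by omega) hy)

theorem mem_cells_bottom : ∀ {c : Construction}, c.IsZ → ∀ {x : ℤ}, c.footX ≤ x →
    x ≤ c.width - 2 → (x, c.bottomY) ∈ c.cells
  | addRight c k, hZ, x, h1, hx => by
    simp only [footX, cast_width_addRight, IsZ] at h1 hx hZ
    rw [bottomY_addRight]
    exact .inr ⟨by dsimp only; omega, by dsimp only; omega, by dsimp only; omega⟩
  | addBottom c k, _, x, h1, hx => by
    simp only [footX, Construction.width] at h1 hx
    exact .inr ⟨bottomY_addBottom, h1, by dsimp only; omega⟩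

theorem Valid.mem_cells_top_of_not_isX (h : c.Valid) (hX : ¬ c.IsX) {x : ℤ} (h1 : -1 ≤ x)
    (h2 : x ≤ c.width - 2) : (x, c.topY - 1) ∈ c.cells :=
  h.mem_cells_top h1 (by have := h.pathInvariant.tip_right hX; omega)

theorem Valid.mem_cells_top_left (h : c.Valid) : (-1, c.topY - 1) ∈ c.cells :=
  h.mem_cells_left (by have := h.pathInvariant.one_le_topY; omega) (sub_one_lt _)

theorem Valid.snd_nonneg_of_left : ∀ {c : Construction}, c.Valid → ∀ {q : ℤ × ℤ}, q ∈ c.cells →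
    q.1 = -1 → 0 ≤ q.2
  | square, _, _, hq, _ => (mem_cells_square.1 hq).2.ge
  | addTop c k, h, q, hq, hleft => by
    rcases hq with hq | ⟨hq, -⟩
    · exact h.1.snd_nonneg_of_left hq hleft
    · have := h.1.pathInvariant.one_le_topY
      omega
  | addRight c k, h, q, hq, hleft => by
    rcases hq with hq | ⟨hq, -⟩
    · exact h.1.snd_nonneg_of_left hq hleft
    · have := h.1.one_le_width
      omega
  | addBottom c k, h, q, hq, hleft => by
    rcases hq with hq | ⟨-, hq, -⟩
    · exact h.1.snd_nonneg_of_left hq hleft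
    · have := h.2.2
      omega

theorem PathInvariant.crossings_loop (h : c.PathInvariant) (q : ℤ × ℤ) : crossings c.loop q =
    crossings c.path q + (if q.1 < c.tip.1 ∧ c.tip.2 ≤ q.2 ∧ q.2 < c.topY then 1 else 0) +
      (if q.1 < -1 ∧ 0 ≤ q.2 ∧ q.2 < c.topY then 1 else 0) := by
  have hbox := h.tip_box
  have htop := h.one_le_topY
  rw [loop, crossings_moveY h.head?_left, crossings_moveX h.head?_up, crossings_moveY h.head]
  dsimp only
  split_ifs <;> omega

theorem odd_crossings_square : Odd (crossings square.loop q) ↔ q ∈ square.cells := by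
  rw [pathInvariant_square.crossings_loop, mem_cells_square]
  simp only [path, paths, crossings, pathEdges, tip, topY, List.countP_nil]
  grind

theorem Valid.odd_crossings_addTop (h : (addTop c k).Valid)
    (ih : Odd (crossings c.loop q) ↔ q ∈ c.cells) :
    Odd (crossings (addTop c k).loop q) ↔ q ∈ (addTop c k).cells := by
  have hc := h.1.pathInvariant
  have hcells := h.1.cells_box (q := q)
  have htip := hc.tip_box
  have htop := hc.one_le_topY
  have hpath : crossings (addTop c k).path q = crossings (moveY c.topY c.path) q :=
    crossings_moveX hc.head?_up _ q
  rw [hc.crossings_loop] at ih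
  rw [h.pathInvariant.crossings_loop, hpath, crossings_moveY hc.head, mem_cells_addTop]
  simp only [odd_add_ite, tip_addTop, topY] at ih ⊢
  by_cases hodd : Odd (crossings c.path q) <;> by_cases hq : q ∈ c.cells <;>
    simp only [hodd, hq, true_iff, false_iff, iff_true, iff_false, true_or, false_or,
      forall_const] at ih hcells ⊢ <;> grind

theorem Valid.odd_crossings_addRight (h : (addRight c k).Valid)
    (ih : Odd (crossings c.loop q) ↔ q ∈ c.cells) :
    Odd (crossings (addRight c k).loop q) ↔ q ∈ (addRight c k).cells := by
  have hc := h.1.pathInvariant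
  have hcells := h.1.cells_box (q := q)
  have htip := hc.tip_box
  have hpath : crossings (addRight c k).path q = crossings (moveY (c.topY - k) c.path) q :=
    crossings_moveX (head?_moveY hc.head _) _ q
  have hright := hc.tip_right h.2.1
  rw [hc.crossings_loop] at ih
  rw [h.pathInvariant.crossings_loop, hpath, crossings_moveY hc.head, mem_cells_addRight]
  simp only [odd_add_ite, tip_addRight, topY] at ih ⊢
  by_cases hodd : Odd (crossings c.path q) <;> by_cases hq : q ∈ c.cells <;>
    simp only [hodd, hq, true_iff, false_iff, iff_true, iff_false, true_or, false_or,
      forall_const] at ih hcells ⊢ <;> grind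

theorem Valid.odd_crossings_addBottom (h : (addBottom c k).Valid)
    (ih : Odd (crossings c.loop q) ↔ q ∈ c.cells) :
    Odd (crossings (addBottom c k).loop q) ↔ q ∈ (addBottom c k).cells := by
  have hc := h.1.pathInvariant
  have hb := h.1.bottomInvariant h.2.1
  have hcells := h.1.cells_box (q := q)
  have htip := hc.tip_box
  have hpath : crossings (addBottom c k).path q = crossings (addBottom c k).footPath q :=
    crossings_moveX (h.bottomInvariant trivial).head?_footPath _ q
  have hfoot : crossings (addBottom c k).footPath q = _ := crossings_moveY (hb.head?_moveX _) _ q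
  have hright := hc.tip_right (not_isX_of_isZ h.2.1)
  have hbottom := hb.tip_snd
  rw [hc.crossings_loop, hb.path_eq, crossings_moveX hb.head] at ih
  rw [h.pathInvariant.crossings_loop, hpath, hfoot, crossings_moveX hb.head, mem_cells_addBottom]
  simp only [odd_add_ite, tip_addBottom, topY] at ih ⊢
  by_cases hodd : Odd (crossings c.footPath q) <;> by_cases hq : q ∈ c.cells <;>
    simp only [hodd, hq, true_iff, false_iff, iff_true, iff_false, true_or, false_or,
      forall_const] at ih hcells ⊢ <;> grind

theorem Valid.odd_crossings : ∀ {c : Construction}, c.Valid → ∀ q : ℤ × ℤ,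
    Odd (crossings c.loop q) ↔ q ∈ c.cells
  | square, _, _ => odd_crossings_square
  | addTop _ _, h, q => h.odd_crossings_addTop (h.1.odd_crossings q)
  | addRight _ _, h, q => h.odd_crossings_addRight (h.1.odd_crossings q)
  | addBottom _ _, h, q => h.odd_crossings_addBottom (h.1.odd_crossings q)

theorem Valid.leftCellsIn_up (h : c.Valid) (hl : LeftCellsIn c.cells c.path) :
    LeftCellsIn c.cells (moveY c.topY c.path) := by
  have hc := h.pathInvariant
  have hbox := hc.tip_box
  refine hl.moveY hc.head (fun t h1 h2 => ?_) (fun t h1 h2 => by omega)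
  by_cases hX : c.IsX
  · have := hc.tip_top hX
    rw [show t = c.topY - 1 by omega]
    exact h.mem_cells_top (by omega) (by omega)
  · have := h.mem_cells_right hX h1 h2
    rwa [hc.tip_right hX, sub_sub]

theorem Valid.leftCellsIn_path_addTop (h : (addTop c k).Valid) (hl : LeftCellsIn c.cells c.path) :
    LeftCellsIn (addTop c k).cells (addTop c k).path := by
  have hc := h.1.pathInvariant
  have htip := hc.tip_box
  refine ((h.1.leftCellsIn_up hl).mono Set.subset_union_left).moveX hc.head?_up
    (fun t h1 h2 => .inr ⟨rfl, ?_, h2⟩) (fun t h1 h2 => .inl (h.1.mem_cells_top ?_ h2))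
  · dsimp only at h1 ⊢
    omega
  · omega

theorem Valid.leftCellsIn_footPath_addRight (h : (addRight c k).Valid)
    (hl : LeftCellsIn c.cells c.path) :
    LeftCellsIn (addRight c k).cells (addRight c k).footPath := by
  have hc := h.1.pathInvariant
  have htip := hc.tip_box
  have hright := hc.tip_right h.2.1
  refine (hl.mono Set.subset_union_left).moveY hc.head (fun t h1 h2 => .inl ?_)
    (fun t h1 h2 => .inr ⟨hright, h1, ?_⟩)
  · have := h.1.mem_cells_right h.2.1 h1 (by omega)
    rwa [hright, sub_sub]
  · dsimp only
    omega

theorem Valid.leftCellsIn_path_addRight (h : (addRight c k).Valid)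
    (hl : LeftCellsIn c.cells c.path) :
    LeftCellsIn (addRight c k).cells (addRight c k).path := by
  have hc := h.1.pathInvariant
  have hright := hc.tip_right h.2.1
  have := h.2.2
  refine (h.leftCellsIn_footPath_addRight hl).moveX (head?_moveY hc.head _)
    (fun t h1 h2 => .inr ⟨?_, le_rfl, ?_⟩) (fun t h1 h2 => ?_) <;> dsimp only at * <;> omega

theorem Valid.leftCellsIn_footPath_addBottom (h : (addBottom c k).Valid)
    (hl : LeftCellsIn c.cells c.footPath) :
    LeftCellsIn (addBottom c k).cells (addBottom c k).footPath := by
  have hb := h.1.bottomInvariant h.2.1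
  have hfoot := hb.footX_le
  have := h.2.2
  have hturn : LeftCellsIn (addBottom c k).cells (moveX (c.width - 1 - k) c.footPath) := by
    refine (hl.mono Set.subset_union_left).moveX hb.head (fun t h1 h2 => .inl ?_)
      (fun t h1 h2 => .inr ⟨by rw [hb.tip_snd], h1, ?_⟩)
    · rw [hb.tip_snd]
      exact mem_cells_bottom h.2.1 h1 (by omega)
    · dsimp only at *
      omega
  refine hturn.moveY (hb.head?_moveX _) (fun t h1 h2 => ?_)
    (fun t h1 h2 => .inr ⟨?_, ?_, ?_⟩)
  all_goals dsimp only at *; omega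

theorem Valid.leftCellsIn_path_addBottom (h : (addBottom c k).Valid)
    (hl : LeftCellsIn c.cells c.footPath) :
    LeftCellsIn (addBottom c k).cells (addBottom c k).path := by
  refine (h.leftCellsIn_footPath_addBottom hl).moveX
    (h.bottomInvariant trivial).head?_footPath (fun t h1 h2 => ?_) (fun t h1 h2 => ?_)
  · exact .inr ⟨bottomY_addBottom, h1, h2⟩
  · simp only [footX] at h2
    omega

theorem Valid.leftCellsIn_paths : ∀ {c : Construction}, c.Valid →
    LeftCellsIn c.cells c.path ∧ (c.IsZ → LeftCellsIn c.cells c.footPath)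
  | square, _ => ⟨fun _ he => absurd he List.not_mem_nil, fun h => h.elim⟩
  | addTop _ _, h => ⟨h.leftCellsIn_path_addTop h.1.leftCellsIn_paths.1, fun h => h.elim⟩
  | addRight _ _, h => ⟨h.leftCellsIn_path_addRight h.1.leftCellsIn_paths.1,
      fun _ => h.leftCellsIn_footPath_addRight h.1.leftCellsIn_paths.1⟩
  | addBottom _ _, h => ⟨h.leftCellsIn_path_addBottom (h.1.leftCellsIn_paths.2 h.2.1),
      fun _ => h.leftCellsIn_footPath_addBottom (h.1.leftCellsIn_paths.2 h.2.1)⟩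

theorem Valid.leftCellsIn_loop (h : c.Valid) : LeftCellsIn c.cells c.loop := by
  have hc := h.pathInvariant
  have htip := hc.tip_box
  have htop := hc.one_le_topY
  refine ((h.leftCellsIn_up h.leftCellsIn_paths.1).moveX hc.head?_up (fun t h1 h2 => ?_)
    (fun t h1 h2 => h.mem_cells_top h1 h2)).moveY hc.head?_left (fun t h1 h2 => ?_)
    (fun t h1 h2 => h.mem_cells_left h1 h2)
  all_goals dsimp only at *; omega

end Construction

theorem ncard_span_eq_iff {α : Type*} {f : α → ℤ} {S : Set α} {a b : ℤ}
    (h : ∀ q ∈ S, a ≤ f q ∧ f q ≤ b) (hab : a ≤ b) :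
    {x : ℤ | ∃ c ∈ S, ∃ d ∈ S, f c ≤ x ∧ x ≤ f d}.ncard = (b + 1 - a).toNat ↔
      (∃ q ∈ S, f q = a) ∧ ∃ q ∈ S, f q = b := by
  set T := {x : ℤ | ∃ c ∈ S, ∃ d ∈ S, f c ≤ x ∧ x ≤ f d}
  have hsub : T ⊆ Finset.Icc a b := by
    rintro x ⟨c, hc, d, hd, h1, h2⟩
    simpa using And.intro ((h c hc).1.trans h1) (h2.trans (h d hd).2)
  have hcard : (b + 1 - a).toNat = (Finset.Icc a b : Set ℤ).ncard := by
    rw [Set.ncard_coe_finset, Int.card_Icc]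
  rw [hcard]
  constructor
  · intro hw
    have heq := Set.eq_of_subset_of_ncard_le hsub hw.ge
    have ha : a ∈ T := by simpa [heq] using hab
    have hb : b ∈ T := by simpa [heq] using hab
    obtain ⟨c, hc, -, -, h1, -⟩ := ha
    obtain ⟨-, -, d, hd, -, h2⟩ := hb
    exact ⟨⟨c, hc, le_antisymm h1 (h c hc).1⟩, d, hd, le_antisymm (h d hd).2 h2⟩
  · rintro ⟨⟨p, hp, rfl⟩, r, hr, rfl⟩
    congr 1
    refine hsub.antisymm fun x hx => ?_
    rw [Finset.coe_Icc] at hx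
    exact ⟨p, hp, r, hr, hx⟩

theorem width_eq_iff {S : Set (ℤ × ℤ)} {a b : ℤ} (h : ∀ q ∈ S, a ≤ q.1 ∧ q.1 ≤ b) (hab : a ≤ b) :
    width S = (b + 1 - a).toNat ↔ (∃ q ∈ S, q.1 = a) ∧ ∃ q ∈ S, q.1 = b :=
  ncard_span_eq_iff h hab

theorem height_eq_iff {S : Set (ℤ × ℤ)} {a b : ℤ} (h : ∀ q ∈ S, a ≤ q.2 ∧ q.2 ≤ b) (hab : a ≤ b) :
    height S = (b + 1 - a).toNat ↔ (∃ q ∈ S, q.2 = a) ∧ ∃ q ∈ S, q.2 = b :=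
  ncard_span_eq_iff h hab

theorem IsOnePiece.insert {S : Set (ℤ × ℤ)} (hS : IsOnePiece S) {s t : ℤ × ℤ} (hs : s ∈ S)
    (hst : |t.1 - s.1| + |t.2 - s.2| = 1) : IsOnePiece (Insert.insert t S) := by
  have mono : ∀ c ∈ S, ∀ d ∈ S, Relation.ReflTransGen
      (fun c d => d ∈ Insert.insert t S ∧ |d.1 - c.1| + |d.2 - c.2| = 1) c d := fun c hc d hd =>
    Relation.ReflTransGen.mono (r := fun c d => d ∈ S ∧ |d.1 - c.1| + |d.2 - c.2| = 1)
      (fun _ _ h => ⟨.inr h.1, h.2⟩) _ _ (hS c hc d hd)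
  have hts : |s.1 - t.1| + |s.2 - t.2| = 1 := by rwa [abs_sub_comm, abs_sub_comm s.2]
  rintro c (rfl | hc) d (rfl | hd)
  · exact .refl
  · exact .head ⟨.inr hs, hts⟩ (mono s hs d hd)
  · exact .tail (mono c hc s hs) ⟨.inl rfl, hst⟩
  · exact mono c hc d hd

theorem not_isOnePiece {S A : Set (ℤ × ℤ)} {c d : ℤ × ℤ} (hc : c ∈ S) (hcA : c ∈ A) (hd : d ∈ S)
    (hdA : d ∉ A) (h : ∀ p ∈ A, ∀ q ∈ S, |q.1 - p.1| + |q.2 - p.2| = 1 → q ∈ A) :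
    ¬ IsOnePiece S := by
  intro hS
  have hclosed : ∀ e, Relation.ReflTransGen
      (fun c d => d ∈ S ∧ |d.1 - c.1| + |d.2 - c.2| = 1) c e → e ∈ A := by
    intro e he
    induction he with
    | refl => exact hcA
    | tail _ hstep ih => exact h _ ih _ hstep.1 hstep.2
  exact hdA (hclosed d (hS c hc d hd))

/-! ### Area, width and height -/

theorem IsOnePiece.union_image_Iio {S : Set (ℤ × ℤ)} (hS : IsOnePiece S) {f : ℕ → ℤ × ℤ}
    {s : ℤ × ℤ} (hs : s ∈ S) (hzero : |(f 0).1 - s.1| + |(f 0).2 - s.2| = 1)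
    (hsucc : ∀ n, |(f (n + 1)).1 - (f n).1| + |(f (n + 1)).2 - (f n).2| = 1) (k : ℕ) :
    IsOnePiece (S ∪ f '' Set.Iio k) := by
  induction k with
  | zero => simpa using hS
  | succ k ih =>
    have hinsert : S ∪ f '' Set.Iio (k + 1) = Insert.insert (f k) (S ∪ f '' Set.Iio k) := by
      rw [← Order.succ_eq_add_one, Order.Iio_succ_eq_insert, Set.image_insert_eq,
        Set.union_insert]
    rw [hinsert]
    cases k with
    | zero => exact ih.insert (.inl hs) hzero
    | succ k => exact ih.insert (.inr ⟨k, Nat.lt_succ_self k, rfl⟩) (hsucc k)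

theorem abs_add_abs_eq_one {p q : ℤ × ℤ} (h : |q.1 - p.1| + |q.2 - p.2| = 1) :
    q.1 ≤ p.1 + 1 ∧ p.1 ≤ q.1 + 1 ∧ q.2 ≤ p.2 + 1 ∧ p.2 ≤ q.2 + 1 := by
  grind

/-- What is left of a set of cells when its bottom row is removed. -/
def removeBottomRow (S : Set (ℤ × ℤ)) : Set (ℤ × ℤ) := {c ∈ S | ∃ d ∈ S, d.2 < c.2}

namespace Construction

variable {c d : Construction} {k m : ℕ} {q : ℤ × ℤ}

theorem cells_addTop : (addTop c k).cells =
    c.cells ∪ (fun n : ℕ => ((n : ℤ) - 1, c.topY)) '' Set.Iio k := by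
  refine congrArg (c.cells ∪ ·) (Set.ext fun ⟨x, y⟩ => ⟨fun ⟨hy, h1, h2⟩ => ?_, ?_⟩)
  · exact ⟨(x + 1).toNat, by simp only [Set.mem_Iio] at *; omega,
      by ext <;> dsimp only at * <;> omega⟩
  · rintro ⟨n, hn, h⟩
    simp only [Prod.ext_iff, Set.mem_Iio, Set.mem_ofPred_eq] at *
    omega

theorem cells_addRight : (addRight c k).cells =
    c.cells ∪ (fun n : ℕ => ((c.width : ℤ) - 1, c.topY - 1 - n)) '' Set.Iio k := by
  refine congrArg (c.cells ∪ ·) (Set.ext fun ⟨x, y⟩ => ⟨fun ⟨hy, h1, h2⟩ => ?_, ?_⟩)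
  · exact ⟨(c.topY - 1 - y).toNat, by simp only [Set.mem_Iio] at *; omega,
      by ext <;> dsimp only at * <;> omega⟩
  · rintro ⟨n, hn, h⟩
    simp only [Prod.ext_iff, Set.mem_Iio, Set.mem_ofPred_eq] at *
    omega

theorem cells_addBottom : (addBottom c k).cells =
    c.cells ∪ (fun n : ℕ => ((c.width : ℤ) - 2 - n, c.bottomY - 1)) '' Set.Iio k := by
  refine congrArg (c.cells ∪ ·) (Set.ext fun ⟨x, y⟩ => ⟨fun ⟨hy, h1, h2⟩ => ?_, ?_⟩)
  · exact ⟨(c.width - 2 - x).toNat, by simp only [Set.mem_Iio] at *; omega,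
      by ext <;> dsimp only at * <;> omega⟩
  · rintro ⟨n, hn, h⟩
    simp only [Prod.ext_iff, Set.mem_Iio, Set.mem_ofPred_eq] at *
    omega

theorem Valid.isOnePiece : ∀ {c : Construction}, c.Valid → IsOnePiece c.cells
  | square, _ => by
    rintro c rfl d rfl
    exact .refl
  | addTop c k, h => by
    rw [cells_addTop]
    exact h.1.isOnePiece.union_image_Iio h.1.mem_cells_top_left (by simp) (by simp) k
  | addRight c k, h => by
    have hwidth := h.1.one_le_width
    rw [cells_addRight]
    exact h.1.isOnePiece.union_image_Iio
      (h.1.mem_cells_top_of_not_isX h.2.1 (by omega) le_rfl) (by simp) (by simp) k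
  | addBottom c k, h => by
    rw [cells_addBottom]
    exact h.1.isOnePiece.union_image_Iio
      (mem_cells_bottom h.2.1 (h.1.bottomInvariant h.2.1).footX_le le_rfl) (by simp) (by simp) k

theorem finite_cells : ∀ c : Construction, c.cells.Finite
  | square => Set.finite_singleton _
  | addTop c k => by
    rw [cells_addTop]
    exact c.finite_cells.union ((Set.finite_Iio k).image _)
  | addRight c k => by
    rw [cells_addRight]
    exact c.finite_cells.union ((Set.finite_Iio k).image _)
  | addBottom c k => by
    rw [cells_addBottom]
    exact c.finite_cells.union ((Set.finite_Iio k).image _)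

theorem ncard_cells_union_image_Iio {f : ℕ → ℤ × ℤ} (hf : f.Injective) (hc : ∀ n, f n ∉ c.cells)
    (k : ℕ) : (c.cells ∪ f '' Set.Iio k).ncard = c.cells.ncard + k := by
  rw [Set.ncard_union_eq _ c.finite_cells ((Set.finite_Iio k).image f),
    Set.ncard_image_of_injective _ hf, Set.ncard_Iio_nat]
  exact Set.disjoint_right.2 fun _ ⟨n, _, hn⟩ => hn ▸ hc n

theorem Valid.ncard_cells : ∀ {c : Construction}, c.Valid → c.cells.ncard = c.area
  | square, _ => Set.ncard_singleton _
  | addTop c k, h => by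
    rw [cells_addTop, ncard_cells_union_image_Iio, h.1.ncard_cells, Construction.area]
    · exact fun _ _ hf => by simpa using hf
    · intro n hn
      have := h.1.cells_box hn
      omega
  | addRight c k, h => by
    rw [cells_addRight, ncard_cells_union_image_Iio, h.1.ncard_cells, Construction.area]
    · exact fun _ _ hf => by simpa using hf
    · intro n hn
      have := h.1.cells_box hn
      omega
  | addBottom c k, h => by
    rw [cells_addBottom, ncard_cells_union_image_Iio, h.1.ncard_cells, Construction.area]
    · exact fun _ _ hf => by simpa using hf
    · intro n hn
      have := h.1.cells_box hn
      omega

theorem Valid.exists_mem_cells_right : ∀ {c : Construction}, c.Valid →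
    ∃ q ∈ c.cells, q.1 = c.width - 2
  | square, h => ⟨_, h.mem_cells_top_left, rfl⟩
  | addTop c k, h => by
    have hk := h.2
    rw [cast_width_addTop]
    rcases le_or_gt k c.width with hle | hlt
    · obtain ⟨q, hq, hright⟩ := h.1.exists_mem_cells_right
      exact ⟨q, .inl hq, by omega⟩
    · exact ⟨((k : ℤ) - 2, c.topY), .inr ⟨rfl, by dsimp only; omega, by dsimp only; omega⟩,
        by dsimp only; omega⟩
  | addRight c k, h => by
    have hk := h.2.2
    exact ⟨((c.width : ℤ) - 1, c.topY - 1), .inr ⟨rfl, by dsimp only; omega, by dsimp only; omega⟩,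
      by rw [cast_width_addRight]; dsimp only; omega⟩
  | addBottom c k, h => by
    obtain ⟨q, hq, hright⟩ := h.1.exists_mem_cells_right
    exact ⟨q, .inl hq, hright⟩

theorem Valid.exists_mem_cells_bottom : ∀ {c : Construction}, c.Valid →
    ∃ q ∈ c.cells, q.2 = c.bottomY
  | square, _ => ⟨(-1, 0), rfl, rfl⟩
  | addTop c k, h => by
    obtain ⟨q, hq, hbottom⟩ := h.1.exists_mem_cells_bottom
    exact ⟨q, .inl hq, hbottom.trans bottomY_addTop.symm⟩
  | addRight c k, h => by
    have hk := h.2.2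
    rw [bottomY_addRight]
    rcases le_or_gt k c.height with hle | hlt
    · obtain ⟨q, hq, hbottom⟩ := h.1.exists_mem_cells_bottom
      exact ⟨q, .inl hq, by rw [hbottom, bottomY]; omega⟩
    · exact ⟨((c.width : ℤ) - 1, c.topY - k), .inr ⟨rfl, le_rfl, by dsimp only; omega⟩,
        by dsimp only; omega⟩
  | addBottom c k, h => by
    have hk := h.2.2
    exact ⟨((c.width : ℤ) - 2, c.bottomY - 1),
      .inr ⟨rfl, by dsimp only; omega, by dsimp only; omega⟩, bottomY_addBottom.symm⟩

theorem Valid.width_cells (h : c.Valid) : PrudentPolygon.width c.cells = c.width := by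
  have hpos := h.one_le_width
  rw [(width_eq_iff (a := -1) (b := c.width - 2)
    (fun q hq => ⟨(h.cells_box hq).1, (h.cells_box hq).2.1⟩) (by omega)).2
    ⟨⟨_, h.mem_cells_top_left, rfl⟩, h.exists_mem_cells_right⟩]
  omega

theorem Valid.height_cells (h : c.Valid) : PrudentPolygon.height c.cells = c.height := by
  have hpos := h.one_le_height
  rw [(height_eq_iff (a := c.bottomY) (b := c.topY - 1) (fun q hq => (h.cells_box hq).2.2)
    (by rw [bottomY]; omega)).2 ⟨h.exists_mem_cells_bottom, _, h.mem_cells_top_left, rfl⟩, bottomY]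
  omega

theorem Valid.mem_removeTopRow (h : c.Valid) :
    q ∈ removeTopRow c.cells ↔ q ∈ c.cells ∧ q.2 < c.topY - 1 := by
  constructor
  · rintro ⟨hq, d, hd, hqd⟩
    have := h.cells_box hd
    exact ⟨hq, by omega⟩
  · exact fun hq => ⟨hq.1, _, h.mem_cells_top_left, hq.2⟩

theorem Valid.mem_removeRightColumn (h : c.Valid) :
    q ∈ removeRightColumn c.cells ↔ q ∈ c.cells ∧ q.1 < c.width - 2 := by
  constructor
  · rintro ⟨hq, d, hd, hqd⟩
    have := h.cells_box hd
    exact ⟨hq, by omega⟩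
  · obtain ⟨d, hd, hright⟩ := h.exists_mem_cells_right
    exact fun hq => ⟨hq.1, d, hd, by omega⟩

theorem Valid.mem_removeBottomRow (h : c.Valid) :
    q ∈ removeBottomRow c.cells ↔ q ∈ c.cells ∧ c.bottomY < q.2 := by
  constructor
  · rintro ⟨hq, d, hd, hqd⟩
    have := h.cells_box hd
    exact ⟨hq, by omega⟩
  · obtain ⟨d, hd, hbottom⟩ := h.exists_mem_cells_bottom
    exact fun hq => ⟨hq.1, d, hd, by omega⟩

theorem removeTopRow_addTop (h : (addTop c k).Valid) :
    removeTopRow (addTop c k).cells = c.cells := by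
  ext q
  have := h.1.cells_box (q := q)
  rw [h.mem_removeTopRow, mem_cells_addTop, topY]
  by_cases hq : q ∈ c.cells <;>
    simp only [hq, true_or, false_or, forall_const, true_and, iff_true, iff_false] at this ⊢ <;>
    omega

theorem removeRightColumn_addRight (h : (addRight c k).Valid) :
    removeRightColumn (addRight c k).cells = c.cells := by
  ext q
  have := h.1.cells_box (q := q)
  rw [h.mem_removeRightColumn, mem_cells_addRight, cast_width_addRight]
  by_cases hq : q ∈ c.cells <;>
    simp only [hq, true_or, false_or, forall_const, true_and, iff_true, iff_false] at this ⊢ <;>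
    omega

theorem removeBottomRow_addBottom (h : (addBottom c k).Valid) :
    removeBottomRow (addBottom c k).cells = c.cells := by
  ext q
  have := h.1.cells_box (q := q)
  rw [h.mem_removeBottomRow, mem_cells_addBottom, bottomY_addBottom]
  by_cases hq : q ∈ c.cells <;>
    simp only [hq, true_or, false_or, forall_const, true_and, iff_true, iff_false] at this ⊢ <;>
    omega

theorem removeRightColumn_addTop (h : (addTop c k).Valid) (hX : ¬ (addTop c k).IsX) :
    (addTop c c.width).Valid ∧
      removeRightColumn (addTop c k).cells = (addTop c c.width).cells := by
  obtain rfl : k = c.width + 1 := le_antisymm h.2.2 (by rw [IsX] at hX; omega)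
  refine ⟨⟨h.1, h.1.one_le_width, Nat.le_succ _⟩, ?_⟩
  ext q
  have := h.1.cells_box (q := q)
  rw [h.mem_removeRightColumn, mem_cells_addTop, mem_cells_addTop, cast_width_addTop]
  by_cases hq : q ∈ c.cells <;>
    simp only [hq, true_or, false_or, forall_const, true_and, iff_true] at this ⊢ <;> omega

theorem removeBottomRow_addRight (h : (addRight c k).Valid) (hZ : (addRight c k).IsZ) :
    (addRight c c.height).Valid ∧
      removeBottomRow (addRight c k).cells = (addRight c c.height).cells := by
  obtain rfl : k = c.height + 1 := le_antisymm h.2.2.2 hZ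
  refine ⟨⟨h.1, h.2.1, h.1.one_le_height, Nat.le_succ _⟩, ?_⟩
  ext q
  have := h.1.cells_box (q := q)
  have hbottom : c.bottomY = c.topY - c.height := rfl
  rw [h.mem_removeBottomRow, mem_cells_addRight, mem_cells_addRight, bottomY_addRight]
  by_cases hq : q ∈ c.cells <;>
    simp only [hq, true_or, false_or, forall_const, true_and, iff_true] at this ⊢ <;> omega

end Construction

/-! ### Connectedness after removing a row or column -/

namespace Construction

variable {c d : Construction} {k m : ℕ} {p q : ℤ × ℤ}

/-- The cells that the removal of the top row separates from the right column, when the last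
addition was not a top row within the width of the polygon. -/
def leftPart : Construction → Set (ℤ × ℤ)
  | square => ∅
  | addTop c _ => c.cells
  | addRight c _ => c.leftPart
  | addBottom c _ => c.leftPart

/-- The cells that the removal of the right column separates from the bottom row, when the last
addition was a bottom row, or a right column that is longer than the polygon. -/
def upperPart : Construction → Set (ℤ × ℤ)
  | addRight c _ => c.cells
  | addBottom c _ => c.upperPart
  | _ => ∅

theorem leftPart_subset : ∀ c : Construction, c.leftPart ⊆ c.cells
  | square => Set.empty_subset _
  | addTop _ _ => Set.subset_union_left
  | addRight c _ => c.leftPart_subset.trans Set.subset_union_left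
  | addBottom c _ => c.leftPart_subset.trans Set.subset_union_left

theorem upperPart_subset : ∀ c : Construction, c.upperPart ⊆ c.cells
  | square => Set.empty_subset _
  | addTop _ _ => Set.empty_subset _
  | addRight _ _ => Set.subset_union_left
  | addBottom c _ => c.upperPart_subset.trans Set.subset_union_left

theorem Valid.fst_lt_of_mem_leftPart : ∀ {c : Construction}, c.Valid → ¬ c.IsX → ∀ {q : ℤ × ℤ},
    q ∈ c.leftPart → q.1 < c.width - 2
  | addTop c k, h, hX, q, hq => by
    have := h.1.cells_box hq
    rw [IsX] at hX
    rw [cast_width_addTop]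
    omega
  | addRight c k, h, _, q, hq => by
    have := h.1.fst_lt_of_mem_leftPart h.2.1 hq
    rw [cast_width_addRight]
    omega
  | addBottom c k, h, _, q, hq => h.1.fst_lt_of_mem_leftPart (not_isX_of_isZ h.2.1) hq

theorem Valid.bottomY_lt_of_mem_leftPart : ∀ {c : Construction}, c.Valid → c.IsZ → ∀ {q : ℤ × ℤ},
    q ∈ c.leftPart → c.bottomY < q.2
  | addRight c k, h, hZ, q, hq => by
    have := (h.1.cells_box (c.leftPart_subset hq)).2.2.1
    have hbottom : c.bottomY = c.topY - c.height := rfl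
    rw [IsZ] at hZ
    rw [bottomY_addRight]
    omega
  | addBottom c k, h, _, q, hq => by
    have := (h.1.cells_box (c.leftPart_subset hq)).2.2.1
    rw [bottomY_addBottom]
    omega

theorem Valid.bottomY_lt_of_mem_upperPart : ∀ {c : Construction}, c.Valid → c.IsZ → ∀ {q : ℤ × ℤ},
    q ∈ c.upperPart → c.bottomY < q.2
  | addRight c k, h, hZ, q, hq => by
    have := (h.1.cells_box hq).2.2.1
    have hbottom : c.bottomY = c.topY - c.height := rfl
    rw [IsZ] at hZ
    rw [bottomY_addRight]
    omega
  | addBottom c k, h, _, q, hq => by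
    have := (h.1.cells_box (c.upperPart_subset hq)).2.2.1
    rw [bottomY_addBottom]
    omega

theorem Valid.mem_leftPart_of_left : ∀ {c : Construction}, c.Valid → ∀ {q : ℤ × ℤ},
    q ∈ c.cells → q.2 < c.topY - 1 → q.1 = -1 → q ∈ c.leftPart
  | square, _, q, hq, htop, _ => by
    rw [mem_cells_square] at hq
    rw [topY] at htop
    omega
  | addTop c k, _, q, hq, htop, _ => by
    refine hq.resolve_right fun hnew => ?_
    have := hnew.1
    rw [topY] at htop
    omega
  | addRight c k, h, q, hq, htop, hleft => by
    refine h.1.mem_leftPart_of_left (hq.resolve_right fun hnew => ?_) htop hleft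
    have := h.1.one_le_width
    have := hnew.1
    omega
  | addBottom c k, h, q, hq, htop, hleft => by
    refine h.1.mem_leftPart_of_left (hq.resolve_right fun hnew => ?_) htop hleft
    have := h.2.2
    have := hnew.2.1
    omega

theorem Valid.mem_leftPart_of_adjacent : ∀ {c : Construction}, c.Valid → ¬ c.IsX → ∀ {p q : ℤ × ℤ},
    p ∈ c.leftPart → q ∈ c.cells → q.2 < c.topY - 1 → |q.1 - p.1| + |q.2 - p.2| = 1 →
    q ∈ c.leftPart
  | addTop c k, _, _, p, q, _, hq, htop, _ => by
    refine hq.resolve_right fun hnew => ?_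
    have := hnew.1
    rw [topY] at htop
    omega
  | addRight c k, h, _, p, q, hp, hq, htop, hpq => by
    refine h.1.mem_leftPart_of_adjacent h.2.1 hp (hq.resolve_right fun hnew => ?_) htop hpq
    have := h.1.fst_lt_of_mem_leftPart h.2.1 hp
    have := abs_add_abs_eq_one hpq
    have := hnew.1
    omega
  | addBottom c k, h, _, p, q, hp, hq, htop, hpq => by
    refine h.1.mem_leftPart_of_adjacent (not_isX_of_isZ h.2.1) hp
      (hq.resolve_right fun hnew => ?_) htop hpq
    have := h.1.bottomY_lt_of_mem_leftPart h.2.1 hp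
    have := abs_add_abs_eq_one hpq
    have := hnew.1
    omega

theorem Valid.mem_upperPart_of_top : ∀ {c : Construction}, c.Valid → c.IsZ → ∀ {q : ℤ × ℤ},
    q ∈ c.cells → q.1 < c.width - 2 → q.2 = c.topY - 1 → q ∈ c.upperPart
  | addRight c k, _, _, q, hq, hright, _ => by
    refine hq.resolve_right fun hnew => ?_
    have := hnew.1
    rw [cast_width_addRight] at hright
    omega
  | addBottom c k, h, _, q, hq, hright, htop => by
    refine h.1.mem_upperPart_of_top h.2.1 (hq.resolve_right fun hnew => ?_) hright htop
    have := h.1.one_le_height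
    have hbottom : c.bottomY = c.topY - c.height := rfl
    have := hnew.1
    rw [topY] at htop
    omega

theorem Valid.mem_upperPart_of_adjacent : ∀ {c : Construction}, c.Valid → c.IsZ → ∀ {p q : ℤ × ℤ},
    p ∈ c.upperPart → q ∈ c.cells → q.1 < c.width - 2 → |q.1 - p.1| + |q.2 - p.2| = 1 →
    q ∈ c.upperPart
  | addRight c k, _, _, p, q, _, hq, hright, _ => by
    refine hq.resolve_right fun hnew => ?_
    have := hnew.1
    rw [cast_width_addRight] at hright
    omega
  | addBottom c k, h, _, p, q, hp, hq, hright, hpq => by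
    refine h.1.mem_upperPart_of_adjacent h.2.1 hp (hq.resolve_right fun hnew => ?_) hright hpq
    have := h.1.bottomY_lt_of_mem_upperPart h.2.1 hp
    have := abs_add_abs_eq_one hpq
    have := hnew.1
    omega

theorem Valid.not_isOnePiece_removeTopRow (h : c.Valid) (hX : ¬ c.IsX)
    (hwidth : PrudentPolygon.width (removeTopRow c.cells) = PrudentPolygon.width c.cells) :
    ¬ IsOnePiece (removeTopRow c.cells) := by
  have hpos := h.one_le_width
  rw [h.width_cells, show c.width = ((c.width : ℤ) - 2 + 1 - -1).toNat by omega,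
    width_eq_iff (fun q hq => by have := h.cells_box hq.1; omega) (by omega)] at hwidth
  obtain ⟨⟨p, hp, hleft⟩, q, hq, hright⟩ := hwidth
  refine not_isOnePiece (A := c.leftPart) hp ?_ hq ?_ fun r hr s hs hrs => ?_
  · rw [h.mem_removeTopRow] at hp
    exact h.mem_leftPart_of_left hp.1 hp.2 hleft
  · exact fun hmem => (h.fst_lt_of_mem_leftPart hX hmem).ne hright
  · rw [h.mem_removeTopRow] at hs
    exact h.mem_leftPart_of_adjacent hX hr hs.1 hs.2 hrs

theorem Valid.not_isOnePiece_removeRightColumn (h : c.Valid) (hZ : c.IsZ)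
    (hheight : PrudentPolygon.height (removeRightColumn c.cells) =
      PrudentPolygon.height c.cells) :
    ¬ IsOnePiece (removeRightColumn c.cells) := by
  have hpos := h.one_le_height
  have hbottom : c.bottomY = c.topY - c.height := rfl
  rw [h.height_cells, show c.height = (c.topY - 1 + 1 - c.bottomY).toNat by omega,
    height_eq_iff (fun q hq => (h.cells_box hq.1).2.2) (by omega)] at hheight
  obtain ⟨⟨p, hp, hlow⟩, q, hq, htop⟩ := hheight
  refine not_isOnePiece (A := c.upperPart) hq ?_ hp ?_ fun r hr s hs hrs => ?_
  · rw [h.mem_removeRightColumn] at hq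
    exact h.mem_upperPart_of_top hZ hq.1 hq.2 htop
  · exact fun hmem => (h.bottomY_lt_of_mem_upperPart hZ hmem).ne' hlow
  · rw [h.mem_removeRightColumn] at hs
    exact h.mem_upperPart_of_adjacent hZ hr hs.1 hs.2 hrs

theorem Valid.isX_iff (h : c.Valid) : c.IsX ↔
    PrudentPolygon.width (removeTopRow c.cells) = PrudentPolygon.width c.cells ∧
      IsOnePiece (removeTopRow c.cells) := by
  refine ⟨fun hX => ?_, fun hrem => not_not.1 fun hX =>
    h.not_isOnePiece_removeTopRow hX hrem.1 hrem.2⟩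
  cases c with
  | addTop c k =>
    rw [removeTopRow_addTop h, h.width_cells, h.1.width_cells]
    exact ⟨(max_eq_left hX).symm, h.1.isOnePiece⟩
  | _ => exact hX.elim

theorem Valid.area_eq_one_iff (h : c.Valid) : c.area = 1 ↔ c = square := by
  refine ⟨fun harea => ?_, fun hc => hc ▸ rfl⟩
  cases c with
  | square => rfl
  | addTop c k =>
    have := h.1.one_le_area
    have := h.2.1
    rw [Construction.area] at harea
    omega
  | addRight c k | addBottom c k =>
    have := h.1.one_le_area
    have := h.2.2.1
    rw [Construction.area] at harea
    omega

theorem Valid.not_isZ_iff (h : c.Valid) (hX : ¬ c.IsX) : ¬ c.IsZ ↔ c.area = 1 ∨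
    PrudentPolygon.height (removeRightColumn c.cells) = PrudentPolygon.height c.cells ∧
      IsOnePiece (removeRightColumn c.cells) := by
  constructor
  · intro hZ
    cases c with
    | square => exact .inl rfl
    | addTop c k =>
      obtain ⟨hvalid, hrem⟩ := removeRightColumn_addTop h hX
      rw [hrem, h.height_cells, hvalid.height_cells]
      exact .inr ⟨rfl, hvalid.isOnePiece⟩
    | addRight c k =>
      rw [removeRightColumn_addRight h, h.height_cells, h.1.height_cells]
      exact .inr ⟨(max_eq_left (not_lt.1 hZ)).symm, h.1.isOnePiece⟩
    | addBottom c k => exact absurd trivial hZ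
  · rintro (harea | ⟨hheight, hpiece⟩) hZ
    · rw [h.area_eq_one_iff.1 harea] at hZ
      exact hZ
    · exact h.not_isOnePiece_removeRightColumn hZ hheight hpiece

theorem Valid.area_congr (hc : c.Valid) (hd : d.Valid) (h : c.cells = d.cells) :
    c.area = d.area := by
  rw [← hc.ncard_cells, ← hd.ncard_cells, h]

theorem Valid.isX_congr (hc : c.Valid) (hd : d.Valid) (h : c.cells = d.cells) :
    c.IsX ↔ d.IsX := by
  rw [hc.isX_iff, hd.isX_iff, h]

theorem Valid.isZ_congr (hc : c.Valid) (hd : d.Valid) (h : c.cells = d.cells) :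
    c.IsZ ↔ d.IsZ := by
  have hX := hc.isX_congr hd h
  by_cases hcX : c.IsX
  · exact iff_of_false (fun hZ => not_isX_of_isZ hZ hcX) fun hZ => not_isX_of_isZ hZ (hX.1 hcX)
  · rw [← not_iff_not, hc.not_isZ_iff hcX, hd.not_isZ_iff (hX.not.1 hcX), h, hc.area_congr hd h]

theorem cells_addTop_ne_cells_addRight (hc : (addTop c k).Valid) (hd : (addRight d m).Valid) :
    (addTop c k).cells ≠ (addRight d m).cells := by
  intro h
  obtain ⟨hvalid, hrem⟩ := removeRightColumn_addTop hc (hc.isX_congr hd h).1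
  rw [h, removeRightColumn_addRight hd] at hrem
  exact hd.2.1 ((hd.1.isX_congr hvalid hrem).2 le_rfl)

theorem cells_addTop_ne_cells_addBottom (hc : (addTop c k).Valid) (hd : (addBottom d m).Valid) :
    (addTop c k).cells ≠ (addBottom d m).cells :=
  fun h => (hc.isZ_congr hd h).2 trivial

theorem cells_addRight_ne_cells_addBottom (hc : (addRight c k).Valid)
    (hd : (addBottom d m).Valid) : (addRight c k).cells ≠ (addBottom d m).cells := by
  intro h
  obtain ⟨hvalid, hrem⟩ := removeBottomRow_addRight hc ((hc.isZ_congr hd h).2 trivial)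
  rw [h, removeBottomRow_addBottom hd] at hrem
  exact lt_irrefl _ ((hd.1.isZ_congr hvalid hrem).1 hd.2.1)

theorem cells_injOn : ∀ {c d : Construction}, c.Valid → d.Valid → c.cells = d.cells → c = d
  | square, _, hc, hd, h => (hd.area_eq_one_iff.1 (hc.area_congr hd h).symm).symm
  | _, square, hc, hd, h => hc.area_eq_one_iff.1 (hc.area_congr hd h)
  | addTop c k, addTop d m, hc, hd, h => by
    have harea := hc.area_congr hd h
    have hrem := congrArg removeTopRow h
    rw [removeTopRow_addTop hc, removeTopRow_addTop hd] at hrem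
    obtain rfl := cells_injOn hc.1 hd.1 hrem
    rw [Nat.add_left_cancel harea]
  | addRight c k, addRight d m, hc, hd, h => by
    have harea := hc.area_congr hd h
    have hrem := congrArg removeRightColumn h
    rw [removeRightColumn_addRight hc, removeRightColumn_addRight hd] at hrem
    obtain rfl := cells_injOn hc.1 hd.1 hrem
    rw [Nat.add_left_cancel harea]
  | addBottom c k, addBottom d m, hc, hd, h => by
    have harea := hc.area_congr hd h
    have hrem := congrArg removeBottomRow h
    rw [removeBottomRow_addBottom hc, removeBottomRow_addBottom hd] at hrem
    obtain rfl := cells_injOn hc.1 hd.1 hrem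
    rw [Nat.add_left_cancel harea]
  | addTop _ _, addRight _ _, hc, hd, h => absurd h (cells_addTop_ne_cells_addRight hc hd)
  | addTop _ _, addBottom _ _, hc, hd, h => absurd h (cells_addTop_ne_cells_addBottom hc hd)
  | addRight _ _, addTop _ _, hc, hd, h => absurd h.symm (cells_addTop_ne_cells_addRight hd hc)
  | addRight _ _, addBottom _ _, hc, hd, h => absurd h (cells_addRight_ne_cells_addBottom hc hd)
  | addBottom _ _, addTop _ _, hc, hd, h => absurd h.symm (cells_addTop_ne_cells_addBottom hd hc)
  | addBottom _ _, addRight _ _, hc, hd, h =>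
    absurd h.symm (cells_addRight_ne_cells_addBottom hd hc)

end Construction

/-! ### Constructions and prudent polygons -/

theorem abs_add_abs_eq_one_iff {a b : ℤ} : |a| + |b| = 1 ↔
    (a = 1 ∧ b = 0) ∨ (a = -1 ∧ b = 0) ∨ (a = 0 ∧ b = 1) ∨ (a = 0 ∧ b = -1) := by
  grind

theorem freeStep_iff {p r : ℤ × ℤ} {l : List (ℤ × ℤ)} : FreeStep p r l ↔
    |r.1 - p.1| + |r.2 - p.2| = 1 ∧ ∀ q ∈ l, ∀ k : ℕ, 1 ≤ k → q ≠ p + k • (r - p) := by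
  simp only [ne_eq, Prod.ext_iff, Prod.fst_add, Prod.snd_add, Prod.smul_fst, Prod.smul_snd,
    Prod.fst_sub, Prod.snd_sub]
  simp only [nsmul_eq_mul]
  constructor
  · rintro (⟨rfl, hfree⟩ | ⟨rfl, hfree⟩ | ⟨rfl, hfree⟩ | ⟨rfl, hfree⟩) <;>
    refine ⟨by simp, fun q hq k hk he => ?_⟩ <;>
    have := hfree q hq <;>
    dsimp only at he <;>
    omega
  · rintro ⟨hunit, hfree⟩
    have not_on_ray : ∀ q ∈ l, ∀ t : ℤ, 1 ≤ t → q.1 = p.1 + t * (r.1 - p.1) →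
        q.2 = p.2 + t * (r.2 - p.2) → False := by
      intro q hq t ht h1 h2
      lift t to ℕ using by omega
      exact hfree q hq t (by omega) ⟨h1, h2⟩
    rcases abs_add_abs_eq_one_iff.1 hunit with ⟨h1, h2⟩ | ⟨h1, h2⟩ | ⟨h1, h2⟩ | ⟨h1, h2⟩ <;>
      rw [h1, h2] at not_on_ray
    · refine .right (Prod.ext (by omega) (by omega)) fun q hq hq2 => ?_
      by_contra hlt
      exact not_on_ray q hq (q.1 - p.1) (by omega) (by omega) (by omega)
    · refine .left (Prod.ext (by omega) (by omega)) fun q hq hq2 => ?_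
      by_contra hlt
      exact not_on_ray q hq (p.1 - q.1) (by omega) (by omega) (by omega)
    · refine .up (Prod.ext (by omega) (by omega)) fun q hq hq1 => ?_
      by_contra hlt
      exact not_on_ray q hq (q.2 - p.2) (by omega) (by omega) (by omega)
    · refine .down (Prod.ext (by omega) (by omega)) fun q hq hq1 => ?_
      by_contra hlt
      exact not_on_ray q hq (p.2 - q.2) (by omega) (by omega) (by omega)

theorem isSAW_concat {w : List (ℤ × ℤ)} {p : ℤ × ℤ} (hw : w.getLast? = some p) (r : ℤ × ℤ) :
    IsSAW (w ++ [r]) ↔ IsSAW w ∧ |r.1 - p.1| + |r.2 - p.2| = 1 ∧ r ∉ w := by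
  have hne : w ≠ [] := by rintro rfl; cases hw
  rw [IsSAW, IsSAW, List.head?_append_of_ne_nil _ hne, List.isChain_append, hw,
    List.nodup_append_comm, List.singleton_append, List.nodup_cons]
  simp only [List.isChain_singleton, List.head?_cons, Option.mem_def, Option.some.injEq,
    forall_eq', true_and]
  tauto

theorem isPrudent_concat {w : List (ℤ × ℤ)} {p : ℤ × ℤ} (hw : w.getLast? = some p) (r : ℤ × ℤ) :
    IsPrudent (w ++ [r]) ↔ IsPrudent w ∧ ∀ q ∈ w, ∀ k : ℕ, 1 ≤ k → q ≠ p + k • (r - p) := by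
  obtain ⟨s, rfl⟩ : ∃ s, w = s ++ [p] := by
    rw [List.getLast?_eq_some_iff] at hw
    exact hw
  constructor
  · refine fun h => ⟨fun i hi q hq k hk => ?_, fun q hq k hk => ?_⟩
    · have hlt : i + 1 < (s ++ [p] ++ [r]).length := by rw [List.length_append]; omega
      have := h i hlt q (by rwa [List.take_append_of_le_length hi.le]) k hk
      rwa [List.getElem_append_left hi, List.getElem_append_left (by omega)] at this
    · have htake : (s ++ [p] ++ [r]).take (s.length + 1) = s ++ [p] := by
        rw [List.take_append_of_le_length (by simp), List.take_of_length_le (by simp)]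
      have := h s.length (by simp) q (by rwa [htake]) k hk
      simpa using this
  · rintro ⟨hprudent, hfree⟩ i hi q hq k hk
    rw [List.length_append, List.length_singleton] at hi
    rw [List.take_append_of_le_length (by omega)] at hq
    by_cases hlt : i + 1 < (s ++ [p]).length
    · rw [List.getElem_append_left hlt, List.getElem_append_left (by omega)]
      exact hprudent i hlt q hq k hk
    · obtain rfl : i = s.length := by rw [List.length_append, List.length_singleton] at *; omega
      simpa using hfree q (List.mem_of_mem_take hq) k hk

theorem prudentPath_singleton {p : ℤ × ℤ} : PrudentPath [p] ↔ p = (0, 0) :=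
  ⟨fun h => by cases h; rfl, fun h => h ▸ .start⟩

theorem prudentPath_cons_cons {p r : ℤ × ℤ} {l : List (ℤ × ℤ)} :
    PrudentPath (r :: p :: l) ↔ PrudentPath (p :: l) ∧ FreeStep p r (p :: l) :=
  ⟨fun h => by cases h with | step path free => exact ⟨path, free⟩, fun h => h.1.step h.2⟩

theorem prudentPath_iff : ∀ l : List (ℤ × ℤ),
    PrudentPath l ↔ IsSAW l.reverse ∧ IsPrudent l.reverse
  | [] => ⟨nofun, fun h => absurd h.1.1 nofun⟩
  | [p] => by
    have hprudent : IsPrudent [p] := fun i hi => absurd hi (by simp)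
    rw [prudentPath_singleton, List.reverse_singleton, and_iff_left hprudent, IsSAW,
      List.head?_cons, Option.some_inj]
    exact (and_iff_left ⟨List.isChain_singleton _, List.nodup_singleton _⟩).symm
  | r :: p :: l => by
    have hlast : (p :: l).reverse.getLast? = some p := List.getLast?_reverse
    rw [List.reverse_cons, isSAW_concat hlast, isPrudent_concat hlast, prudentPath_cons_cons,
      prudentPath_iff (p :: l)]
    constructor
    · rintro ⟨⟨hsaw, hprudent⟩, hstep⟩
      have hr := hstep.not_mem
      rw [freeStep_iff] at hstep
      simp only [List.mem_reverse]
      exact ⟨⟨hsaw, hstep.1, hr⟩, hprudent, hstep.2⟩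
    · rintro ⟨⟨hsaw, hunit, -⟩, hprudent, hfree⟩
      simp only [List.mem_reverse] at hfree
      exact ⟨⟨hsaw, hprudent⟩, freeStep_iff.2 ⟨hunit, hfree⟩⟩

theorem isPrudentPolygon_iff {w : List (ℤ × ℤ)} : IsPrudentPolygon w ↔
    PrudentPath w.reverse ∧ 2 < w.length ∧ ∃ p, w.getLast? = some p ∧ |p.1| + |p.2| = 1 := by
  rw [prudentPath_iff, List.reverse_reverse, IsPrudentPolygon, and_assoc]

theorem zip_reverse_tail : ∀ {l : List (ℤ × ℤ)} {p : ℤ × ℤ}, l.head? = some p → ∀ a : ℤ × ℤ,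
    l.reverse.zip (l.reverse.tail ++ [a]) = (pathEdges l).reverse ++ [(p, a)]
  | [_], _, rfl, _ => rfl
  | r :: s :: l, _, rfl, a => by
    have hne : (s :: l).reverse ≠ [] := List.reverse_ne_nil_iff.2 (List.cons_ne_nil _ _)
    rw [List.reverse_cons, List.tail_append_of_ne_nil hne, List.zip_append (by simp),
      zip_reverse_tail rfl r, pathEdges, List.reverse_cons]
    rfl

theorem edges_reverse {l : List (ℤ × ℤ)} {p a : ℤ × ℤ} (hp : l.head? = some p)
    (ha : l.getLast? = some a) : edges l.reverse = (pathEdges l).reverse ++ [(p, a)] := by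
  obtain ⟨t, ht⟩ : ∃ t, l.reverse = a :: t :=
    List.head?_eq_some_iff.1 (by rw [List.head?_reverse, ha])
  rw [← zip_reverse_tail hp a, edges, ht, List.rotate_cons_succ, List.rotate_zero, List.tail_cons]

theorem PrudentPath.unit_edges {l : List (ℤ × ℤ)} (h : PrudentPath l) :
    ∀ e ∈ pathEdges l, |e.2.1 - e.1.1| + |e.2.2 - e.1.2| = 1 := by
  induction h with
  | start => exact nofun
  | step _ hf ih => exact List.forall_mem_cons.2 ⟨(freeStep_iff.1 hf).1, ih⟩

theorem IsPrudentPolygon.unit_edges {w : List (ℤ × ℤ)} (h : IsPrudentPolygon w) :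
    ∀ e ∈ edges w, |e.2.1 - e.1.1| + |e.2.2 - e.1.2| = 1 := by
  obtain ⟨hpath, -, p, hp, hunit⟩ := isPrudentPolygon_iff.1 h
  intro e he
  rw [← w.reverse_reverse, edges_reverse (by rw [List.head?_reverse, hp]) hpath.getLast?,
    List.mem_append, List.mem_reverse, List.mem_singleton] at he
  rcases he with he | rfl
  · exact hpath.unit_edges e he
  · simpa only [zero_sub, abs_neg] using hunit

namespace Construction

variable {c d : Construction}

/-- The prudent walk around the polygon. -/
def walk (c : Construction) : List (ℤ × ℤ) := c.loop.reverse

theorem Valid.edges_walk (h : c.Valid) :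
    edges c.walk = (pathEdges c.loop).reverse ++ [((-1, 0), (0, 0))] :=
  edges_reverse h.pathInvariant.head?_loop h.pathInvariant.prudent_loop.getLast?

theorem Valid.cells_walk (h : c.Valid) : PrudentPolygon.cells c.walk = c.cells := by
  ext q
  rw [← h.odd_crossings, PrudentPolygon.cells, Set.mem_ofPred_eq, h.edges_walk,
    List.countP_append, List.countP_reverse, List.countP_singleton, if_neg (by simp), add_zero,
    crossings]

theorem Valid.isCounterclockwise_walk (h : c.Valid) : IsCounterclockwise c.walk := by
  intro e he
  rw [h.cells_walk]
  rw [h.edges_walk, List.mem_append, List.mem_reverse, List.mem_singleton] at he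
  rcases he with he | rfl
  · exact h.leftCellsIn_loop e he
  · exact h.mem_cells_left le_rfl (zero_lt_one.trans_le h.pathInvariant.one_le_topY)

theorem Valid.getLast?_walk (h : c.Valid) : c.walk.getLast? = some (-1, 0) := by
  rw [walk, List.getLast?_reverse, h.pathInvariant.head?_loop]

theorem Valid.two_lt_length_walk (h : c.Valid) : 2 < c.walk.length := by
  have hc := h.pathInvariant
  have htop := hc.one_le_topY
  have hcorner : (-1, c.topY) ∈ c.loop :=
    (mem_moveY hc.head?_left _ _).2 (.inl (List.mem_of_mem_head? hc.head?_left))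
  have hnodup : [(0, 0), (-1, 0), (-1, c.topY)].Nodup := by simp; omega
  have hsub : [(0, 0), (-1, 0), (-1, c.topY)] ⊆ c.loop := by
    simp only [List.cons_subset, List.nil_subset, and_true]
    exact ⟨hc.prudent_loop.origin_mem, List.mem_of_mem_head? hc.head?_loop, hcorner⟩
  rw [walk, List.length_reverse]
  exact (hnodup.subperm hsub).length_le

theorem Valid.isPrudentPolygon_walk (h : c.Valid) : IsPrudentPolygon c.walk := by
  rw [isPrudentPolygon_iff, walk, List.reverse_reverse]
  exact ⟨h.pathInvariant.prudent_loop, h.two_lt_length_walk, _, h.getLast?_walk, rfl⟩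

theorem Valid.walk_mem_classW (h : c.Valid) : c.walk ∈ classW :=
  ⟨h.isPrudentPolygon_walk, h.getLast?_walk, h.isCounterclockwise_walk⟩

theorem walk_injOn : Set.InjOn walk {c | c.Valid} := fun c hc d hd h =>
  cells_injOn hc hd (by rw [← Valid.cells_walk hc, ← Valid.cells_walk hd, h])

end Construction

/-! ### The classes and the orientation of a polygon -/

theorem edges_map (f : ℤ × ℤ → ℤ × ℤ) (w : List (ℤ × ℤ)) :
    edges (w.map f) = (edges w).map (Prod.map f f) := by
  rw [edges, edges, ← List.map_rotate, List.zip_map]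

theorem IsPrudentPolygon.map_reflect {w : List (ℤ × ℤ)} (h : IsPrudentPolygon w) :
    IsPrudentPolygon (w.map reflect) := by
  rw [isPrudentPolygon_iff] at h ⊢
  obtain ⟨hpath, hlen, p, hp, hunit⟩ := h
  rw [← List.map_reverse, List.length_map, List.getLast?_map, hp]
  exact ⟨hpath.map_reflect, hlen, reflect p, rfl, by rwa [reflect, abs_neg]⟩

theorem IsPrudentPolygon.map_swap {w : List (ℤ × ℤ)} (h : IsPrudentPolygon w) :
    IsPrudentPolygon (w.map Prod.swap) := by
  rw [isPrudentPolygon_iff] at h ⊢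
  obtain ⟨hpath, hlen, p, hp, hunit⟩ := h
  rw [← List.map_reverse, List.length_map, List.getLast?_map, hp]
  exact ⟨hpath.map_swap, hlen, p.swap, rfl, by rwa [Prod.fst_swap, Prod.snd_swap, add_comm]⟩

theorem IsPrudentPolygon.mem_cells_map_reflect {w : List (ℤ × ℤ)} (h : IsPrudentPolygon w)
    (q : ℤ × ℤ) : q ∈ cells (w.map reflect) ↔ (q.1, -q.2 - 1) ∈ cells w := by
  rw [cells, cells, Set.mem_ofPred_eq, Set.mem_ofPred_eq, edges_map, List.countP_map]
  rw [List.countP_congr]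
  intro e he
  have hunit := abs_add_abs_eq_one_iff.1 (h.unit_edges e he)
  simp only [Function.comp_apply, Prod.map_fst, Prod.map_snd, reflect, decide_eq_true_eq]
  grind

/-- The indicator of the north-eastern quadrant of the cell `q`, evaluated at the node `p`. -/
def northEast (q p : ℤ × ℤ) : ℕ := if q.1 < p.1 ∧ q.2 < p.2 then 1 else 0

theorem even_crossing_add {p r : ℤ × ℤ} (h : |r.1 - p.1| + |r.2 - p.2| = 1) (q : ℤ × ℤ) :
    Even ((if p.1 = r.1 ∧ q.1 < p.1 ∧ min p.2 r.2 = q.2 then 1 else 0) +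
      (if p.2 = r.2 ∧ q.2 < p.2 ∧ min p.1 r.1 = q.1 then 1 else 0) +
      (northEast q p + northEast q r)) := by
  have hunit := abs_add_abs_eq_one_iff.1 h
  rw [northEast, northEast, Nat.even_iff]
  split_ifs <;> omega

theorem even_countP_add {E : List ((ℤ × ℤ) × (ℤ × ℤ))} (q : ℤ × ℤ)
    (h : ∀ e ∈ E, |e.2.1 - e.1.1| + |e.2.2 - e.1.2| = 1) :
    Even (E.countP (fun e => decide (e.1.1 = e.2.1 ∧ q.1 < e.1.1 ∧ min e.1.2 e.2.2 = q.2)) +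
      E.countP (fun e => decide (e.1.2 = e.2.2 ∧ q.2 < e.1.2 ∧ min e.1.1 e.2.1 = q.1)) +
      (E.map fun e => northEast q e.1 + northEast q e.2).sum) := by
  induction E with
  | nil => exact even_two_mul 0
  | cons e E ih =>
    have hE := ih fun e he => h e (List.mem_cons_of_mem _ he)
    have he := even_crossing_add (h e List.mem_cons_self) q
    simp only [List.countP_cons, List.map_cons, List.sum_cons, decide_eq_true_eq]
    rw [Nat.even_iff] at he hE ⊢
    omega

theorem sum_map_edges (f : ℤ × ℤ → ℕ) (w : List (ℤ × ℤ)) :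
    ((edges w).map fun e => f e.1 + f e.2).sum = 2 * (w.map f).sum := by
  have hfst : (edges w).map Prod.fst = w := List.map_fst_zip (by simp)
  have hsnd : (edges w).map Prod.snd = w.rotate 1 := List.map_snd_zip (by simp)
  calc ((edges w).map fun e => f e.1 + f e.2).sum
      = (((edges w).map Prod.fst).map f).sum + (((edges w).map Prod.snd).map f).sum := by
        rw [List.sum_map_add, List.map_map, List.map_map]
        rfl
    _ = 2 * (w.map f).sum := by
        rw [hfst, hsnd, ((w.rotate_perm 1).map f).sum_eq, two_mul]

-- The rays from a cell to the east and to the north bound its north-eastern quadrant, which a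
-- closed walk enters and leaves equally often, so their numbers of crossings have the same parity.
theorem IsPrudentPolygon.mem_cells_map_swap {w : List (ℤ × ℤ)} (h : IsPrudentPolygon w)
    (q : ℤ × ℤ) : q ∈ cells (w.map Prod.swap) ↔ q.swap ∈ cells w := by
  have heven := even_countP_add q.swap h.unit_edges
  rw [sum_map_edges, Nat.even_add, iff_true_right (even_two_mul _), Nat.even_add] at heven
  rw [cells, cells, Set.mem_ofPred_eq, Set.mem_ofPred_eq, edges_map, List.countP_map,
    ← Nat.not_even_iff_odd, ← Nat.not_even_iff_odd, heven]
  rfl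

theorem ncard_eq_of_mem_iff_of_involutive {α : Type*} {f : α → α} (hf : f.Involutive) {s t : Set α}
    (h : ∀ a, a ∈ s ↔ f a ∈ t) : s.ncard = t.ncard := by
  rw [show s = f ⁻¹' t from Set.ext h, ← hf.image_eq_preimage_symm,
    Set.ncard_image_of_injective _ hf.injective]

theorem IsPrudentPolygon.area_map_reflect {w : List (ℤ × ℤ)} (h : IsPrudentPolygon w) :
    area (cells (w.map reflect)) = area (cells w) :=
  ncard_eq_of_mem_iff_of_involutive (f := fun q => (q.1, -q.2 - 1))
    (fun _ => Prod.ext rfl (by ring)) h.mem_cells_map_reflect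

theorem IsPrudentPolygon.area_map_swap {w : List (ℤ × ℤ)} (h : IsPrudentPolygon w) :
    area (cells (w.map Prod.swap)) = area (cells w) :=
  ncard_eq_of_mem_iff_of_involutive Prod.swap_swap h.mem_cells_map_swap

theorem IsPrudentPolygon.exists_walk {w : List (ℤ × ℤ)} (h : IsPrudentPolygon w)
    (hw : w.getLast? = some (-1, 0)) :
    ∃ c : Construction, c.Valid ∧ (w = c.walk ∨ w = c.walk.map reflect) := by
  obtain ⟨hpath, hlen, -⟩ := isPrudentPolygon_iff.1 h
  obtain ⟨c, hc, hloop⟩ :=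
    hpath.exists_loop (by rw [List.head?_reverse, hw]) (by rwa [List.length_reverse])
  refine ⟨c, hc, ?_⟩
  rwa [Construction.walk, List.map_reverse, ← List.reverse_eq_iff, ← List.reverse_eq_iff]

namespace Construction

variable {c : Construction}

theorem Valid.not_isCounterclockwise_map_reflect (h : c.Valid) :
    ¬ IsCounterclockwise (c.walk.map reflect) := by
  intro hccw
  have hclosing : ((-1, 0), (0, 0)) ∈ edges (c.walk.map reflect) := by
    rw [edges_map, h.edges_walk, List.map_append]
    exact List.mem_append_right _ List.mem_cons_self
  have hleft : leftCell (-1, 0) (0, 0) = (-1, 0) := leftCell_right (-1) 0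
  have hcell := hccw _ hclosing
  rw [hleft, h.isPrudentPolygon_walk.mem_cells_map_reflect, h.cells_walk] at hcell
  exact absurd (h.snd_nonneg_of_left hcell rfl) (by decide)

theorem mem_classW_iff {w : List (ℤ × ℤ)} :
    w ∈ classW ↔ ∃ c : Construction, c.Valid ∧ c.walk = w := by
  constructor
  · rintro ⟨hpolygon, hlast, hccw⟩
    obtain ⟨c, hc, rfl | rfl⟩ := hpolygon.exists_walk hlast
    · exact ⟨c, hc, rfl⟩
    · exact absurd hccw hc.not_isCounterclockwise_map_reflect
  · rintro ⟨c, hc, rfl⟩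
    exact hc.walk_mem_classW

theorem Valid.walk_mem_classX_iff (h : c.Valid) : c.walk ∈ classX ↔ c.IsX := by
  rw [h.isX_iff, ← h.cells_walk]
  exact and_iff_right h.walk_mem_classW

theorem Valid.walk_mem_classY_iff (h : c.Valid) : c.walk ∈ classY ↔ ¬ c.IsX ∧ ¬ c.IsZ := by
  have hmem : c.walk ∈ classY ↔ area (PrudentPolygon.cells c.walk) = 1 ∨
      (c.walk ∉ classX ∧ PrudentPolygon.height (removeRightColumn (PrudentPolygon.cells c.walk)) =
          PrudentPolygon.height (PrudentPolygon.cells c.walk) ∧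
        IsOnePiece (removeRightColumn (PrudentPolygon.cells c.walk))) :=
    and_iff_right h.walk_mem_classW
  rw [hmem, h.walk_mem_classX_iff, h.cells_walk, PrudentPolygon.area, h.ncard_cells]
  by_cases hX : c.IsX
  · have harea : c.area ≠ 1 := fun harea => by rwa [h.area_eq_one_iff.1 harea] at hX
    simp only [hX, harea, not_true_eq_false, false_and, or_self]
  · rw [h.not_isZ_iff hX]
    simp only [hX, not_false_eq_true, true_and]

theorem Valid.walk_mem_classZ_iff (h : c.Valid) : c.walk ∈ classZ ↔ c.IsZ := by
  have hmem : c.walk ∈ classZ ↔ c.walk ∉ classX ∧ c.walk ∉ classY :=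
    and_iff_right h.walk_mem_classW
  rw [hmem, h.walk_mem_classX_iff, h.walk_mem_classY_iff]
  have := not_isX_of_isZ (c := c)
  tauto

theorem ncard_walks {s : Set (List (ℤ × ℤ))} (hs : s ⊆ classW) {P : Construction → Prop}
    (h : ∀ {c : Construction}, c.Valid → (c.walk ∈ s ↔ P c)) :
    s.ncard = {c : Construction | c.Valid ∧ P c}.ncard := by
  have himage : s = walk '' {c : Construction | c.Valid ∧ P c} := by
    ext w
    constructor
    · intro hw
      obtain ⟨c, hc, rfl⟩ := mem_classW_iff.1 (hs hw)
      exact ⟨c, ⟨hc, (h hc).1 hw⟩, rfl⟩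
    · rintro ⟨c, ⟨hc, hP⟩, rfl⟩
      exact (h hc).2 hP
  rw [himage, Set.InjOn.ncard_image (walk_injOn.mono fun _ hc => hc.1)]

end Construction

/-! ### The eight symmetry classes -/

/-- The constructions of the polygons of area `n`. -/
def ofArea (n : ℕ) : Set Construction := {c | c.Valid ∧ c.area = n}

theorem finite_area_le : ∀ n : ℕ, {c : Construction | c.Valid ∧ c.area ≤ n}.Finite
  | 0 => Set.finite_empty.subset fun _ hc => absurd hc.2 (Nat.not_le.2 hc.1.one_le_area)
  | n + 1 => by
    have hfin (f : Construction → ℕ → Construction) :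
        (Set.image2 f {c | c.Valid ∧ c.area ≤ n} (Set.Iic (n + 1))).Finite :=
      (finite_area_le n).image2 f (Set.finite_Iic _)
    refine ((((hfin addTop).union (hfin addRight)).union (hfin addBottom)).insert square).subset ?_
    rintro (_ | ⟨c, k⟩ | ⟨c, k⟩ | ⟨c, k⟩) ⟨hc, harea⟩
    · exact .inl rfl
    all_goals
      rw [Construction.area] at harea
      have hk := hc.2
      have hmem : c ∈ {c : Construction | c.Valid ∧ c.area ≤ n} := ⟨hc.1, by omega⟩
      have hk' : k ∈ Set.Iic (n + 1) := Set.mem_Iic.2 (by omega)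
    · exact .inr (.inl (.inl ⟨c, hmem, k, hk', rfl⟩))
    · exact .inr (.inl (.inr ⟨c, hmem, k, hk', rfl⟩))
    · exact .inr (.inr ⟨c, hmem, k, hk', rfl⟩)

theorem finite_ofArea (n : ℕ) : (ofArea n).Finite :=
  (finite_area_le n).subset fun _ hc => ⟨hc.1, hc.2.le⟩

/-- The prudent polygons of area `n` that end at `e`. -/
def polygonsEndingAt (n : ℕ) (e : ℤ × ℤ) : Set (List (ℤ × ℤ)) :=
  {w | IsPrudentPolygon w ∧ area (cells w) = n ∧ w.getLast? = some e}

theorem encard_polygonsEndingAt_of_involutive {f : ℤ × ℤ → ℤ × ℤ} (hf : f.Involutive)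
    (hpolygon : ∀ {w}, IsPrudentPolygon w → IsPrudentPolygon (w.map f))
    (harea : ∀ {w}, IsPrudentPolygon w → area (cells (w.map f)) = area (cells w))
    (n : ℕ) (e : ℤ × ℤ) :
    (polygonsEndingAt n (f e)).encard = (polygonsEndingAt n e).encard := by
  have hle (e : ℤ × ℤ) : (polygonsEndingAt n e).encard ≤ (polygonsEndingAt n (f e)).encard := by
    refine Set.encard_le_encard_of_injOn (f := List.map f) (fun w hw => ?_)
      (List.map_injective_iff.2 hf.injective).injOn
    exact ⟨hpolygon hw.1, (harea hw.1).trans hw.2.1, by rw [List.getLast?_map, hw.2.2]; rfl⟩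
  exact le_antisymm (by simpa only [hf e] using hle (f e)) (hle e)

theorem encard_polygonsEndingAt_reflect (n : ℕ) (e : ℤ × ℤ) :
    (polygonsEndingAt n (reflect e)).encard = (polygonsEndingAt n e).encard :=
  encard_polygonsEndingAt_of_involutive reflect_involutive .map_reflect
    IsPrudentPolygon.area_map_reflect n e

theorem encard_polygonsEndingAt_swap (n : ℕ) (e : ℤ × ℤ) :
    (polygonsEndingAt n e.swap).encard = (polygonsEndingAt n e).encard :=
  encard_polygonsEndingAt_of_involutive Prod.swap_swap .map_swap
    IsPrudentPolygon.area_map_swap n e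

theorem Construction.Valid.area_cells_walk {c : Construction} (h : c.Valid) :
    PrudentPolygon.area (PrudentPolygon.cells c.walk) = c.area := by
  rw [h.cells_walk, PrudentPolygon.area, h.ncard_cells]

theorem polygonsEndingAt_left (n : ℕ) : polygonsEndingAt n (-1, 0) =
    walk '' ofArea n ∪ List.map reflect '' (walk '' ofArea n) := by
  ext w
  constructor
  · rintro ⟨hpolygon, harea, hlast⟩
    obtain ⟨c, hc, rfl | rfl⟩ := hpolygon.exists_walk hlast
    · rw [hc.area_cells_walk] at harea
      exact .inl ⟨c, ⟨hc, harea⟩, rfl⟩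
    · rw [hc.isPrudentPolygon_walk.area_map_reflect, hc.area_cells_walk] at harea
      exact .inr ⟨_, ⟨c, ⟨hc, harea⟩, rfl⟩, rfl⟩
  · rintro (⟨c, ⟨hc, rfl⟩, rfl⟩ | ⟨_, ⟨c, ⟨hc, rfl⟩, rfl⟩, rfl⟩)
    · exact ⟨hc.isPrudentPolygon_walk, hc.area_cells_walk, hc.getLast?_walk⟩
    · have hpolygon := hc.isPrudentPolygon_walk
      refine ⟨hpolygon.map_reflect, by rw [hpolygon.area_map_reflect, hc.area_cells_walk], ?_⟩
      rw [List.getLast?_map, hc.getLast?_walk]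
      rfl

theorem encard_polygonsEndingAt_left (n : ℕ) :
    (polygonsEndingAt n (-1, 0)).encard = 2 * (ofArea n).encard := by
  have hdisjoint : Disjoint (walk '' ofArea n) (List.map reflect '' (walk '' ofArea n)) := by
    rw [Set.disjoint_left]
    rintro _ ⟨c, hc, rfl⟩ ⟨_, ⟨d, hd, rfl⟩, h⟩
    exact hd.1.not_isCounterclockwise_map_reflect (h ▸ hc.1.isCounterclockwise_walk)
  rw [polygonsEndingAt_left, Set.encard_union_eq hdisjoint,
    (List.map_injective_iff.2 reflect_involutive.injective).encard_image,
    (walk_injOn.mono fun _ hc => hc.1).encard_image, two_mul]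

theorem setOf_isPrudentPolygon_area_eq (n : ℕ) : {w | IsPrudentPolygon w ∧ area (cells w) = n} =
    (polygonsEndingAt n (1, 0) ∪ polygonsEndingAt n (-1, 0)) ∪
      (polygonsEndingAt n (0, 1) ∪ polygonsEndingAt n (0, -1)) := by
  ext w
  constructor
  · rintro ⟨hpolygon, harea⟩
    obtain ⟨-, -, -, ⟨a, b⟩, hlast, hunit⟩ := id hpolygon
    rcases abs_add_abs_eq_one_iff.1 hunit with ⟨rfl, rfl⟩ | ⟨rfl, rfl⟩ | ⟨rfl, rfl⟩ | ⟨rfl, rfl⟩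
    · exact .inl (.inl ⟨hpolygon, harea, hlast⟩)
    · exact .inl (.inr ⟨hpolygon, harea, hlast⟩)
    · exact .inr (.inl ⟨hpolygon, harea, hlast⟩)
    · exact .inr (.inr ⟨hpolygon, harea, hlast⟩)
  · rintro ((h | h) | (h | h)) <;> exact ⟨h.1, h.2.1⟩

theorem disjoint_polygonsEndingAt {e e' : ℤ × ℤ} (h : e ≠ e') (n : ℕ) :
    Disjoint (polygonsEndingAt n e) (polygonsEndingAt n e') :=
  Set.disjoint_left.2 fun _ hw hw' => h (Option.some.inj (hw.2.2.symm.trans hw'.2.2))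

-- The symmetries of the square permute the four end points, and the two orientations of a polygon
-- that ends at `(-1, 0)` are exchanged by a reflection.
theorem encard_polygons_of_area (n : ℕ) :
    {w | IsPrudentPolygon w ∧ area (cells w) = n}.encard = 8 * (ofArea n).encard := by
  have hleft := encard_polygonsEndingAt_left n
  have hbottom : (polygonsEndingAt n (0, -1)).encard = _ :=
    (encard_polygonsEndingAt_swap n (-1, 0)).trans hleft
  have htop : (polygonsEndingAt n (0, 1)).encard = _ :=
    (encard_polygonsEndingAt_reflect n (0, -1)).trans hbottom
  have hright : (polygonsEndingAt n (1, 0)).encard = _ :=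
    (encard_polygonsEndingAt_swap n (0, 1)).trans htop
  rw [setOf_isPrudentPolygon_area_eq, Set.encard_union_eq, Set.encard_union_eq,
    Set.encard_union_eq, hleft, hbottom, htop, hright]
  · ring
  · exact disjoint_polygonsEndingAt (by decide) n
  · exact disjoint_polygonsEndingAt (by decide) n
  · rw [Set.disjoint_union_left, Set.disjoint_union_right, Set.disjoint_union_right]
    exact ⟨⟨disjoint_polygonsEndingAt (by decide) n, disjoint_polygonsEndingAt (by decide) n⟩,
      disjoint_polygonsEndingAt (by decide) n, disjoint_polygonsEndingAt (by decide) n⟩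

theorem finite_polygons_of_area (n : ℕ) : {w | IsPrudentPolygon w ∧ area (cells w) = n}.Finite := by
  rw [← Set.encard_lt_top_iff, encard_polygons_of_area]
  exact WithTop.mul_lt_top (by decide) (finite_ofArea n).encard_lt_top

theorem ncard_polygons_of_area (n : ℕ) :
    {w | IsPrudentPolygon w ∧ area (cells w) = n}.ncard = 8 * (ofArea n).ncard := by
  rw [Set.ncard_def, encard_polygons_of_area, Set.ncard_def, ENat.toNat_mul]
  rfl

/-! ### Generating functions -/

open MvPowerSeries Finsupp

section genSeries

variable {α β σ τ : Type*} {R : Type*} [CommRing R] {s t : Set α} {w : α → σ →₀ ℕ}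

/-- Each value of the statistic `f` is taken by finitely many elements of `s`. -/
def FiniteFibers (s : Set α) (f : α → β) : Prop := ∀ b, {a ∈ s | f a = b}.Finite

theorem FiniteFibers.subset {f : α → β} (h : FiniteFibers t f) (hs : s ⊆ t) : FiniteFibers s f :=
  fun b => (h b).subset fun _ ha => ⟨hs ha.1, ha.2⟩

theorem FiniteFibers.of_comp {γ : Type*} {f : α → β} (g : β → γ)
    (h : FiniteFibers s fun a => g (f a)) : FiniteFibers s f :=
  fun b => (h (g b)).subset fun _ ha => ⟨ha.1, congrArg g ha.2⟩

theorem FiniteFibers.add_right {f : α → ℕ} (h : FiniteFibers s f) (g : α → ℕ) :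
    FiniteFibers s fun a => f a + g a := fun n =>
  ((Set.finite_Iic n).biUnion fun m _ => h m).subset fun _ ha =>
    Set.mem_biUnion (Set.mem_Iic.2 ((Nat.le_add_right _ _).trans ha.2.le)) ⟨ha.1, rfl⟩

/-- The generating function of the set `s`, whose elements `a` are marked by the monomials with
exponent vectors `w a`. It is meaningful when `w` has finite fibers on `s`. -/
noncomputable def genSeries (R : Type*) [CommRing R] (s : Set α) (w : α → σ →₀ ℕ) :
    MvPowerSeries σ R := fun m => ({a ∈ s | w a = m}.ncard : R)

theorem coeff_genSeries (s : Set α) (w : α → σ →₀ ℕ) (m : σ →₀ ℕ) :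
    coeff m (genSeries R s w) = ({a ∈ s | w a = m}.ncard : R) := rfl

theorem genSeries_congr {w' : α → σ →₀ ℕ} (h : ∀ a ∈ s, w a = w' a) :
    genSeries R s w = genSeries R s w' := by
  ext m
  rw [coeff_genSeries, coeff_genSeries]
  congr 2
  ext a
  exact and_congr_right fun ha => by rw [h a ha]

theorem genSeries_union (hd : Disjoint s t) (hs : FiniteFibers s w) (ht : FiniteFibers t w) :
    genSeries R (s ∪ t) w = genSeries R s w + genSeries R t w := by
  ext m
  rw [map_add, coeff_genSeries, coeff_genSeries, coeff_genSeries, ← Nat.cast_add,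
    ← Set.ncard_union_eq (hd.mono (fun _ ha => ha.1) fun _ ha => ha.1) (hs m) (ht m)]
  congr 2
  ext a
  exact or_and_right

theorem genSeries_image {e : β → α} {s : Set β} (he : Set.InjOn e s) (w : α → σ →₀ ℕ) :
    genSeries R (e '' s) w = genSeries R s fun b => w (e b) := by
  ext m
  rw [coeff_genSeries, coeff_genSeries, ← Set.InjOn.ncard_image (he.mono fun a ha => ha.1)]
  congr 2
  ext a
  constructor
  · rintro ⟨⟨b, hb, rfl⟩, ha⟩
    exact ⟨b, ⟨hb, ha⟩, rfl⟩
  · rintro ⟨b, ⟨hb, ha⟩, rfl⟩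
    exact ⟨⟨b, hb, rfl⟩, ha⟩

theorem genSeries_singleton (a : α) (w : α → σ →₀ ℕ) :
    genSeries R {a} w = monomial (w a) 1 := by
  classical
  ext m
  rw [coeff_genSeries, coeff_monomial]
  split_ifs with hm
  · have hfiber : {b ∈ ({a} : Set α) | w b = m} = {a} := by
      refine Set.Subset.antisymm (fun _ hb => hb.1) ?_
      rintro _ rfl
      exact ⟨rfl, hm.symm⟩
    rw [hfiber, Set.ncard_singleton, Nat.cast_one]
  · have hfiber : {b ∈ ({a} : Set α) | w b = m} = ∅ := by
      refine Set.eq_empty_of_forall_notMem ?_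
      rintro _ ⟨rfl, hb⟩
      exact hm hb.symm
    rw [hfiber, Set.ncard_empty, Nat.cast_zero]

theorem X_mul_genSeries (i : σ) (s : Set α) (w : α → σ →₀ ℕ) :
    X i * genSeries R s w = genSeries R s fun a => w a + single i 1 := by
  classical
  ext m
  rw [X_def, coeff_monomial_mul, one_mul, coeff_genSeries, coeff_genSeries]
  split_ifs with hm
  · congr 2
    ext a
    exact and_congr_right fun _ => eq_tsub_iff_add_eq_of_le hm
  · have hfiber : {a ∈ s | w a + single i 1 = m} = ∅ := by
      refine Set.eq_empty_of_forall_notMem ?_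
      rintro a ⟨-, rfl⟩
      exact hm le_add_self
    rw [hfiber, Set.ncard_empty, Nat.cast_zero]

theorem ncard_eq_finsum_ncard_fiber (ht : t.Finite) (f : α → β) :
    (t.ncard : R) = ∑ᶠ b, ({a ∈ t | f a = b}.ncard : R) := by
  classical
  lift t to Finset α using ht
  have hfiber (b : β) : {a ∈ (t : Set α) | f a = b}.ncard = (t.filter (f · = b)).card := by
    rw [← Set.ncard_coe_finset, Finset.coe_filter]
    rfl
  simp only [hfiber]
  rw [finsum_eq_sum_of_support_subset (s := t.image f), Set.ncard_coe_finset,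
    Finset.card_eq_sum_card_image f t, Nat.cast_sum]
  intro b hb
  have hcard : (t.filter (f · = b)).card ≠ 0 := fun h => hb (by simp only [h, Nat.cast_zero])
  obtain ⟨a, ha⟩ := Finset.card_ne_zero.1 hcard
  exact Finset.mem_coe.2 (Finset.mem_image.2 ⟨a, Finset.mem_filter.1 ha⟩)

theorem hasSubst_monomial [Finite σ] {φ : σ → τ →₀ ℕ} (hφ : ∀ i, φ i ≠ 0) :
    HasSubst fun i => (monomial (φ i) 1 : MvPowerSeries τ R) := by
  classical
  refine hasSubst_of_constantCoeff_zero fun i => ?_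
  rw [← coeff_zero_eq_constantCoeff_apply, coeff_monomial_ne (hφ i).symm]

theorem subst_genSeries [Finite σ] {φ : σ → τ →₀ ℕ} (hφ : ∀ i, φ i ≠ 0)
    (hs : FiniteFibers s fun a => (w a).sum fun i e => e • φ i) :
    subst (fun i => (monomial (φ i) 1 : MvPowerSeries τ R)) (genSeries R s w) =
      genSeries R s fun a => (w a).sum fun i e => e • φ i := by
  classical
  have hprod (d : σ →₀ ℕ) : (d.prod fun i e => (monomial (φ i) 1 : MvPowerSeries τ R) ^ e) =
      monomial (d.sum fun i e => e • φ i) 1 := by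
    simp only [Finsupp.prod, Finsupp.sum, monomial_pow, one_pow, prod_monomial,
      Finset.prod_const_one]
  ext m
  rw [coeff_subst (hasSubst_monomial hφ), coeff_genSeries, ncard_eq_finsum_ncard_fiber (hs m) w]
  refine finsum_congr fun d => ?_
  rw [hprod, coeff_monomial, coeff_genSeries, smul_eq_mul]
  split_ifs with hm
  · rw [mul_one]
    congr 2
    ext a
    exact ⟨fun ha => ⟨⟨ha.1, hm ▸ ha.2 ▸ rfl⟩, ha.2⟩, fun ha => ⟨ha.1.1, ha.2⟩⟩
  · have hfiber : {a ∈ {a ∈ s | ((w a).sum fun i e => e • φ i) = m} | w a = d} = ∅ := by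
      refine Set.eq_empty_of_forall_notMem ?_
      rintro a ⟨⟨-, rfl⟩, rfl⟩
      exact hm rfl
    rw [mul_zero, hfiber, Set.ncard_empty, Nat.cast_zero]

/-- The pairs of an element `a` of `s` and a number `k` with `1 ≤ k ≤ n a`. -/
def pairs (s : Set α) (n : α → ℕ) : Set (α × ℕ) := {p | p.1 ∈ s ∧ 1 ≤ p.2 ∧ p.2 ≤ n p.1}

theorem FiniteFibers.pairs (hs : FiniteFibers s w) (i : σ) (n : α → ℕ) :
    FiniteFibers (pairs s n) fun p => w p.1 + single i p.2 := by
  intro m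
  refine ((Set.finite_Iic (m i)).biUnion fun k _ =>
    (hs (m - single i k)).prod (Set.finite_singleton k)).subset ?_
  rintro ⟨a, k⟩ ⟨⟨ha, -⟩, rfl⟩
  refine Set.mem_biUnion (x := k) ?_ ⟨⟨ha, ?_⟩, rfl⟩
  · simp
  · exact (add_tsub_cancel_right _ _).symm

theorem pairs_add_one (s : Set α) (n : α → ℕ) :
    pairs s (fun a => n a + 1) = pairs s n ∪ (fun a => (a, n a + 1)) '' s := by
  ext ⟨a, k⟩
  simp only [pairs, Set.mem_ofPred_eq, Set.mem_union, Set.mem_image, Prod.mk.injEq]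
  constructor
  · rintro ⟨ha, hk, hkn⟩
    rcases hkn.lt_or_eq with hlt | rfl
    · exact .inl ⟨ha, hk, Nat.lt_succ_iff.1 hlt⟩
    · exact .inr ⟨a, ha, rfl, rfl⟩
  · rintro (⟨ha, hk, hkn⟩ | ⟨_, ha, rfl, rfl⟩)
    · exact ⟨ha, hk, Nat.le_succ_of_le hkn⟩
    · exact ⟨ha, Nat.le_add_left 1 _, le_rfl⟩

theorem pairs_add_one' (s : Set α) (n : α → ℕ) : pairs s (fun a => n a + 1) =
    (fun p : α × ℕ => (p.1, p.2 + 1)) '' pairs s n ∪ (fun a => (a, 1)) '' s := by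
  ext ⟨a, k⟩
  simp only [pairs, Set.mem_ofPred_eq, Set.mem_union, Set.mem_image, Prod.mk.injEq, Prod.exists]
  constructor
  · rintro ⟨ha, hk, hkn⟩
    rcases hk.eq_or_lt with rfl | hlt
    · exact .inr ⟨a, ha, rfl, rfl⟩
    · exact .inl ⟨a, k - 1, ⟨ha, by omega, by omega⟩, rfl, by omega⟩
  · rintro (⟨_, k, ⟨ha, -, hkn⟩, rfl, rfl⟩ | ⟨_, ha, rfl, rfl⟩)
    · exact ⟨ha, Nat.le_add_left 1 k, Nat.succ_le_succ hkn⟩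
    · exact ⟨ha, le_rfl, Nat.le_add_left 1 _⟩

theorem genSeries_pairs_add_one (hs : FiniteFibers s w) (i : σ) (n : α → ℕ) :
    genSeries R (pairs s fun a => n a + 1) (fun p => w p.1 + single i p.2) =
      genSeries R (pairs s n) (fun p => w p.1 + single i p.2) +
        X i * genSeries R s fun a => w a + single i (n a) := by
  have hfin := hs.pairs i fun a => n a + 1
  rw [pairs_add_one] at hfin ⊢
  have hinj : Set.InjOn (fun a => (a, n a + 1)) s := fun _ _ _ _ h => (Prod.mk.inj h).1
  have hdisj : Disjoint (pairs s n) ((fun a => (a, n a + 1)) '' s) := by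
    rw [Set.disjoint_left]
    rintro _ hp ⟨a, -, rfl⟩
    exact Nat.not_succ_le_self (n a) hp.2.2
  rw [genSeries_union hdisj (hfin.subset Set.subset_union_left)
    (hfin.subset Set.subset_union_right), genSeries_image hinj, X_mul_genSeries]
  simp only [single_add, add_assoc]

theorem genSeries_pairs_add_one' (hs : FiniteFibers s w) (i : σ) (n : α → ℕ) :
    genSeries R (pairs s fun a => n a + 1) (fun p => w p.1 + single i p.2) =
      X i * genSeries R (pairs s n) (fun p => w p.1 + single i p.2) + X i * genSeries R s w := by
  have hfin := hs.pairs i fun a => n a + 1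
  rw [pairs_add_one'] at hfin ⊢
  have hinj_succ : Set.InjOn (fun p : α × ℕ => (p.1, p.2 + 1)) (pairs s n) := fun _ _ _ _ h =>
    Prod.ext (Prod.mk.inj h).1 (Nat.succ_injective (Prod.mk.inj h).2)
  have hinj_one : Set.InjOn (fun a : α => (a, 1)) s := fun _ _ _ _ h => (Prod.mk.inj h).1
  have hdisj : Disjoint ((fun p : α × ℕ => (p.1, p.2 + 1)) '' pairs s n)
      ((fun a => (a, 1)) '' s) := by
    rw [Set.disjoint_left]
    rintro _ ⟨p, hp, rfl⟩ ⟨a, -, h⟩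
    exact Nat.one_le_iff_ne_zero.1 hp.2.1 (Nat.succ_injective (Prod.mk.inj h).2.symm)
  rw [genSeries_union hdisj (hfin.subset Set.subset_union_left)
    (hfin.subset Set.subset_union_right), genSeries_image hinj_succ, genSeries_image hinj_one,
    X_mul_genSeries, X_mul_genSeries]
  simp only [single_add, add_assoc]

-- The pairs over each element of `s` contribute a geometric sum.
theorem one_sub_X_mul_genSeries_pairs (hs : FiniteFibers s w) (i : σ) (n : α → ℕ) :
    (1 - X i) * genSeries R (pairs s n) (fun p => w p.1 + single i p.2) =
      X i * (genSeries R s w - genSeries R s fun a => w a + single i (n a)) := by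
  linear_combination
    genSeries_pairs_add_one' (R := R) hs i n - genSeries_pairs_add_one (R := R) hs i n

end genSeries

section statSeries

/-- The exponent vector of the monomial `q ^ i * u ^ j * v ^ k`. -/
noncomputable def exponent (i j k : ℕ) : Fin 3 →₀ ℕ := Finsupp.equivFunOnFinite.symm ![i, j, k]

theorem exponent_eq_iff {i j k : ℕ} {m : Fin 3 →₀ ℕ} :
    exponent i j k = m ↔ i = m 0 ∧ j = m 1 ∧ k = m 2 := by
  rw [Finsupp.ext_iff, Fin.forall_fin_succ, Fin.forall_fin_two]
  rfl

theorem exponent_ne_zero {i j k : ℕ} (hne : i + j + k ≠ 0) : exponent i j k ≠ 0 := by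
  rw [Ne, exponent_eq_iff]
  simp only [Finsupp.coe_zero, Pi.zero_apply]
  omega

theorem exponent_add (i j k i' j' k' : ℕ) :
    exponent i j k + exponent i' j' k' = exponent (i + i') (j + j') (k + k') :=
  (exponent_eq_iff.2 ⟨rfl, rfl, rfl⟩).symm

theorem smul_exponent (n i j k : ℕ) :
    n • exponent i j k = exponent (n * i) (n * j) (n * k) :=
  (exponent_eq_iff.2 ⟨rfl, rfl, rfl⟩).symm

theorem single_zero_eq_exponent (n : ℕ) : single 0 n = exponent n 0 0 :=
  (exponent_eq_iff.2 ⟨by simp, by simp, by simp⟩).symm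

theorem single_one_eq_exponent (n : ℕ) : single 1 n = exponent 0 n 0 :=
  (exponent_eq_iff.2 ⟨by simp, by simp, by simp⟩).symm

theorem single_two_eq_exponent (n : ℕ) : single 2 n = exponent 0 0 n :=
  (exponent_eq_iff.2 ⟨by simp, by simp, by simp⟩).symm

theorem monomial_exponent (i j k : ℕ) :
    (monomial (exponent i j k) 1 : MvPowerSeries (Fin 3) ℚ) = X 0 ^ i * X 1 ^ j * X 2 ^ k := by
  rw [X_pow_eq, X_pow_eq, X_pow_eq, monomial_mul_monomial, monomial_mul_monomial,
    single_zero_eq_exponent, single_one_eq_exponent, single_two_eq_exponent, exponent_add,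
    exponent_add]
  simp only [add_zero, zero_add, mul_one]

variable {α β : Type*} {s t : Set α} {f g h : α → ℕ}

/-- The generating function of the set `s` in which `q, u, v` mark the statistics `f, g, h`. -/
noncomputable def statSeries (s : Set α) (f g h : α → ℕ) : MvPowerSeries (Fin 3) ℚ :=
  genSeries ℚ s fun a => exponent (f a) (g a) (h a)

theorem coeff_statSeries (s : Set α) (f g h : α → ℕ) (m : Fin 3 →₀ ℕ) :
    coeff m (statSeries s f g h) =
      ({a ∈ s | f a = m 0 ∧ g a = m 1 ∧ h a = m 2}.ncard : ℚ) := by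
  simp only [statSeries, coeff_genSeries, exponent_eq_iff]

theorem FiniteFibers.exponent (hs : FiniteFibers s f) (g h : α → ℕ) :
    FiniteFibers s fun a => exponent (f a) (g a) (h a) :=
  .of_comp (fun m : Fin 3 →₀ ℕ => m 0) hs

theorem statSeries_congr {f' g' h' : α → ℕ} (hf : ∀ a ∈ s, f a = f' a) (hg : ∀ a ∈ s, g a = g' a)
    (hh : ∀ a ∈ s, h a = h' a) : statSeries s f g h = statSeries s f' g' h' :=
  genSeries_congr fun a ha => by rw [hf a ha, hg a ha, hh a ha]

theorem statSeries_union (hd : Disjoint s t) (hf : FiniteFibers (s ∪ t) f) (g h : α → ℕ) :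
    statSeries (s ∪ t) f g h = statSeries s f g h + statSeries t f g h :=
  genSeries_union hd ((hf.subset Set.subset_union_left).exponent g h)
    ((hf.subset Set.subset_union_right).exponent g h)

theorem statSeries_image {e : β → α} {s : Set β} (he : Set.InjOn e s) (f g h : α → ℕ) :
    statSeries (e '' s) f g h =
      statSeries s (fun b => f (e b)) (fun b => g (e b)) fun b => h (e b) :=
  genSeries_image he _

theorem statSeries_singleton (a : α) (f g h : α → ℕ) :
    statSeries {a} f g h = X 0 ^ f a * X 1 ^ g a * X 2 ^ h a := by
  rw [statSeries, genSeries_singleton, monomial_exponent]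

theorem X_zero_mul_statSeries (s : Set α) (f g h : α → ℕ) :
    X 0 * statSeries s f g h = statSeries s (fun a => f a + 1) g h := by
  simp only [statSeries, X_mul_genSeries, single_zero_eq_exponent, exponent_add, add_zero]

theorem X_one_mul_statSeries (s : Set α) (f g h : α → ℕ) :
    X 1 * statSeries s f g h = statSeries s f (fun a => g a + 1) h := by
  simp only [statSeries, X_mul_genSeries, single_one_eq_exponent, exponent_add, add_zero]

theorem X_two_mul_statSeries (s : Set α) (f g h : α → ℕ) :
    X 2 * statSeries s f g h = statSeries s f g fun a => h a + 1 := by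
  simp only [statSeries, X_mul_genSeries, single_two_eq_exponent, exponent_add, add_zero]

theorem statSeries_pairs (hs : FiniteFibers s f) (n g h : α → ℕ) :
    statSeries (pairs s n) (fun p => f p.1 + p.2) (fun p => g p.1) (fun p => h p.1) =
      X 0 * (1 - X 0)⁻¹ * (statSeries s f g h - statSeries s (fun a => f a + n a) g h) := by
  have hconst : constantCoeff (1 - X 0 : MvPowerSeries (Fin 3) ℚ) ≠ 0 := by simp
  have hpairs := one_sub_X_mul_genSeries_pairs (R := ℚ) (hs.exponent g h) 0 n
  simp only [single_zero_eq_exponent, exponent_add, add_zero] at hpairs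
  rw [mul_right_comm, MvPowerSeries.eq_mul_inv_iff_mul_eq hconst, mul_comm]
  exact hpairs

theorem substUV_statSeries {i j k i' j' k' : ℕ} (hs : FiniteFibers s f) (hne : i + j + k ≠ 0)
    (hne' : i' + j' + k' ≠ 0) (g h : α → ℕ) :
    substUV (statSeries s f g h) (X 0 ^ i * X 1 ^ j * X 2 ^ k) (X 0 ^ i' * X 1 ^ j' * X 2 ^ k') =
      statSeries s (fun a => f a + (g a * i + h a * i')) (fun a => g a * j + h a * j')
        fun a => g a * k + h a * k' := by
  set φ : Fin 3 → Fin 3 →₀ ℕ := ![exponent 1 0 0, exponent i j k, exponent i' j' k']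
  have hφ_ne : ∀ t, φ t ≠ 0 := by
    rw [Fin.forall_fin_succ, Fin.forall_fin_two]
    exact ⟨exponent_ne_zero (by decide), exponent_ne_zero hne, exponent_ne_zero hne'⟩
  have hsum (a : α) : ((exponent (f a) (g a) (h a)).sum fun t e => e • φ t) =
      exponent (f a + (g a * i + h a * i')) (g a * j + h a * j') (g a * k + h a * k') := by
    rw [Finsupp.sum_fintype _ _ fun t => zero_smul ℕ (φ t), Fin.sum_univ_three]
    change f a • exponent 1 0 0 + g a • exponent i j k + h a • exponent i' j' k' = _
    simp only [smul_exponent, exponent_add, mul_one, mul_zero, zero_add, add_assoc]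
  have hsubst : ![X 0, X 0 ^ i * X 1 ^ j * X 2 ^ k, X 0 ^ i' * X 1 ^ j' * X 2 ^ k'] =
      fun t => (monomial (φ t) 1 : MvPowerSeries (Fin 3) ℚ) := by
    rw [← monomial_exponent, ← monomial_exponent, X_def, single_zero_eq_exponent]
    funext t
    fin_cases t <;> rfl
  have hfin : FiniteFibers s fun a => (exponent (f a) (g a) (h a)).sum fun t e => e • φ t := by
    simp only [hsum]
    exact (hs.add_right _).exponent _ _
  rw [substUV, hsubst, statSeries, subst_genSeries hφ_ne hfin]
  simp only [hsum, statSeries]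

theorem substUV_statSeries_qu_v (hs : FiniteFibers s f) (g h : α → ℕ) :
    substUV (statSeries s f g h) (X 0 * X 1) (X 2) = statSeries s (fun a => f a + g a) g h := by
  simpa using substUV_statSeries (i := 1) (j := 1) (k := 0) (i' := 0) (j' := 0) (k' := 1) hs
    (by decide) (by decide) g h

theorem substUV_statSeries_qv_u (hs : FiniteFibers s f) (g h : α → ℕ) :
    substUV (statSeries s f g h) (X 0 * X 2) (X 1) = statSeries s (fun a => f a + g a) h g := by
  simpa using substUV_statSeries (i := 1) (j := 0) (k := 1) (i' := 0) (j' := 1) (k' := 0) hs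
    (by decide) (by decide) g h

theorem substUV_statSeries_v_u (hs : FiniteFibers s f) (g h : α → ℕ) :
    substUV (statSeries s f g h) (X 2) (X 1) = statSeries s f h g := by
  simpa using substUV_statSeries (i := 0) (j := 0) (k := 1) (i' := 0) (j' := 1) (k' := 0) hs
    (by decide) (by decide) g h

theorem substUV_statSeries_v_qu (hs : FiniteFibers s f) (g h : α → ℕ) :
    substUV (statSeries s f g h) (X 2) (X 0 * X 1) = statSeries s (fun a => f a + h a) h g := by
  simpa using substUV_statSeries (i := 0) (j := 0) (k := 1) (i' := 1) (j' := 1) (k' := 0) hs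
    (by decide) (by decide) g h

theorem substUV_statSeries_u_qv (hs : FiniteFibers s f) (g h : α → ℕ) :
    substUV (statSeries s f g h) (X 1) (X 0 * X 2) = statSeries s (fun a => f a + h a) g h := by
  simpa using substUV_statSeries (i := 0) (j := 1) (k := 0) (i' := 1) (j' := 0) (k' := 1) hs
    (by decide) (by decide) g h

theorem coeff_evalOne_statSeries (hs : FiniteFibers s f) (g h : α → ℕ) (n : ℕ) :
    PowerSeries.coeff n (evalOne (statSeries s f g h)) = ({a ∈ s | f a = n}.ncard : ℚ) := by
  rw [evalOne, PowerSeries.coeff_mk, ncard_eq_finsum_ncard_fiber (hs n) fun a => (g a, h a)]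
  refine finsum_congr fun p => ?_
  rw [coeff_statSeries]
  congr 2
  ext a
  change _ ∧ _ = n ∧ _ = p.1 ∧ _ = p.2 ↔ (_ ∧ _) ∧ (g a, h a) = p
  rw [Prod.ext_iff, and_assoc]

end statSeries

/-! ### The functional equations -/

namespace Construction

variable {f : Construction → ℕ}

/-- The constructions of the prudent polygons that end at `(-1, 0)` and are traversed
counterclockwise. -/
def valid : Set Construction := {c | c.Valid}

/-- The constructions of the polygons of class `𝒳`. -/
def validX : Set Construction := {c | c.Valid ∧ c.IsX}

/-- The constructions of the polygons of class `𝒴`. -/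
def validY : Set Construction := {c | c.Valid ∧ ¬ c.IsX ∧ ¬ c.IsZ}

/-- The constructions of the polygons of class `𝒵`. -/
def validZ : Set Construction := {c | c.Valid ∧ c.IsZ}

/-- The constructions of the polygons that are not of class `𝒳`. -/
def validYZ : Set Construction := {c | c.Valid ∧ ¬ c.IsX}

theorem validY_union_validZ : validY ∪ validZ = validYZ := by
  ext c
  have := not_isX_of_isZ (c := c)
  simp only [validY, validZ, validYZ, Set.mem_union, Set.mem_ofPred_eq]
  tauto

theorem validX_union_validY_union_validZ : validX ∪ (validY ∪ validZ) = valid := by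
  ext c
  rw [validY_union_validZ]
  simp only [valid, validX, validYZ, Set.mem_union, Set.mem_ofPred_eq]
  tauto

theorem disjoint_validY_validZ : Disjoint validY validZ :=
  Set.disjoint_left.2 fun _ hY hZ => hY.2.2 hZ.2

theorem disjoint_validX : Disjoint validX (validY ∪ validZ) := by
  rw [validY_union_validZ]
  exact Set.disjoint_left.2 fun _ hX hYZ => hYZ.2 hX.2

theorem finiteFibers_area {s : Set Construction} (hs : s ⊆ valid) :
    FiniteFibers s (·.area) :=
  FiniteFibers.subset finite_ofArea hs

theorem finiteFibers_area_validX : FiniteFibers validX (·.area) :=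
  finiteFibers_area fun _ hc => hc.1

theorem finiteFibers_area_validY : FiniteFibers validY (·.area) :=
  finiteFibers_area fun _ hc => hc.1

theorem finiteFibers_area_validZ : FiniteFibers validZ (·.area) :=
  finiteFibers_area fun _ hc => hc.1

theorem statSeries_validYZ (hf : FiniteFibers valid f) (g h : Construction → ℕ) :
    statSeries validYZ f g h =
      statSeries validY f g h + statSeries validZ f g h := by
  rw [← validY_union_validZ, statSeries_union disjoint_validY_validZ]
  exact hf.subset (Set.union_subset (fun _ hc => hc.1) fun _ hc => hc.1)

theorem statSeries_valid (hf : FiniteFibers valid f) (g h : Construction → ℕ) :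
    statSeries valid f g h =
      statSeries validX f g h + (statSeries validY f g h + statSeries validZ f g h) := by
  rw [← statSeries_validYZ hf, ← validY_union_validZ, ← statSeries_union disjoint_validX]
  all_goals rw [validX_union_validY_union_validZ]
  exact hf

theorem validX_eq : validX =
    (fun p : Construction × ℕ => addTop p.1 p.2) '' pairs valid (·.width) := by
  ext c
  constructor
  · rintro ⟨hc, hX⟩
    cases c with
    | addTop c k => exact ⟨(c, k), ⟨hc.1, hc.2.1, hX⟩, rfl⟩
    | _ => exact hX.elim
  · rintro ⟨⟨c, k⟩, ⟨hc, hk, hk'⟩, rfl⟩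
    exact ⟨⟨hc, hk, Nat.le_succ_of_le hk'⟩, hk'⟩

theorem validY_eq : validY =
    ({square} ∪ (fun c : Construction => addTop c (c.width + 1)) '' valid) ∪
      (fun p : Construction × ℕ => addRight p.1 p.2) ''
        pairs validYZ (·.height) := by
  ext c
  constructor
  · rintro ⟨hc, hX, hZ⟩
    cases c with
    | square => exact .inl (.inl rfl)
    | addTop c k =>
      obtain rfl : k = c.width + 1 := le_antisymm hc.2.2 (not_le.1 hX)
      exact .inl (.inr ⟨c, hc.1, rfl⟩)
    | addRight c k => exact .inr ⟨(c, k), ⟨⟨hc.1, hc.2.1⟩, hc.2.2.1, not_lt.1 hZ⟩, rfl⟩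
    | addBottom c k => exact (hZ trivial).elim
  · rintro ((rfl | ⟨c, hc, rfl⟩) | ⟨⟨c, k⟩, ⟨⟨hc, hX⟩, hk, hk'⟩, rfl⟩)
    · exact ⟨trivial, id, id⟩
    · exact ⟨⟨hc, Nat.le_add_left 1 _, le_rfl⟩, Nat.not_succ_le_self _, id⟩
    · exact ⟨⟨hc, hX, hk, Nat.le_succ_of_le hk'⟩, id, not_lt.2 hk'⟩

theorem validZ_eq : validZ =
    (fun c : Construction => addRight c (c.height + 1)) '' validYZ ∪
      (fun p : Construction × ℕ => addBottom p.1 p.2) '' pairs validZ (·.width - 1) := by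
  ext c
  constructor
  · rintro ⟨hc, hZ⟩
    cases c with
    | square => exact hZ.elim
    | addTop c k => exact hZ.elim
    | addRight c k =>
      obtain rfl : k = c.height + 1 := le_antisymm hc.2.2.2 hZ
      exact .inl ⟨c, ⟨hc.1, hc.2.1⟩, rfl⟩
    | addBottom c k =>
      exact .inr ⟨(c, k), ⟨⟨hc.1, hc.2.1⟩, hc.2.2.1, Nat.le_sub_one_of_lt hc.2.2.2⟩, rfl⟩
  · rintro (⟨c, ⟨hc, hX⟩, rfl⟩ | ⟨⟨c, k⟩, ⟨⟨hc, hZ⟩, hk, hk'⟩, rfl⟩)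
    · exact ⟨⟨hc, hX, Nat.le_add_left 1 _, le_rfl⟩, Nat.lt_succ_self _⟩
    · exact ⟨⟨hc, hZ, hk, (Nat.le_sub_iff_add_le hc.one_le_width).1 hk'⟩, trivial⟩

theorem statSeries_validX : statSeries validX (·.area) (·.width) (·.height) =
    X 2 * (X 0 * (1 - X 0)⁻¹ * (statSeries valid (·.area) (·.width) (·.height) -
      statSeries valid (fun c => c.area + c.width) (·.width) (·.height))) := by
  have hinj : Set.InjOn (fun p : Construction × ℕ => addTop p.1 p.2)
      (pairs valid (·.width)) :=
    fun _ _ _ _ h => Prod.ext (addTop.inj h).1 (addTop.inj h).2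
  rw [← statSeries_pairs (finiteFibers_area subset_rfl), X_two_mul_statSeries]
  nth_rw 1 [validX_eq]
  rw [statSeries_image hinj]
  exact statSeries_congr (fun _ _ => rfl) (fun _ hp => max_eq_left hp.2.2) fun _ _ => rfl

theorem statSeries_validY : statSeries validY (·.area) (·.height) (·.width) =
    X 0 * X 1 * X 2 +
      X 0 * (X 1 * (X 2 *
        statSeries valid (fun c => c.area + c.width) (·.height) (·.width))) +
      X 2 * (X 0 * (1 - X 0)⁻¹ *
        (statSeries validYZ (·.area) (·.height) (·.width) -
          statSeries validYZ (fun c => c.area + c.height) (·.height)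
            (·.width))) := by
  have hfin := finiteFibers_area_validY
  rw [validY_eq] at hfin
  have hinj_top : Set.InjOn (fun c : Construction => addTop c (c.width + 1)) valid :=
    fun _ _ _ _ h => (addTop.inj h).1
  have hinj_right : Set.InjOn (fun p : Construction × ℕ => addRight p.1 p.2)
      (pairs validYZ (·.height)) :=
    fun _ _ _ _ h => Prod.ext (addRight.inj h).1 (addRight.inj h).2
  rw [← statSeries_pairs (finiteFibers_area fun _ hc => hc.1), X_two_mul_statSeries,
    X_two_mul_statSeries, X_one_mul_statSeries, X_zero_mul_statSeries]
  nth_rw 1 [validY_eq]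
  rw [statSeries_union ?_ hfin, statSeries_union ?_ (hfin.subset Set.subset_union_left),
    statSeries_singleton, statSeries_image hinj_top, statSeries_image hinj_right]
  · congr 1
    · congr 1
      · simp only [Construction.area, Construction.height, Construction.width, pow_one]
      · exact statSeries_congr (fun _ _ => rfl) (fun _ _ => rfl)
          fun _ _ => max_eq_right (Nat.le_succ _)
    · exact statSeries_congr (fun _ _ => rfl) (fun _ hp => max_eq_left hp.2.2) fun _ _ => rfl
  · rw [Set.disjoint_left]
    rintro _ rfl ⟨c, -, h⟩
    cases h
  · rw [Set.disjoint_left]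
    rintro _ (rfl | ⟨c, -, rfl⟩) ⟨p, -, h⟩ <;> cases h

theorem statSeries_validZ : statSeries validZ (·.area) (·.width - 1) (·.height) =
    X 0 * (X 2 *
      statSeries validYZ (fun c => c.area + c.height) (·.width) (·.height)) +
      X 2 * (X 0 * (1 - X 0)⁻¹ * (statSeries validZ (·.area) (·.width - 1) (·.height) -
        statSeries validZ (fun c => c.area + (c.width - 1)) (·.width - 1) (·.height))) := by
  have hfin := finiteFibers_area_validZ
  rw [validZ_eq] at hfin
  have hinj_right : Set.InjOn (fun c : Construction => addRight c (c.height + 1))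
      validYZ :=
    fun _ _ _ _ h => (addRight.inj h).1
  have hinj_bottom : Set.InjOn (fun p : Construction × ℕ => addBottom p.1 p.2)
      (pairs validZ (·.width - 1)) :=
    fun _ _ _ _ h => Prod.ext (addBottom.inj h).1 (addBottom.inj h).2
  rw [← statSeries_pairs finiteFibers_area_validZ, X_two_mul_statSeries, X_two_mul_statSeries,
    X_zero_mul_statSeries]
  nth_rw 1 [validZ_eq]
  rw [statSeries_union ?_ hfin, statSeries_image hinj_right, statSeries_image hinj_bottom]
  · congr 1
    exact statSeries_congr (fun _ _ => rfl) (fun _ _ => rfl)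
      fun _ _ => max_eq_right (Nat.le_succ _)
  · rw [Set.disjoint_left]
    rintro _ ⟨c, -, rfl⟩ ⟨p, -, h⟩
    cases h

theorem X_zero_mul_statSeries_validZ (g h : Construction → ℕ) :
    X 0 * statSeries validZ (fun c => c.area + (c.width - 1)) g h =
      statSeries validZ (fun c => c.area + c.width) g h := by
  rw [X_zero_mul_statSeries]
  refine statSeries_congr (fun c hc => ?_) (fun _ _ => rfl) fun _ _ => rfl
  rw [add_assoc, Nat.sub_add_cancel hc.1.one_le_width]

theorem X_one_mul_statSeries_validZ (f h : Construction → ℕ) :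
    X 1 * statSeries validZ f (·.width - 1) h = statSeries validZ f (·.width) h := by
  rw [X_one_mul_statSeries]
  exact statSeries_congr (fun _ _ => rfl) (fun _ hc => Nat.sub_add_cancel hc.1.one_le_width)
    fun _ _ => rfl

theorem X_two_mul_statSeries_validZ (f g : Construction → ℕ) :
    X 2 * statSeries validZ f g (·.width - 1) = statSeries validZ f g (·.width) := by
  rw [X_two_mul_statSeries]
  exact statSeries_congr (fun _ _ => rfl) (fun _ _ => rfl)
    fun _ hc => Nat.sub_add_cancel hc.1.one_le_width

theorem Valid.width_cells_walk {c : Construction} (h : c.Valid) :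
    width (PrudentPolygon.cells c.walk) = c.width := by
  rw [h.cells_walk, h.width_cells]

theorem Valid.height_cells_walk {c : Construction} (h : c.Valid) :
    height (PrudentPolygon.cells c.walk) = c.height := by
  rw [h.cells_walk, h.height_cells]

end Construction

theorem genX_eq : genX = statSeries validX (·.area) (·.width) (·.height) := by
  ext m
  rw [coeff_statSeries]
  refine congrArg Nat.cast ((ncard_walks (fun w hw => hw.1.1) (P := fun c =>
    c.IsX ∧ c.area = m 0 ∧ c.width = m 1 ∧ c.height = m 2) fun {c} hc => ?_).trans ?_)
  · rw [Set.mem_ofPred_eq, hc.walk_mem_classX_iff, hc.area_cells_walk, hc.width_cells_walk,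
      hc.height_cells_walk]
  · simp only [validX, Set.mem_ofPred_eq, and_assoc]

theorem genY_eq : genY = statSeries validY (·.area) (·.height) (·.width) := by
  ext m
  rw [coeff_statSeries]
  refine congrArg Nat.cast ((ncard_walks (fun w hw => hw.1.1) (P := fun c =>
    (¬ c.IsX ∧ ¬ c.IsZ) ∧ c.area = m 0 ∧ c.height = m 1 ∧ c.width = m 2)
    fun {c} hc => ?_).trans ?_)
  · rw [Set.mem_ofPred_eq, hc.walk_mem_classY_iff, hc.area_cells_walk, hc.width_cells_walk,
      hc.height_cells_walk]
  · simp only [validY, Set.mem_ofPred_eq, and_assoc]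

theorem genZ_eq : genZ = statSeries validZ (·.area) (·.width - 1) (·.height) := by
  ext m
  rw [coeff_statSeries]
  refine congrArg Nat.cast ((ncard_walks (fun w hw => hw.1.1) (P := fun c =>
    c.IsZ ∧ c.area = m 0 ∧ c.width - 1 = m 1 ∧ c.height = m 2) fun {c} hc => ?_).trans ?_)
  · rw [Set.mem_ofPred_eq, hc.walk_mem_classZ_iff, hc.area_cells_walk, hc.width_cells_walk,
      hc.height_cells_walk, Nat.sub_eq_iff_eq_add hc.one_le_width]
  · simp only [validZ, Set.mem_ofPred_eq, and_assoc]

theorem genX_functional_equation : genX =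
    X 0 * X 2 * (1 - X 0)⁻¹ * (genX - substUV genX (X 0 * X 1) (X 2))
      + X 0 * X 2 * (1 - X 0)⁻¹ * (substUV genY (X 2) (X 1) - substUV genY (X 2) (X 0 * X 1))
      + X 0 * X 1 * X 2 * (1 - X 0)⁻¹ * (genZ - X 0 * substUV genZ (X 0 * X 1) (X 2)) := by
  have hfin : FiniteFibers valid (·.area) := finite_ofArea
  have hX := statSeries_validX
  rw [statSeries_valid hfin, statSeries_valid (hfin.add_right _), ← X_one_mul_statSeries_validZ,
    ← X_one_mul_statSeries_validZ, ← X_zero_mul_statSeries_validZ] at hX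
  rw [genX_eq, genY_eq, genZ_eq, substUV_statSeries_qu_v finiteFibers_area_validX,
    substUV_statSeries_v_u finiteFibers_area_validY,
    substUV_statSeries_v_qu finiteFibers_area_validY,
    substUV_statSeries_qu_v finiteFibers_area_validZ]
  linear_combination hX

theorem genY_functional_equation : genY = X 0 * X 1 * X 2
      + X 0 * X 2 * (1 - X 0)⁻¹ * (genY - substUV genY (X 0 * X 1) (X 2))
      + X 0 * X 2 ^ 2 * (1 - X 0)⁻¹ * (substUV genZ (X 2) (X 1) - substUV genZ (X 2) (X 0 * X 1))
      + X 0 * X 1 * X 2 * (substUV genX (X 0 * X 2) (X 1) + substUV genY (X 1) (X 0 * X 2)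
        + X 0 * X 2 * substUV genZ (X 0 * X 2) (X 1)) := by
  have hfin : FiniteFibers valid (·.area) := finite_ofArea
  have hY := statSeries_validY
  rw [statSeries_valid (hfin.add_right _), statSeries_validYZ hfin,
    statSeries_validYZ (hfin.add_right _), ← X_two_mul_statSeries_validZ,
    ← X_two_mul_statSeries_validZ, ← X_two_mul_statSeries_validZ,
    ← X_zero_mul_statSeries_validZ] at hY
  rw [genX_eq, genY_eq, genZ_eq, substUV_statSeries_qu_v finiteFibers_area_validY,
    substUV_statSeries_v_u finiteFibers_area_validZ,
    substUV_statSeries_v_qu finiteFibers_area_validZ,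
    substUV_statSeries_qv_u finiteFibers_area_validX,
    substUV_statSeries_u_qv finiteFibers_area_validY,
    substUV_statSeries_qv_u finiteFibers_area_validZ]
  linear_combination hY

theorem genZ_functional_equation : genZ =
    X 0 * X 2 * (1 - X 0)⁻¹ * (genZ - substUV genZ (X 0 * X 1) (X 2))
      + X 0 * X 2 * substUV genY (X 0 * X 2) (X 1)
      + X 0 * X 1 * X 2 * substUV genZ (X 1) (X 0 * X 2) := by
  have hfin : FiniteFibers valid (·.area) := finite_ofArea
  have hZ := statSeries_validZ
  rw [statSeries_validYZ (hfin.add_right _), ← X_one_mul_statSeries_validZ] at hZ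
  rw [genY_eq, genZ_eq, substUV_statSeries_qu_v finiteFibers_area_validZ,
    substUV_statSeries_qv_u finiteFibers_area_validY,
    substUV_statSeries_u_qv finiteFibers_area_validZ]
  linear_combination hZ

theorem coeff_genPA (n : ℕ) : PowerSeries.coeff n genPA = 8 * ((ofArea n).ncard : ℚ) := by
  rw [genPA, PowerSeries.coeff_mk, ncard_polygons_of_area, Nat.cast_mul, Nat.cast_ofNat]

theorem ncard_ofArea_eq_add (n : ℕ) : (ofArea n).ncard = {c ∈ validX | c.area = n}.ncard +
    {c ∈ validY | c.area = n}.ncard + {c ∈ validZ | c.area = n}.ncard := by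
  have hX := finiteFibers_area_validX n
  have hY := finiteFibers_area_validY n
  have hZ := finiteFibers_area_validZ n
  have hunion : ofArea n =
      {c ∈ validX | c.area = n} ∪ ({c ∈ validY | c.area = n} ∪ {c ∈ validZ | c.area = n}) := by
    ext c
    have hvalid := Set.ext_iff.1 validX_union_validY_union_validZ c
    simp only [ofArea, valid, Set.mem_union, Set.mem_ofPred_eq] at hvalid ⊢
    rw [← hvalid]
    tauto
  have hdisj {s t : Set Construction} (h : Disjoint s t) :
      Disjoint {c ∈ s | c.area = n} {c ∈ t | c.area = n} :=
    h.mono (Set.sep_subset _ _) (Set.sep_subset _ _)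
  rw [hunion, Set.ncard_union_eq _ hX (hY.union hZ), Set.ncard_union_eq _ hY hZ, add_assoc]
  · exact hdisj disjoint_validY_validZ
  · exact Set.disjoint_union_right.2 ((Set.disjoint_union_right.1 disjoint_validX).imp hdisj hdisj)

theorem genPA_eq : genPA = 8 * (evalOne genX + evalOne genY + evalOne genZ) := by
  have h8 : (8 : PowerSeries ℚ) = PowerSeries.C 8 := (map_ofNat PowerSeries.C 8).symm
  ext n
  rw [h8, PowerSeries.coeff_C_mul, map_add, map_add, genX_eq, genY_eq, genZ_eq,
    coeff_evalOne_statSeries finiteFibers_area_validX,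
    coeff_evalOne_statSeries finiteFibers_area_validY,
    coeff_evalOne_statSeries finiteFibers_area_validZ, coeff_genPA, ncard_ofArea_eq_add,
    Nat.cast_add, Nat.cast_add]

/-! ### Enumeration of the polygons of small area -/

theorem mem_ite_singleton {α : Type*} {p : Prop} [Decidable p] {a b : α} :
    (a ∈ if p then [b] else []) ↔ p ∧ a = b := by
  rw [List.mem_ite_nil_right, List.mem_singleton]

namespace Construction

instance : DecidablePred IsX
  | square => isFalse id
  | addTop c k => Nat.decLe k c.width
  | addRight _ _ => isFalse id
  | addBottom _ _ => isFalse id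

instance : DecidablePred IsZ
  | square => isFalse id
  | addTop _ _ => isFalse id
  | addRight c k => Nat.decLt c.height k
  | addBottom _ _ => isTrue trivial

/-- The constructions that continue `c` by adding a row or column of `k` cells. -/
def extensions (c : Construction) (k : ℕ) : List Construction :=
  (if k ≤ c.width + 1 then [addTop c k] else []) ++
    (if ¬ c.IsX ∧ k ≤ c.height + 1 then [addRight c k] else []) ++
      if c.IsZ ∧ k + 1 ≤ c.width then [addBottom c k] else []

/-- The list of the valid constructions of area `n`, for `n ≤ t`; the bound `t` on the depth makes
the recursion structural, so that the kernel can evaluate it. -/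
def enum : ℕ → ℕ → List Construction
  | 0, _ => []
  | t + 1, n => (if n = 1 then [square] else []) ++
      (List.range n).flatMap fun i => (enum t i).flatMap fun c => c.extensions (n - i)

/-- The construction before the last addition. -/
def parent : Construction → Construction
  | square => square
  | addTop c _ => c
  | addRight c _ => c
  | addBottom c _ => c

theorem mem_extensions {c d : Construction} {k : ℕ} : d ∈ c.extensions k ↔
    (k ≤ c.width + 1 ∧ d = addTop c k) ∨ (¬ c.IsX ∧ k ≤ c.height + 1 ∧ d = addRight c k) ∨
      (c.IsZ ∧ k + 1 ≤ c.width ∧ d = addBottom c k) := by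
  rw [extensions, List.mem_append, List.mem_append, mem_ite_singleton, mem_ite_singleton,
    mem_ite_singleton, or_assoc, and_assoc, and_assoc]

theorem parent_of_mem_extensions {c d : Construction} {k : ℕ} (h : d ∈ c.extensions k) :
    d.parent = c := by
  rcases mem_extensions.1 h with ⟨-, rfl⟩ | ⟨-, -, rfl⟩ | ⟨-, -, rfl⟩ <;> rfl

theorem square_notMem_extensions (c : Construction) (k : ℕ) : square ∉ c.extensions k := by
  intro h
  rcases mem_extensions.1 h with ⟨-, h⟩ | ⟨-, -, h⟩ | ⟨-, -, h⟩ <;> cases h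

theorem nodup_extensions (c : Construction) (k : ℕ) : (c.extensions k).Nodup := by
  rw [extensions]
  split_ifs <;> simp

theorem mem_ofArea_iff {c : Construction} {n : ℕ} : c ∈ ofArea n ↔
    (n = 1 ∧ c = square) ∨ ∃ i < n, ∃ d ∈ ofArea i, c ∈ d.extensions (n - i) := by
  constructor
  · rintro ⟨hc, rfl⟩
    cases c with
    | square => exact .inl ⟨rfl, rfl⟩
    | addTop d k =>
      refine .inr ⟨d.area, Nat.lt_add_of_pos_right hc.2.1, d, ⟨hc.1, rfl⟩, ?_⟩
      rw [Construction.area, Nat.add_sub_cancel_left, mem_extensions]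
      exact .inl ⟨hc.2.2, rfl⟩
    | addRight d k =>
      refine .inr ⟨d.area, Nat.lt_add_of_pos_right hc.2.2.1, d, ⟨hc.1, rfl⟩, ?_⟩
      rw [Construction.area, Nat.add_sub_cancel_left, mem_extensions]
      exact .inr (.inl ⟨hc.2.1, hc.2.2.2, rfl⟩)
    | addBottom d k =>
      refine .inr ⟨d.area, Nat.lt_add_of_pos_right hc.2.2.1, d, ⟨hc.1, rfl⟩, ?_⟩
      rw [Construction.area, Nat.add_sub_cancel_left, mem_extensions]
      exact .inr (.inr ⟨hc.2.1, hc.2.2.2, rfl⟩)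
  · rintro (⟨rfl, rfl⟩ | ⟨_, hi, d, ⟨hd, rfl⟩, hc⟩)
    · exact ⟨trivial, rfl⟩
    · have harea := Nat.add_sub_cancel' hi.le
      have hpos := Nat.sub_pos_of_lt hi
      rcases mem_extensions.1 hc with ⟨hk, rfl⟩ | ⟨hX, hk, rfl⟩ | ⟨hZ, hk, rfl⟩
      · exact ⟨⟨hd, hpos, hk⟩, harea⟩
      · exact ⟨⟨hd, hX, hpos, hk⟩, harea⟩
      · exact ⟨⟨hd, hZ, hpos, hk⟩, harea⟩

theorem mem_enum {t n : ℕ} (h : n ≤ t) (c : Construction) : c ∈ enum t n ↔ c ∈ ofArea n := by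
  induction t generalizing n c with
  | zero =>
    refine iff_of_false List.not_mem_nil fun hc => ?_
    have := hc.1.one_le_area.trans_eq hc.2
    omega
  | succ t ih =>
    rw [enum, List.mem_append, mem_ite_singleton, mem_ofArea_iff]
    simp only [List.mem_flatMap, List.mem_range]
    refine or_congr_right (exists_congr fun i => and_congr_right fun hi => ?_)
    simp only [ih (Nat.le_of_lt_succ (hi.trans_le h))]

theorem nodup_enum {t n : ℕ} (h : n ≤ t) : (enum t n).Nodup := by
  induction t generalizing n with
  | zero => exact List.nodup_nil
  | succ t ih =>
    have hle {i : ℕ} (hi : i ∈ List.range n) : i ≤ t :=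
      Nat.le_of_lt_succ ((List.mem_range.1 hi).trans_le h)
    rw [enum, List.nodup_append']
    refine ⟨by split_ifs <;> simp, List.nodup_flatMap.2 ⟨fun i hi => List.nodup_flatMap.2
      ⟨fun c _ => nodup_extensions c _, ?_⟩, ?_⟩, ?_⟩
    · refine (ih (hle hi)).imp fun {c d} hcd e hc hd => hcd ?_
      rw [← parent_of_mem_extensions hc, parent_of_mem_extensions hd]
    · refine List.nodup_range.imp_of_mem fun {i j} hi hj hij e hc hd => hij ?_
      obtain ⟨c, hc, hec⟩ := List.mem_flatMap.1 hc
      obtain ⟨d, hd, hed⟩ := List.mem_flatMap.1 hd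
      rw [← ((mem_enum (hle hi) c).1 hc).2, ← ((mem_enum (hle hj) d).1 hd).2,
        ← parent_of_mem_extensions hec, parent_of_mem_extensions hed]
    · intro c hc hd
      obtain ⟨-, rfl⟩ := mem_ite_singleton.1 hc
      simp only [List.mem_flatMap] at hd
      obtain ⟨i, -, d, -, hd⟩ := hd
      exact square_notMem_extensions d _ hd

theorem ncard_ofArea (n : ℕ) : (ofArea n).ncard = (enum n n).length := by
  classical
  have hofArea : ofArea n = ((enum n n).toFinset : Set Construction) := by
    ext c
    rw [Finset.mem_coe, List.mem_toFinset, mem_enum le_rfl]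
  rw [hofArea, Set.ncard_coe_finset, List.toFinset_card_of_nodup (nodup_enum le_rfl)]

theorem length_enum : (List.range 11).map (fun n => (enum n n).length) =
    [0, 1, 2, 5, 12, 29, 70, 167, 397, 935, 2191] := by
  decide +kernel

end Construction

theorem coeff_genPA_range : (List.range 11).map (fun n => PowerSeries.coeff n genPA) =
    [0, 8, 16, 40, 96, 232, 560, 1336, 3176, 7480, 17528] := by
  have h := congrArg (List.map fun n : ℕ => 8 * (n : ℚ)) length_enum
  rw [List.map_map] at h
  simp only [coeff_genPA, ncard_ofArea]
  refine h.trans ?_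
  norm_num

end PrudentPolygon

/-- `substUV genX a b` is `X(q, a, b)`, and similarly for `Y` and `Z`. The finiteness of the number
of prudent polygons of each area makes all the coefficients genuine cardinalities and all the sums
in `evalOne` finite. -/
theorem proposition2p2 (q u v : MvPowerSeries (Fin 3) ℚ) (hq : q = MvPowerSeries.X 0)
    (hu : u = MvPowerSeries.X 1) (hv : v = MvPowerSeries.X 2) :
    (∀ n : ℕ, {w | IsPrudentPolygon w ∧ area (cells w) = n}.Finite) ∧
    genX = q * v * (1 - q)⁻¹ * (genX - substUV genX (q * u) v)
      + q * v * (1 - q)⁻¹ * (substUV genY v u - substUV genY v (q * u))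
      + q * u * v * (1 - q)⁻¹ * (genZ - q * substUV genZ (q * u) v) ∧
    genY = q * u * v
      + q * v * (1 - q)⁻¹ * (genY - substUV genY (q * u) v)
      + q * v ^ 2 * (1 - q)⁻¹ * (substUV genZ v u - substUV genZ v (q * u))
      + q * u * v * (substUV genX (q * v) u + substUV genY u (q * v)
        + q * v * substUV genZ (q * v) u) ∧
    genZ = q * v * (1 - q)⁻¹ * (genZ - substUV genZ (q * u) v)
      + q * v * substUV genY (q * v) u + q * u * v * substUV genZ u (q * v) ∧
    genPA = 8 * (evalOne genX + evalOne genY + evalOne genZ) ∧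
    (List.range 11).map (fun n => PowerSeries.coeff n genPA)
      = [0, 8, 16, 40, 96, 232, 560, 1336, 3176, 7480, 17528] := by
  subst hq hu hv
  exact ⟨finite_polygons_of_area, genX_functional_equation, genY_functional_equation,
    genZ_functional_equation, genPA_eq, coeff_genPA_range⟩
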